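/- **Setting.** Let $(M,g)$ be a globally hyperbolic spacetime, $V_0,V_1$ complex vector bundles over $M$ with (non-degenerate) hermitian structures, and $P=P^*\in\mathrm{Diff}(M;V_1)$, $K\in\mathrm{Diff}(M;V_0,V_1)$ with $PK=0$, such that $D_0=K^*K$ and $D_1=P+KK^*$ are Green hyperbolic, with causal propagators $G_i=G_i^+-G_i^-$ (retarded minus advanced). Let $\Sigma$ be a smooth spacelike Cauchy surface, and let $\rho_i$ be Cauchy data maps on $\Sigma$ (a differential operator followed by restriction to $\Sigma$), with values in bundles $V_{\rho_i}$ with positive definite hermitian structure, for which the Cauchy problem $D_if=0$, $\rho_if=\varphi\in\Gamma_c(\Sigma;V_{\rho_i})$ has a unique space-compact solution. Let $G_{i\Sigma}$ be the invertible differential operators on $\Sigma$ (with inverse a differential operator) with $G_i=(\rho_iG_i)^*G_{i\Sigma}(\rho_iG_i)$, let $K_\Sigma\in\mathrm{Diff}(\Sigma;V_{\rho_0},V_{\rho_1})$ be the operator with $K_\Sigma\rho_0=\rho_1K$ on space-compact solutions of $D_0$, and put $K_\Sigma^\dagger=G_{0\Sigma}^{-1}K_\Sigma^*G_{1\Sigma}$.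 More generally $A^\dagger$ denotes the adjoint with respect to the forms $(\cdot|G_{i\Sigma}\,\cdot)$. **Function spaces.** For $i=0,1$ let $\mathcal H_i$ be a topological vector space with $\Gamma_c(\Sigma;V_{\rho_i})\subset\mathcal H_i\subset\Gamma(\Sigma;V_{\rho_i})$ continuously and $\Gamma_c$ dense, so that $\Gamma'\subset\mathcal H_i'\subset\Gamma_c'$; assume that if $x,y\in\mathcal H_i$ both define elements $\varphi,\psi$ of $\mathcal H_i'$ by $\varphi=(x|\cdot)$, $\psi=(y|\cdot)$ on $\Gamma_c$, then $\varphi(y)=\overline{\psi(x)}$. "$A:\mathcal H_i\to\mathcal H_j$" means continuously, and "$A:\mathcal H_i'\to\mathcal H_j'$" means that the formal adjoint $A^*$ maps $\mathcal H_j\to\mathcal H_i$ continuously. Assume $G_{i\Sigma}^{\pm1}:\mathcal H_i\to\mathcal H_i$, and $K_\Sigma:\mathcal H_0\to\mathcal H_1$, $\mathcal H_0'\to\mathcal H_1'$. Let $\lambda_{i\Sigma}^\pm:\mathcal H_i\to\mathcal H_i$ be formally self-adjoint with $\lambda_{i\Sigma}^+-\lambda_{i\Sigma}^-=\mathrm i^{-1}G_{i\Sigma}$,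 and put $c_i^\pm=\pm\mathrm i\,G_{i\Sigma}^{-1}\lambda_{i\Sigma}^\pm$ and $R_{-\infty}=c_1^+K_\Sigma-K_\Sigma c_0^+$ (so $c_1^\pm K_\Sigma-K_\Sigma c_0^\pm=\pm R_{-\infty}$). **Projection, weight, right inverse.** Let $\Pi:\mathcal H_1\to\mathcal H_1$, $\mathcal H_1'\to\mathcal H_1'$ be a projection whose kernel in $\mathcal H_1$ is the closure of $K_\Sigma\mathcal H_0$ (in particular this holds if $\mathrm{Ker}\,\Pi=\mathrm{Ran}\,K_\Sigma$ in $\mathcal H_1$). Let $\langle x\rangle$ be a smooth positive function on $\Sigma$ with $\langle x\rangle^{-1}:\mathcal H_i\to\mathcal H_i$, $\langle x\rangle G_{i\Sigma}\langle x\rangle^{-1}:\mathcal H_i\to\mathcal H_i$, $\langle x\rangle^{-1}K_\Sigma\langle x\rangle:\mathcal H_0\to\mathcal H_1$ and $\mathcal H_0'\to\mathcal H_1'$, $\langle x\rangle^{-1}c_0^\pm\langle x\rangle:\mathcal H_0\to\mathcal H_0$ and $\mathcal H_0'\to\mathcal H_0'$ ($c_0^\pm$ is extended to $\langle x\rangle\mathcal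 H_0$ accordingly). Let $B:\mathcal H_1\to\langle x\rangle\mathcal H_0$, $\mathcal H_1'\to\langle x\rangle\mathcal H_0'$ satisfy $K_\Sigma B=\mathbf 1-\Pi$. Set $$\tilde c_1^\pm=\Pi^\dagger c_1^\pm\Pi+B^\dagger c_0^\pm K_\Sigma^\dagger+K_\Sigma c_0^\pm B,\qquad \tilde\lambda_{1\Sigma}^\pm=\pm\mathrm i^{-1}G_{1\Sigma}\tilde c_1^\pm,$$ $$c_{1\,\mathrm{reg}}^\pm=\pm\big(B^\dagger R_{-\infty}^\dagger+\Pi^\dagger R_{-\infty}B\big),$$ where in $B^\dagger R_{-\infty}^\dagger=B^\dagger K_\Sigma^\dagger c_1^+-B^\dagger c_0^+K_\Sigma^\dagger$ and $\Pi^\dagger R_{-\infty}B=\Pi^\dagger c_1^+(\mathbf 1-\Pi)-\Pi^\dagger K_\Sigma c_0^+B$ the products $B^\dagger K_\Sigma^\dagger$ and $\Pi^\dagger K_\Sigma$ stand for their continuous extensions from $\Gamma_c$ to operators $\mathcal H_1\to\mathcal H_1$ and $\langle x\rangle\mathcal H_0\to\langle x\rangle\mathcal H_1$; these extensions exist (part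 of the claim). **Claim.** 1. $\tilde c_1^\pm$ is well defined and continuous $\langle x\rangle^{-1}\mathcal H_1\to\langle x\rangle\mathcal H_1$, hence linear and continuous $\Gamma_c(\Sigma;V_{\rho_1})\to\Gamma(\Sigma;V_{\rho_1})$. 2. On $\Gamma_c$ (for i and iv) respectively on $\langle x\rangle^{-1}\mathcal H_1$ (for ii, iii, v): i) $(\tilde c_1^\pm)^\dagger=\tilde c_1^\pm$; ii) $\tilde c_1^++\tilde c_1^-=\mathbf 1$; iii) $\tilde c_1^\pm$ maps $\mathrm{Ker}\,K_\Sigma^\dagger$ to $\mathrm{Ker}\,K_\Sigma^\dagger$, and also $\mathrm{Ran}\,K_\Sigma$ to $\mathrm{Ran}\,K_\Sigma$ (from $\langle x\rangle^{-1}\mathcal H_1\cap K_\Sigma\mathcal H_0$ to $K_\Sigma\langle x\rangle\mathcal H_0$); iv) $(f|\tilde\lambda_{1\Sigma}^\pm g)=(\Pi f|\lambda_{1\Sigma}^\pm\Pi g)$ for $f,g\in\mathrm{Ker}\,K_\Sigma^\dagger$, the right hand side being the duality pairing of $\Pi f\in\mathcal H_1'$ with $\lambda_{1\Sigma}^\pm\Pi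 g\in\mathcal H_1$; v) $c_1^\pm=\tilde c_1^\pm+c_{1\,\mathrm{reg}}^\pm$. In particular $\tilde\lambda_{1\Sigma}^\pm$ are gauge invariant. 3. If $\lambda_{1\Sigma}^\pm\ge0$ on $\Pi\,\mathrm{Ker}\,K_\Sigma^\dagger|_{\Gamma_c}$, then $\tilde\lambda_{1\Sigma}^\pm\ge0$ on $\mathrm{Ker}\,K_\Sigma^\dagger|_{\Gamma_c}$. 4. If $c_{1\,\mathrm{reg}}^+$ and $c_{1\,\mathrm{reg}}^-$ are smoothing, i.e. extend to continuous operators $\Gamma'(\Sigma;V_{\rho_1})\to\Gamma(\Sigma;V_{\rho_1})$, and $\lambda_{1\Sigma}^\pm$ are Hadamard, then $\tilde\lambda_{1\Sigma}^\pm$ are Hadamard. Here a pair $\lambda_\Sigma^\pm$ is Hadamard if $\lambda^\pm=(\rho_1G_1)^*\lambda_\Sigma^\pm(\rho_1G_1)$ are spacetime two-point functions for $D_1$ (continuous $\Gamma_c(M;V_1)\to\Gamma(M;V_1)$, formally self-adjoint, $\lambda^+-\lambda^-=\mathrm i^{-1}G_1$, $D_1\lambda^\pm=\lambda^\pm D_1=0$)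 with $\mathrm{WF}'(\lambda^\pm)\subset\mathcal N^\pm\times\mathcal N^\pm$, where $\mathcal N^\pm$ is the set of non-zero null covectors in the positive/negative energy cone. -/

import Mathlib

open scoped Manifold ContDiff Topology Bundle
open MeasureTheory Set Filter Complex

universe u v w h

noncomputable section

set_option linter.checkUnivs false

namespace GaugeFix

/-! ### Sections of complex vector bundles with hermitian structure -/

section Bundles

variable {n : ℕ} {M : Type u} [TopologicalSpace M] [ChartedSpace (EuclideanSpace ℝ (Fin n)) M]

/-- A smooth complex vector bundle of finite rank over the real manifold `M` (total space, fibres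
`E x`, model fibre `F`), together with a smooth fibrewise non-degenerate hermitian form
(antilinear in the first argument, of arbitrary signature). -/
structure HermBundle (n : ℕ) (M : Type u) [TopologicalSpace M]
    [ChartedSpace (EuclideanSpace ℝ (Fin n)) M] where
  F : Type v
  E : M → Type w
  [normF : NormedAddCommGroup F]
  [spaceF : NormedSpace ℂ F]
  [finF : FiniteDimensional ℂ F]
  [addE : ∀ x, AddCommGroup (E x)]
  [modE : ∀ x, Module ℂ (E x)]
  [topE : ∀ x, TopologicalSpace (E x)]
  [topTot : TopologicalSpace (Bundle.TotalSpace F E)]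
  [fib : FiberBundle F E]
  [vecC : VectorBundle ℂ F E]
  [vecR : VectorBundle ℝ F E]
  [smoothE : ContMDiffVectorBundle ∞ F E (𝓡 n)]
  form : ∀ x, E x →ₗ⋆[ℂ] E x →ₗ[ℂ] ℂ
  form_symm : ∀ x (a b : E x), form x a b = starRingEnd ℂ (form x b a)
  form_nondeg : ∀ x (a : E x), (∀ b, form x a b = 0) → a = 0
  form_smooth : ∀ s t : ∀ x, E x,
    ContMDiff (𝓡 n) ((𝓡 n).prod 𝓘(ℝ, F)) ∞ (fun x ↦ Bundle.TotalSpace.mk' F x (s x)) →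
    ContMDiff (𝓡 n) ((𝓡 n).prod 𝓘(ℝ, F)) ∞ (fun x ↦ Bundle.TotalSpace.mk' F x (t x)) →
    ContMDiff (𝓡 n) 𝓘(ℝ, ℂ) ∞ (fun x ↦ form x (s x) (t x))

attribute [instance] HermBundle.normF HermBundle.spaceF HermBundle.finF HermBundle.addE
  HermBundle.modE HermBundle.topE HermBundle.topTot HermBundle.fib HermBundle.vecC
  HermBundle.vecR HermBundle.smoothE

/-- The hermitian structure is positive definite. -/
def HermBundle.PosDef (V : HermBundle.{u, v, w} n M) : Prop :=
  ∀ x (a : V.E x), a ≠ 0 → 0 < (V.form x a a).re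

/-- Smoothness of a section. -/
def HermBundle.IsSmooth (V : HermBundle.{u, v, w} n M) (s : ∀ x, V.E x) : Prop :=
  ContMDiff (𝓡 n) ((𝓡 n).prod 𝓘(ℝ, V.F)) ∞ (fun x ↦ Bundle.TotalSpace.mk' V.F x (s x))

theorem HermBundle.isSmooth_smul (V : HermBundle.{u, v, w} n M) (c : ℂ) {s : ∀ x, V.E x}
    (hs : V.IsSmooth s) : V.IsSmooth (fun x ↦ c • s x) := by
  intro x₀
  have h := hs x₀
  rw [Bundle.contMDiffAt_section] at h ⊢
  have h2 : ContMDiffAt (𝓡 n) 𝓘(ℝ, V.F) ∞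
      (fun x ↦ c • (trivializationAt V.F V.E x₀ ⟨x, s x⟩).2) x₀ := by
    have hL : ContDiff ℝ ∞ (fun y : V.F ↦ c • y) := contDiff_const_smul c
    exact hL.contMDiff.contMDiffAt.comp x₀ h
  refine h2.congr_of_eventuallyEq ?_
  filter_upwards [(trivializationAt V.F V.E x₀).open_baseSet.mem_nhds
    (FiberBundle.mem_baseSet_trivializationAt' x₀)] with y hy
  exact ((trivializationAt V.F V.E x₀).linear ℂ hy).2 c (s y)

/-- `Γ(M;V)` as a subspace of all set-theoretic sections. -/
def HermBundle.secSubmodule (V : HermBundle.{u, v, w} n M) : Submodule ℂ (∀ x, V.E x) where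
  carrier := {s | V.IsSmooth s}
  add_mem' := fun ha hb ↦ ContMDiff.add_section ha hb
  zero_mem' := Bundle.contMDiff_zeroSection ℝ V.E
  smul_mem' := fun c _ hs ↦ V.isSmooth_smul c hs

/-- `Γ(M;V)`, the space of smooth sections. -/
def HermBundle.Sec (V : HermBundle.{u, v, w} n M) : Type (max u w) := ↥V.secSubmodule

instance (V : HermBundle.{u, v, w} n M) : AddCommGroup V.Sec :=
  inferInstanceAs (AddCommGroup ↥V.secSubmodule)

instance (V : HermBundle.{u, v, w} n M) : Module ℂ V.Sec :=
  inferInstanceAs (Module ℂ ↥V.secSubmodule)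

instance (V : HermBundle.{u, v, w} n M) : CoeFun V.Sec (fun _ ↦ ∀ x, V.E x) :=
  ⟨fun s ↦ s.1⟩

/-- The support of a section. -/
def HermBundle.supp (V : HermBundle.{u, v, w} n M) (s : V.Sec) : Set M := closure {x | s x ≠ 0}

/-- `Γ_c(M;V)`, the smooth sections with compact support. -/
def HermBundle.Secc (V : HermBundle.{u, v, w} n M) : Submodule ℂ V.Sec where
  carrier := {s | IsCompact (V.supp s)}
  add_mem' := by
    intro a b ha hb
    refine IsCompact.of_isClosed_subset (ha.union hb) isClosed_closure ?_
    refine closure_minimal ?_ (isClosed_closure.union isClosed_closure)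
    intro x hx
    by_contra hcon
    have h1 : a x = 0 := by
      by_contra h
      exact hcon (Or.inl (subset_closure h))
    have h2 : b x = 0 := by
      by_contra h
      exact hcon (Or.inr (subset_closure h))
    apply hx
    change a x + b x = 0
    rw [h1, h2, add_zero]
  zero_mem' := by
    have h : V.supp (0 : V.Sec) = ∅ := by
      unfold HermBundle.supp
      rw [closure_empty_iff]
      ext x
      simp only [Set.mem_ofPred_eq, mem_empty_iff_false, iff_false, not_not]
      rfl
    change IsCompact (V.supp (0 : V.Sec))
    rw [h]
    exact isCompact_empty
  smul_mem' := by
    intro c a ha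
    refine IsCompact.of_isClosed_subset ha isClosed_closure ?_
    refine closure_mono ?_
    intro x hx h
    apply hx
    change c • a x = 0
    rw [h, smul_zero]

/-- Multiplication of a section by a smooth real function. -/
def HermBundle.fmul (V : HermBundle.{u, v, w} n M) (f : C^∞⟮𝓡 n, M; ℝ⟯) : V.Sec →ₗ[ℂ] V.Sec where
  toFun s := ⟨fun x ↦ f x • s x, ContMDiff.smul_section f.contMDiff s.2⟩
  map_add' s t := by
    apply Subtype.ext
    funext x
    exact smul_add (f x) (s x) (t x)
  map_smul' c s := by
    apply Subtype.ext
    funext x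
    exact smul_comm (f x) c (s x)

/-- `∫ (u(x)|v(x))_V dμ`, the pairing of two sections (one of which has compact support in all
uses below), antilinear in `u`. -/
def HermBundle.pair [MeasurableSpace M] (V : HermBundle.{u, v, w} n M) (μ : Measure M)
    (s t : V.Sec) : ℂ := ∫ x, V.form x (s x) (t x) ∂μ

/-- Multiplication of a complex function by a real function. -/
def scalarMul (f : C^∞⟮𝓡 n, M; ℝ⟯) : (M → ℂ) →ₗ[ℂ] (M → ℂ) where
  toFun s := fun x ↦ f x • s x
  map_add' s t := by
    funext x
    exact smul_add (f x) (s x) (t x)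
  map_smul' c s := by
    funext x
    exact smul_comm (f x) c (s x)

end Bundles

/-! ### Differential operators

The algebraic definition: `A` has order `< k + 1` iff its commutators with multiplication by
smooth functions have order `< k`, and order `< 0` iff it vanishes. -/

/-- `A : X → Y` has order `< k` relative to actions `φ`, `ψ` of the functions on `X` and `Y`. -/
def OrderLT {R : Type*} {X Y : Type*} [AddCommGroup X] [Module ℂ X] [AddCommGroup Y] [Module ℂ Y]
    (φ : R → X →ₗ[ℂ] X) (ψ : R → Y →ₗ[ℂ] Y) : ℕ → (X →ₗ[ℂ] Y) → Prop
  | 0, A => A = 0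
  | k + 1, A => ∀ f, OrderLT φ ψ k (A ∘ₗ φ f - ψ f ∘ₗ A)

section DiffOps

variable {n : ℕ} {M : Type u} [TopologicalSpace M] [ChartedSpace (EuclideanSpace ℝ (Fin n)) M]
variable {m : ℕ} {S : Type u} [TopologicalSpace S] [ChartedSpace (EuclideanSpace ℝ (Fin m)) S]

/-- `A ∈ Diff(M;V,W)`. -/
def IsDiffOp {V W : HermBundle.{u, v, w} n M} (A : V.Sec →ₗ[ℂ] W.Sec) : Prop :=
  ∃ k, OrderLT V.fmul W.fmul k A

/-- A differential operator on `M` followed by the pullback along `ι : S → M`, with values in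
sections of a bundle over `S`: a differential operator along `ι`. -/
def IsDiffOpAlong (ι : C^∞⟮𝓡 m, S; 𝓡 n, M⟯) {V : HermBundle.{u, v, w} n M}
    {W : HermBundle.{u, v, w} m S} (A : V.Sec →ₗ[ℂ] W.Sec) : Prop :=
  ∃ k, OrderLT V.fmul (fun f : C^∞⟮𝓡 n, M; ℝ⟯ ↦ W.fmul (f.comp ι)) k A

/-- A scalar differential operator `Γ(M;V) → C^∞(M)`. -/
structure ScalarDiffOp (V : HermBundle.{u, v, w} n M) where
  op : V.Sec →ₗ[ℂ] (M → ℂ)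
  smooth : ∀ s, ContMDiff (𝓡 n) 𝓘(ℝ, ℂ) ∞ (op s)
  order : ∃ k, OrderLT V.fmul scalarMul k op

/-- `s ↦ (D s)|_K`, with values in the Banach space `C(K,ℂ)`. -/
def ScalarDiffOp.restrict {V : HermBundle.{u, v, w} n M} (D : ScalarDiffOp V)
    (K : TopologicalSpace.Compacts M) : V.Sec →ₗ[ℂ] C(K, ℂ) where
  toFun s := ⟨fun x ↦ D.op s x, (D.smooth s).continuous.comp continuous_subtype_val⟩
  map_add' s t := by
    ext x
    simp
  map_smul' c s := by
    ext x
    simp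

/-- The `C^∞` topology of `Γ(M;V)`: the locally convex topology of the seminorms
`sup_K |D s|`, with `K` compact and `D` a scalar differential operator. -/
instance (V : HermBundle.{u, v, w} n M) : TopologicalSpace V.Sec :=
  ⨅ p : TopologicalSpace.Compacts M × ScalarDiffOp V,
    TopologicalSpace.induced (p.2.restrict p.1) inferInstance

instance (V : HermBundle.{u, v, w} n M) : IsTopologicalAddGroup V.Sec :=
  topologicalAddGroup_iInf fun p ↦ topologicalAddGroup_induced (p.2.restrict p.1)

instance (V : HermBundle.{u, v, w} n M) : ContinuousSMul ℂ V.Sec :=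
  continuousSMul_iInf fun p ↦ continuousSMul_induced (p.2.restrict p.1)

/-- Continuity on `Γ_c(M;V)` with its inductive limit topology, for a linear map `A`: continuity
on the sections with support in `K`, for every compact `K`. -/
def ContinuousOnSecc (V : HermBundle.{u, v, w} n M) {X : Type*} [TopologicalSpace X]
    (A : V.Secc → X) : Prop :=
  ∀ K : Set M, IsCompact K → ContinuousOn A {s | V.supp s.1 ⊆ K}

/-- `A` and `A'` are formal adjoints of each other. -/
def IsFormalAdj [MeasurableSpace M] (μ : Measure M) {V W : HermBundle.{u, v, w} n M}
    (A : V.Sec →ₗ[ℂ] W.Sec) (A' : W.Sec →ₗ[ℂ] V.Sec) : Prop :=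
  ∀ (s : V.Secc) (t : W.Secc), W.pair μ t.1 (A s.1) = V.pair μ (A' t.1) s.1

/-- `A : Γ_c(M;V) → Γ(M;V)` is smoothing: it extends to a continuous linear operator
`Γ'(M;V) → Γ(M;V)`. Here `Γ'(M;V)` is the space of continuous antilinear forms on `Γ(M;V)`
(compactly supported distributions) with the strong dual topology, and `s ∈ Γ_c(M;V)` is
identified with `(·|s)_V`. -/
def IsSmoothing [MeasurableSpace M] (V : HermBundle.{u, v, w} n M) (μ : Measure M)
    (A : V.Secc → V.Sec) : Prop :=
  ∃ A' : (V.Sec →SL[starRingEnd ℂ] ℂ) →L[ℂ] V.Sec,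
    ∀ (s : V.Secc) (T : V.Sec →SL[starRingEnd ℂ] ℂ), (∀ t, T t = V.pair μ t s.1) → A' T = A s

/-- `μ` is the volume measure of the pseudo-Riemannian metric `g`: in every preferred chart its
density with respect to Lebesgue measure is `|det g_{ij}|^{1/2}`. -/
def IsVolume [MeasurableSpace M]
    (g : ∀ x : M, TangentSpace (𝓡 n) x →ₗ[ℝ] TangentSpace (𝓡 n) x →ₗ[ℝ] ℝ) (μ : Measure M) : Prop :=
  ∀ x : M,
    Measure.map (extChartAt (𝓡 n) x) (μ.restrict (extChartAt (𝓡 n) x).source) =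
      (volume.restrict (extChartAt (𝓡 n) x).target).withDensity fun y ↦
        ENNReal.ofReal (Real.sqrt |Matrix.det (Matrix.of fun i j : Fin n ↦
          g ((extChartAt (𝓡 n) x).symm y)
            (mfderiv 𝓘(ℝ, EuclideanSpace ℝ (Fin n)) (𝓡 n) (extChartAt (𝓡 n) x).symm y
              (EuclideanSpace.single i (1 : ℝ)))
            (mfderiv 𝓘(ℝ, EuclideanSpace ℝ (Fin n)) (𝓡 n) (extChartAt (𝓡 n) x).symm y
              (EuclideanSpace.single j (1 : ℝ))))|)

end DiffOps

/-! ### Globally hyperbolic spacetimes -/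

section Lorentz

/-- A time-oriented Lorentzian metric of signature `(-,+,…,+)`; the time orientation is given by a
timelike vector field. -/
structure PreSpacetime (n : ℕ) (M : Type u) [TopologicalSpace M]
    [ChartedSpace (EuclideanSpace ℝ (Fin n)) M] [IsManifold (𝓡 n) ∞ M] where
  g : ∀ x : M, TangentSpace (𝓡 n) x →ₗ[ℝ] TangentSpace (𝓡 n) x →ₗ[ℝ] ℝ
  g_symm : ∀ x (a b : TangentSpace (𝓡 n) x), g x a b = g x b a
  g_lorentz : ∀ x, ∃ a : TangentSpace (𝓡 n) x, g x a a < 0 ∧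
    ∀ b : TangentSpace (𝓡 n) x, g x a b = 0 → b ≠ 0 → 0 < g x b b
  g_smooth : ∀ X Y : ∀ x : M, TangentSpace (𝓡 n) x,
    ContMDiff (𝓡 n) (𝓡 n).tangent ∞ (fun x ↦ (⟨x, X x⟩ : TangentBundle (𝓡 n) M)) →
    ContMDiff (𝓡 n) (𝓡 n).tangent ∞ (fun x ↦ (⟨x, Y x⟩ : TangentBundle (𝓡 n) M)) →
    ContMDiff (𝓡 n) 𝓘(ℝ, ℝ) ∞ (fun x ↦ g x (X x) (Y x))
  time : ∀ x : M, TangentSpace (𝓡 n) x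
  time_smooth : ContMDiff (𝓡 n) (𝓡 n).tangent ∞ (fun x ↦ (⟨x, time x⟩ : TangentBundle (𝓡 n) M))
  time_timelike : ∀ x, g x (time x) (time x) < 0

variable {n : ℕ} {M : Type u} [TopologicalSpace M] [ChartedSpace (EuclideanSpace ℝ (Fin n)) M]
  [IsManifold (𝓡 n) ∞ M]

/-- The velocity vector of a curve. -/
def velocity (γ : ℝ → M) (t : ℝ) : TangentSpace (𝓡 n) (γ t) :=
  mfderiv 𝓘(ℝ, ℝ) (𝓡 n) γ t (1 : ℝ)

/-- Future directed causal vectors. -/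
def PreSpacetime.FutureCausal (X : PreSpacetime n M) (x : M) (v : TangentSpace (𝓡 n) x) : Prop :=
  v ≠ 0 ∧ X.g x v v ≤ 0 ∧ X.g x v (X.time x) < 0

/-- Future directed timelike vectors. -/
def PreSpacetime.FutureTimelike (X : PreSpacetime n M) (x : M) (v : TangentSpace (𝓡 n) x) : Prop :=
  X.g x v v < 0 ∧ X.g x v (X.time x) < 0

/-- `γ|_[0,1]` is a future directed causal curve from `p` to `q`. -/
def PreSpacetime.CausalCurve (X : PreSpacetime n M) (γ : ℝ → M) (p q : M) : Prop :=
  ContMDiff 𝓘(ℝ, ℝ) (𝓡 n) 1 γ ∧ γ 0 = p ∧ γ 1 = q ∧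
    ∀ t ∈ Icc (0 : ℝ) 1, X.FutureCausal (γ t) (velocity γ t)

/-- The causal future `J⁺(A)`. -/
def PreSpacetime.Jplus (X : PreSpacetime n M) (A : Set M) : Set M :=
  {q | ∃ p ∈ A, p = q ∨ ∃ γ, X.CausalCurve γ p q}

/-- The causal past `J⁻(A)`. -/
def PreSpacetime.Jminus (X : PreSpacetime n M) (A : Set M) : Set M :=
  {p | ∃ q ∈ A, p = q ∨ ∃ γ, X.CausalCurve γ p q}

/-- `A` is a Cauchy surface: every inextendible timelike curve meets it exactly once. -/
def PreSpacetime.IsCauchy (X : PreSpacetime n M) (A : Set M) : Prop :=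
  ∀ γ : ℝ → M, ContMDiff 𝓘(ℝ, ℝ) (𝓡 n) 1 γ → (∀ t, X.FutureTimelike (γ t) (velocity γ t)) →
    (¬ ∃ p, Tendsto γ atTop (𝓝 p)) → (¬ ∃ p, Tendsto γ atBot (𝓝 p)) → ∃! t, γ t ∈ A

/-- A globally hyperbolic spacetime (no closed causal curves, compact causal diamonds), with its
volume measure. Compactness of `J⁺(K) ∩ J⁻(L)` for compact `K`, `L` is equivalent to that of the
diamonds `J⁺(p) ∩ J⁻(q)`. -/
structure Spacetime (n : ℕ) (M : Type u) [TopologicalSpace M]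
    [ChartedSpace (EuclideanSpace ℝ (Fin n)) M] [IsManifold (𝓡 n) ∞ M] [MeasurableSpace M]
    extends PreSpacetime n M where
  causal : ∀ (p : M) (γ : ℝ → M), ¬ toPreSpacetime.CausalCurve γ p p
  diamond : ∀ K L : Set M, IsCompact K → IsCompact L →
    IsCompact (toPreSpacetime.Jplus K ∩ toPreSpacetime.Jminus L)
  vol : Measure M
  isVolume : IsVolume g vol

variable [MeasurableSpace M]

/-- `u ∈ Γ_sc(M;V)`: the support of `u` is space-compact. -/
def Spacetime.SpaceCompact (X : Spacetime n M) (V : HermBundle.{u, v, w} n M) (s : V.Sec) : Prop :=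
  ∃ K : Set M, IsCompact K ∧ V.supp s ⊆ X.Jplus K ∪ X.Jminus K

/-- Retarded and advanced propagators `G⁺`, `G⁻` of a (formally self-adjoint) operator `D`. -/
structure GreenOps (X : Spacetime n M) (V : HermBundle.{u, v, w} n M)
    (D : V.Sec →ₗ[ℂ] V.Sec) where
  ret : V.Secc →ₗ[ℂ] V.Sec
  adv : V.Secc →ₗ[ℂ] V.Sec
  D_ret : ∀ f, D (ret f) = f.1
  D_adv : ∀ f, D (adv f) = f.1
  ret_D : ∀ f g : V.Secc, g.1 = D f.1 → ret g = f.1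
  adv_D : ∀ f g : V.Secc, g.1 = D f.1 → adv g = f.1
  supp_ret : ∀ f, V.supp (ret f) ⊆ X.Jplus (V.supp f.1)
  supp_adv : ∀ f, V.supp (adv f) ⊆ X.Jminus (V.supp f.1)

/-- The causal propagator `G = G⁺ - G⁻`. -/
def GreenOps.G {X : Spacetime n M} {V : HermBundle.{u, v, w} n M} {D : V.Sec →ₗ[ℂ] V.Sec}
    (Gr : GreenOps X V D) : V.Secc →ₗ[ℂ] V.Sec := Gr.ret - Gr.adv

/-- A linear gauge theory in the subsidiary condition formalism: `P = P*`, `P K = 0`, and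
`D₀ = K* K`, `D₁ = P + K K*` are Green hyperbolic. -/
structure GaugeTheory (X : Spacetime n M) where
  V₀ : HermBundle.{u, v, w} n M
  V₁ : HermBundle.{u, v, w} n M
  P : V₁.Sec →ₗ[ℂ] V₁.Sec
  K : V₀.Sec →ₗ[ℂ] V₁.Sec
  Kstar : V₁.Sec →ₗ[ℂ] V₀.Sec
  P_diff : IsDiffOp P
  K_diff : IsDiffOp K
  Kstar_diff : IsDiffOp Kstar
  P_adj : IsFormalAdj X.vol P P
  K_adj : IsFormalAdj X.vol K Kstar
  PK : P ∘ₗ K = 0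
  Gr₀ : GreenOps X V₀ (Kstar ∘ₗ K)
  Gr₁ : GreenOps X V₁ (P + K ∘ₗ Kstar)

end Lorentz

/-! ### Cauchy data -/

section Cauchy

variable {d : ℕ} {M : Type u} [TopologicalSpace M]
  [ChartedSpace (EuclideanSpace ℝ (Fin (d + 1))) M] [IsManifold (𝓡 (d + 1)) ∞ M]
  [MeasurableSpace M]
  {S : Type u} [TopologicalSpace S] [ChartedSpace (EuclideanSpace ℝ (Fin d)) S]
  [IsManifold (𝓡 d) ∞ S] [MeasurableSpace S]

/-- A smooth spacelike Cauchy surface `ι : S → M`, with the induced volume measure. -/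
structure CauchySurface (X : Spacetime (d + 1) M) (S : Type u) [TopologicalSpace S]
    [ChartedSpace (EuclideanSpace ℝ (Fin d)) S] [IsManifold (𝓡 d) ∞ S] [MeasurableSpace S] where
  ι : C^∞⟮𝓡 d, S; 𝓡 (d + 1), M⟯
  embedding : Topology.IsEmbedding ι
  spacelike : ∀ (x : S) (a : TangentSpace (𝓡 d) x), a ≠ 0 →
    0 < X.g (ι x) (mfderiv (𝓡 d) (𝓡 (d + 1)) ι x a) (mfderiv (𝓡 d) (𝓡 (d + 1)) ι x a)
  cauchy : X.IsCauchy (range ι)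
  vol : Measure S
  isVolume : IsVolume (fun x ↦ (X.g (ι x)).compl₁₂
    (mfderiv (𝓡 d) (𝓡 (d + 1)) ι x).toLinearMap (mfderiv (𝓡 d) (𝓡 (d + 1)) ι x).toLinearMap) vol

/-- Cauchy data for `D` on a Cauchy surface: a bundle `W` with positive definite hermitian
structure, a trace operator `ρ` for which the Cauchy problem is well posed, and the operator `G_Σ`
characterized by `G = (ρG)* G_Σ (ρG)`. -/
structure CauchyData {X : Spacetime (d + 1) M} (Sg : CauchySurface X S)
    {V : HermBundle.{u, v, w} (d + 1) M} {D : V.Sec →ₗ[ℂ] V.Sec} (Gr : GreenOps X V D) where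
  W : HermBundle.{u, v, w} d S
  posDef : W.PosDef
  ρ : V.Sec →ₗ[ℂ] W.Sec
  ρ_diff : IsDiffOpAlong Sg.ι ρ
  ρ_sc : ∀ f, X.SpaceCompact V f → ρ f ∈ W.Secc
  wellPosed : ∀ φ : W.Secc, ∃! f : V.Sec, X.SpaceCompact V f ∧ D f = 0 ∧ ρ f = φ.1
  GS : W.Sec →ₗ[ℂ] W.Sec
  GSinv : W.Sec →ₗ[ℂ] W.Sec
  GS_diff : IsDiffOp GS
  GSinv_diff : IsDiffOp GSinv
  GS_inv : GS ∘ₗ GSinv = LinearMap.id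
  inv_GS : GSinv ∘ₗ GS = LinearMap.id
  GS_def : ∀ u v : V.Secc,
    V.pair X.vol u.1 (Gr.G v) = W.pair Sg.vol (ρ (Gr.G u)) (GS (ρ (Gr.G v)))

/-- Cauchy data for `D₀` and `D₁`, together with the operator `K_Σ` and its formal adjoint. -/
structure SurfaceTheory {X : Spacetime (d + 1) M} (Sg : CauchySurface X S)
    (T : GaugeTheory.{u, v, w} X) where
  C₀ : CauchyData Sg T.Gr₀
  C₁ : CauchyData Sg T.Gr₁
  KS : C₀.W.Sec →ₗ[ℂ] C₁.W.Sec
  KSstar : C₁.W.Sec →ₗ[ℂ] C₀.W.Sec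
  KS_diff : IsDiffOp KS
  KSstar_diff : IsDiffOp KSstar
  KS_def : ∀ f, X.SpaceCompact T.V₀ f → T.Kstar (T.K f) = 0 → KS (C₀.ρ f) = C₁.ρ (T.K f)
  KS_adj : IsFormalAdj Sg.vol KS KSstar

/-- The symplectic adjoint `K_Σ† = G₀_Σ⁻¹ K_Σ* G₁_Σ`. -/
def SurfaceTheory.Kdag {X : Spacetime (d + 1) M} {Sg : CauchySurface X S}
    {T : GaugeTheory.{u, v, w} X} (Q : SurfaceTheory Sg T) : Q.C₁.W.Sec →ₗ[ℂ] Q.C₀.W.Sec :=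
  Q.C₀.GSinv ∘ₗ Q.KSstar ∘ₗ Q.C₁.GS

end Cauchy

/-! ### Two-point functions and the Hadamard condition -/

section Hadamard

/-- `(x,ξ;y,η) ∉ WF'(λ)` for an operator `λ : Γ_c(M;V) → Γ(M;V)`. The covectors `ξ ∈ T*_x M` and
`η ∈ T*_y M` are written in the preferred charts at `x` and at `y`. -/
def NotMemWF {n : ℕ} {M : Type u} [TopologicalSpace M] [ChartedSpace (EuclideanSpace ℝ (Fin n)) M]
    [MeasurableSpace M] (V : HermBundle.{u, v, w} n M) (μ : Measure M) (lam : V.Secc → V.Sec)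
    (x : M) (ξ : EuclideanSpace ℝ (Fin n) →L[ℝ] ℝ)
    (y : M) (η : EuclideanSpace ℝ (Fin n) →L[ℝ] ℝ) : Prop :=
  ∃ U ∈ 𝓝 x, ∃ U' ∈ 𝓝 y, U ⊆ (chartAt (EuclideanSpace ℝ (Fin n)) x).source ∧
    U' ⊆ (chartAt (EuclideanSpace ℝ (Fin n)) y).source ∧
    ∃ C : Set ((EuclideanSpace ℝ (Fin n) →L[ℝ] ℝ) × (EuclideanSpace ℝ (Fin n) →L[ℝ] ℝ)),
      IsOpen C ∧ (ξ, η) ∈ C ∧ (∀ r : ℝ, 0 < r → ∀ p ∈ C, r • p ∈ C) ∧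
      ∀ a b : V.Secc, V.supp a.1 ⊆ U → V.supp b.1 ⊆ U' → ∀ N : ℕ, ∃ c : ℝ, ∀ p ∈ C,
        ∀ a' b' : V.Secc,
          (∀ z, a'.1 z = exp (I * (p.1 (extChartAt (𝓡 n) x z) : ℝ)) • a.1 z) →
          (∀ z, b'.1 z = exp (I * (p.2 (extChartAt (𝓡 n) y z) : ℝ)) • b.1 z) →
          ‖V.pair μ a'.1 (lam b')‖ ≤ c * ((1 + ‖p.1‖ + ‖p.2‖) ^ N)⁻¹

variable {d : ℕ} {M : Type u} [TopologicalSpace M]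
  [ChartedSpace (EuclideanSpace ℝ (Fin (d + 1))) M] [IsManifold (𝓡 (d + 1)) ∞ M]
  [MeasurableSpace M]
  {S : Type u} [TopologicalSpace S] [ChartedSpace (EuclideanSpace ℝ (Fin d)) S]
  [IsManifold (𝓡 d) ∞ S] [MeasurableSpace S]

/-- `(x,ξ) ∈ 𝒩^s`: `ξ` is a null covector in the positive (`s = 1`) or negative (`s = -1`) energy
cone. -/
def PreSpacetime.InCone {n : ℕ} {M : Type u} [TopologicalSpace M]
    [ChartedSpace (EuclideanSpace ℝ (Fin n)) M] [IsManifold (𝓡 n) ∞ M]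
    (X : PreSpacetime n M) (s : ℤˣ) (x : M) (ξ : EuclideanSpace ℝ (Fin n) →L[ℝ] ℝ) : Prop :=
  ξ ≠ 0 ∧ (∃ a : TangentSpace (𝓡 n) x, X.g x a a = 0 ∧ ∀ b : TangentSpace (𝓡 n) x, ξ b = X.g x a b) ∧
    ∀ b : TangentSpace (𝓡 n) x, X.FutureTimelike x b → 0 < ((s : ℤ) : ℝ) * ξ b

/-- A pair of spacetime two-point functions `λ^±` for `D`. -/
structure IsTwoPoint {n : ℕ} {M : Type u} [TopologicalSpace M]
    [ChartedSpace (EuclideanSpace ℝ (Fin n)) M] [IsManifold (𝓡 n) ∞ M] [MeasurableSpace M]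
    {X : Spacetime n M} {V : HermBundle.{u, v, w} n M} {D : V.Sec →ₗ[ℂ] V.Sec}
    (Gr : GreenOps X V D) (lam : ℤˣ → V.Secc → V.Sec) : Prop where
  linear : ∀ s, IsLinearMap ℂ (lam s)
  continuous : ∀ s, ContinuousOnSecc V (lam s)
  adj : ∀ s (a b : V.Secc), V.pair X.vol a.1 (lam s b) = V.pair X.vol (lam s a) b.1
  ccr : ∀ a, lam 1 a - lam (-1) a = I⁻¹ • Gr.G a
  D_lam : ∀ s a, D (lam s a) = 0
  lam_D : ∀ s (a b : V.Secc), b.1 = D a.1 → lam s b = 0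

/-- A pair of Cauchy surface two-point functions. -/
structure CauchyData.IsTwoPoint {X : Spacetime (d + 1) M} {Sg : CauchySurface X S}
    {V : HermBundle.{u, v, w} (d + 1) M} {D : V.Sec →ₗ[ℂ] V.Sec} {Gr : GreenOps X V D}
    (C : CauchyData Sg Gr) (lam : ℤˣ → C.W.Secc → C.W.Sec) : Prop where
  linear : ∀ s, IsLinearMap ℂ (lam s)
  continuous : ∀ s, ContinuousOnSecc C.W (lam s)
  adj : ∀ s (a b : C.W.Secc), C.W.pair Sg.vol a.1 (lam s b) = C.W.pair Sg.vol (lam s a) b.1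
  ccr : ∀ a, lam 1 a - lam (-1) a = I⁻¹ • C.GS a.1

/-- Cauchy surface two-point functions `λ_Σ^±` are Hadamard: the spacetime two-point functions
`λ^± = (ρG)* λ_Σ^± (ρG)` satisfy `WF'(λ^±) ⊆ 𝒩^± × 𝒩^±`. -/
def CauchyData.IsHadamard {X : Spacetime (d + 1) M} {Sg : CauchySurface X S}
    {V : HermBundle.{u, v, w} (d + 1) M} {D : V.Sec →ₗ[ℂ] V.Sec} {Gr : GreenOps X V D}
    (C : CauchyData Sg Gr) (lamS : ℤˣ → C.W.Secc → C.W.Sec) : Prop :=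
  C.IsTwoPoint lamS ∧ ∃ lam : ℤˣ → V.Secc → V.Sec, GaugeFix.IsTwoPoint Gr lam ∧
    (∀ s (u v : V.Secc) (a b : C.W.Secc), a.1 = C.ρ (Gr.G u) → b.1 = C.ρ (Gr.G v) →
      V.pair X.vol u.1 (lam s v) = C.W.pair Sg.vol a.1 (lamS s b)) ∧
    ∀ s x ξ y η, (ξ ≠ 0 ∨ η ≠ 0) → ¬ NotMemWF V X.vol (lam s) x ξ y η →
      X.InCone s x ξ ∧ X.InCone s y η

end Hadamard

/-! ### The spaces `ℋ` and operators on them -/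

section Spaces

variable {d : ℕ} {S : Type u} [TopologicalSpace S] [ChartedSpace (EuclideanSpace ℝ (Fin d)) S]
  [MeasurableSpace S]

/-- A topological vector space `ℋ` with `Γ_c(S;W) ⊂ ℋ ⊂ Γ(S;W)` (continuous inclusions, `Γ_c`
dense, so that `Γ' ⊂ ℋ' ⊂ Γ_c'`). The last field says that the two ways of pairing elements of
`ℋ ∩ ℋ'` agree: if the distributions `(x|·)` and `(y|·)` extend to elements `φ`, `ψ` of the dual
of `ℋ`, then `φ(y)` and `ψ(x)` are complex conjugate. -/
structure TestSpace (W : HermBundle.{u, v, w} d S) (μ : Measure S) where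
  H : Type h
  [addH : AddCommGroup H]
  [modH : Module ℂ H]
  [topH : TopologicalSpace H]
  [tagH : IsTopologicalAddGroup H]
  [smulH : ContinuousSMul ℂ H]
  incl : H →L[ℂ] W.Sec
  incl_inj : Function.Injective incl
  ofc : W.Secc →ₗ[ℂ] H
  incl_ofc : ∀ f, incl (ofc f) = f.1
  ofc_cont : ContinuousOnSecc W ofc
  ofc_dense : DenseRange ofc
  compat : ∀ (x y : H) (φ ψ : H →L[ℂ] ℂ), (∀ f : W.Secc, φ (ofc f) = W.pair μ (incl x) f.1) →
    (∀ f : W.Secc, ψ (ofc f) = W.pair μ (incl y) f.1) → φ y = starRingEnd ℂ (ψ x)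

attribute [instance] TestSpace.addH TestSpace.modH TestSpace.topH TestSpace.tagH TestSpace.smulH

variable {W W' : HermBundle.{u, v, w} d S} {μ : Measure S}

/-- The operator `A` on sections maps the space `X` continuously into the space `Y`; `op` is its
restriction `X → Y`. -/
structure Restr (X : TestSpace.{u, v, w, h} W μ) (Y : TestSpace.{u, v, w, h} W' μ)
    (A : W.Sec →ₗ[ℂ] W'.Sec) where
  op : X.H →L[ℂ] Y.H
  spec : ∀ f, Y.incl (op f) = A (X.incl f)

/-- A continuous operator `X → Y` that also acts between the duals `X' → Y'`, i.e. whose formal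
adjoint is continuous `Y → X`. -/
structure AdjOp (X : TestSpace.{u, v, w, h} W μ) (Y : TestSpace.{u, v, w, h} W' μ) where
  op : X.H →L[ℂ] Y.H
  adj : Y.H →L[ℂ] X.H
  spec : ∀ (f : W.Secc) (g : W'.Secc),
    W'.pair μ g.1 (Y.incl (op (X.ofc f))) = W.pair μ (X.incl (adj (Y.ofc g))) f.1

/-- A smooth positive weight function `⟨x⟩`. -/
structure Weight (d : ℕ) (S : Type u) [TopologicalSpace S]
    [ChartedSpace (EuclideanSpace ℝ (Fin d)) S] where
  wt : C^∞⟮𝓡 d, S; ℝ⟯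
  pos : ∀ x, 0 < wt x

/-- `⟨x⟩⁻¹`. -/
def Weight.inv (a : Weight d S) : C^∞⟮𝓡 d, S; ℝ⟯ :=
  ⟨fun x ↦ (a.wt x)⁻¹, fun x ↦ (a.wt.contMDiff x).inv₀ (a.pos x).ne'⟩

end Spaces

/-! ### Gauge fixing -/

section GaugeFixing

variable {d : ℕ} {M : Type u} [TopologicalSpace M]
  [ChartedSpace (EuclideanSpace ℝ (Fin (d + 1))) M] [IsManifold (𝓡 (d + 1)) ∞ M]
  [MeasurableSpace M]
  {S : Type u} [TopologicalSpace S] [ChartedSpace (EuclideanSpace ℝ (Fin d)) S]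
  [IsManifold (𝓡 d) ∞ S] [MeasurableSpace S]
  {X : Spacetime (d + 1) M} {Sg : CauchySurface X S} {T : GaugeTheory.{u, v, w} X}

/-- The spaces `ℋ_i`, the operators `G_iΣ^{±1}`, `K_Σ` on them, and Cauchy surface two-point
functions `λ_iΣ^±`. -/
structure TwoPointData (Q : SurfaceTheory.{u, v, w} Sg T) where
  H₀ : TestSpace.{u, v, w, h} Q.C₀.W Sg.vol
  H₁ : TestSpace.{u, v, w, h} Q.C₁.W Sg.vol
  G₀ : Restr H₀ H₀ Q.C₀.GS
  G₀inv : Restr H₀ H₀ Q.C₀.GSinv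
  G₁ : Restr H₁ H₁ Q.C₁.GS
  G₁inv : Restr H₁ H₁ Q.C₁.GSinv
  K : Restr H₀ H₁ Q.KS
  Kstar : Restr H₁ H₀ Q.KSstar
  lam₀ : ℤˣ → H₀.H →L[ℂ] H₀.H
  lam₁ : ℤˣ → H₁.H →L[ℂ] H₁.H
  lam₀_adj : ∀ s (f g : Q.C₀.W.Secc), Q.C₀.W.pair Sg.vol f.1 (H₀.incl (lam₀ s (H₀.ofc g))) =
    Q.C₀.W.pair Sg.vol (H₀.incl (lam₀ s (H₀.ofc f))) g.1
  lam₁_adj : ∀ s (f g : Q.C₁.W.Secc), Q.C₁.W.pair Sg.vol f.1 (H₁.incl (lam₁ s (H₁.ofc g))) =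
    Q.C₁.W.pair Sg.vol (H₁.incl (lam₁ s (H₁.ofc f))) g.1
  lam₀_ccr : lam₀ 1 - lam₀ (-1) = I⁻¹ • G₀.op
  lam₁_ccr : lam₁ 1 - lam₁ (-1) = I⁻¹ • G₁.op

variable {Q : SurfaceTheory.{u, v, w} Sg T}

/-- `c_0^± = ± i G_0Σ⁻¹ λ_0Σ^±`. -/
def TwoPointData.c₀ (L : TwoPointData.{u, v, w, h} Q) (s : ℤˣ) : L.H₀.H →L[ℂ] L.H₀.H :=
  (((s : ℤ) : ℂ) * I) • (L.G₀inv.op ∘L L.lam₀ s)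

/-- `c_1^± = ± i G_1Σ⁻¹ λ_1Σ^±`. -/
def TwoPointData.c₁ (L : TwoPointData.{u, v, w, h} Q) (s : ℤˣ) : L.H₁.H →L[ℂ] L.H₁.H :=
  (((s : ℤ) : ℂ) * I) • (L.G₁inv.op ∘L L.lam₁ s)

/-- `K_Σ†` on `ℋ_1`. -/
def TwoPointData.KdagH (L : TwoPointData.{u, v, w, h} Q) : L.H₁.H →L[ℂ] L.H₀.H :=
  L.G₀inv.op ∘L L.Kstar.op ∘L L.G₁.op

/-- The projection `Π`, the weight `⟨x⟩` and the operator `B = ⟨x⟩ b : ℋ_1 → ⟨x⟩ ℋ_0`, with the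
mapping properties of `G_iΣ`, `K_Σ`, `c_0^±` conjugated by the weight. -/
structure GaugeFixing (L : TwoPointData.{u, v, w, h} Q) where
  Pi : AdjOp L.H₁ L.H₁
  Pi_proj : Pi.op ∘L Pi.op = Pi.op
  Pi_ker : {f | Pi.op f = 0} = closure (range L.K.op)
  x : Weight d S
  xinv₀ : Restr L.H₀ L.H₀ (Q.C₀.W.fmul x.inv)
  xinv₁ : Restr L.H₁ L.H₁ (Q.C₁.W.fmul x.inv)
  xG₀ : Restr L.H₀ L.H₀ (Q.C₀.W.fmul x.wt ∘ₗ Q.C₀.GS ∘ₗ Q.C₀.W.fmul x.inv)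
  xG₁ : Restr L.H₁ L.H₁ (Q.C₁.W.fmul x.wt ∘ₗ Q.C₁.GS ∘ₗ Q.C₁.W.fmul x.inv)
  xK : Restr L.H₀ L.H₁ (Q.C₁.W.fmul x.inv ∘ₗ Q.KS ∘ₗ Q.C₀.W.fmul x.wt)
  xKstar : Restr L.H₁ L.H₀ (Q.C₀.W.fmul x.wt ∘ₗ Q.KSstar ∘ₗ Q.C₁.W.fmul x.inv)
  xc₀ : ℤˣ → AdjOp L.H₀ L.H₀
  xc₀_spec : ∀ s (f g : Q.C₀.W.Secc), g.1 = Q.C₀.W.fmul x.wt f.1 →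
    L.H₀.incl ((xc₀ s).op (L.H₀.ofc f)) = Q.C₀.W.fmul x.inv (L.H₀.incl (L.c₀ s (L.H₀.ofc g)))
  b : AdjOp L.H₁ L.H₀
  K_B : ∀ f, Q.KS (Q.C₀.W.fmul x.wt (L.H₀.incl (b.op f))) = L.H₁.incl f - L.H₁.incl (Pi.op f)

namespace GaugeFixing

variable {L : TwoPointData.{u, v, w, h} Q} (A : GaugeFixing L)

/-- `Π† = G_1Σ⁻¹ Π* G_1Σ`. -/
def Pidag : L.H₁.H →L[ℂ] L.H₁.H := L.G₁inv.op ∘L A.Pi.adj ∘L L.G₁.op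

/-- `g` belongs to the domain of `B† = G_1Σ⁻¹ B* G_0Σ`, with `B* = b* ⟨x⟩`. -/
def InDomBdag (g : Q.C₀.W.Sec) : Prop :=
  ∃ e : L.H₀.H, L.H₀.incl e = Q.C₀.W.fmul A.x.wt (Q.C₀.GS g)

open Classical in
/-- `B† = G_1Σ⁻¹ b* ⟨x⟩ G_0Σ`, extended by zero outside its domain. -/
def Bdag (g : Q.C₀.W.Sec) : Q.C₁.W.Sec :=
  if hg : A.InDomBdag g then L.H₁.incl (L.G₁inv.op (A.b.adj hg.choose)) else 0

/-- `c̃_1^± = Π† c_1^± Π + B† c_0^± K_Σ† + K_Σ c_0^± B`. -/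
def cTilde (s : ℤˣ) (f : L.H₁.H) : Q.C₁.W.Sec :=
  L.H₁.incl (A.Pidag (L.c₁ s (A.Pi.op f))) + A.Bdag (L.H₀.incl (L.c₀ s (L.KdagH f))) +
    Q.KS (Q.C₀.W.fmul A.x.wt (L.H₀.incl ((A.xc₀ s).op (A.b.op f))))

/-- `λ̃_1Σ^± = ± i⁻¹ G_1Σ c̃_1^±` on `Γ_c`. -/
def lamTilde (s : ℤˣ) (f : Q.C₁.W.Secc) : Q.C₁.W.Sec :=
  (((s : ℤ) : ℂ) * I⁻¹) • Q.C₁.GS (A.cTilde s (L.H₁.ofc f))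

/-- `E` is the continuous extension to `ℋ_1` of the operator `B† K_Σ†` on `Γ_c`. -/
def ExtendsBK (E : L.H₁.H →L[ℂ] L.H₁.H) : Prop :=
  ∀ f : Q.C₁.W.Secc, A.InDomBdag (Q.Kdag f.1) ∧ L.H₁.incl (E (L.H₁.ofc f)) = A.Bdag (Q.Kdag f.1)

/-- `⟨x⟩ J ⟨x⟩⁻¹` is the continuous extension to `⟨x⟩ ℋ_0` of the operator `Π† K_Σ` on `Γ_c`. -/
def ExtendsPiK (J : L.H₀.H →L[ℂ] L.H₁.H) : Prop :=
  ∀ f g : Q.C₀.W.Secc, g.1 = Q.C₀.W.fmul A.x.wt f.1 →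
    Q.C₁.W.fmul A.x.wt (L.H₁.incl (J (L.H₀.ofc f))) =
      L.H₁.incl (A.Pidag (L.K.op (L.H₀.ofc g)))

/-- `c_{1 reg}^± = ±(B† R† + Π† R B)` with `R = c_1⁺ K_Σ - K_Σ c_0⁺`, that is
`±(B†K_Σ† c_1⁺ - B† c_0⁺ K_Σ† + Π† c_1⁺ K_Σ B - Π† K_Σ c_0⁺ B)`, where `K_Σ B = 1 - Π` and the
products `B†K_Σ†` and `Π†K_Σ` stand for their continuous extensions `E` and `⟨x⟩ J ⟨x⟩⁻¹`. -/
def cReg (E : L.H₁.H →L[ℂ] L.H₁.H) (J : L.H₀.H →L[ℂ] L.H₁.H) (s : ℤˣ) (f : L.H₁.H) : Q.C₁.W.Sec :=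
  ((s : ℤ) : ℂ) •
    (L.H₁.incl (E (L.c₁ 1 f)) - A.Bdag (L.H₀.incl (L.c₀ 1 (L.KdagH f))) +
      L.H₁.incl (A.Pidag (L.c₁ 1 (f - A.Pi.op f))) -
      Q.C₁.W.fmul A.x.wt (L.H₁.incl (J ((A.xc₀ 1).op (A.b.op f)))))

end GaugeFixing

end GaugeFixing

end GaugeFix

end

/-!
The operators `K_Σ`, `G_iΣ` are differential operators, the projections and two-point functions
are operators on the test spaces `ℋ_i` with an adjoint (`AdjOp`), and the symmetry built into the
test spaces lets these adjoints be composed (`AdjOp.comp`). All algebraic claims follow from three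
identities. Since `K* K` annihilates the solutions of `D_0` and the causal propagators intertwine
`K` and `K*` (`GaugeTheory.K_G`, `GaugeTheory.Kstar_G`), one has `K_Σ† K_Σ = 0`
(`SurfaceTheory.Kdag_KS`). Transposing `K_Σ B = 1 - Π` gives `B† K_Σ† = 1 - Π†`
(`GaugeFixing.b_adj_xKG`). Together these give `Π† K_Σ = K_Σ`, and hence `Π† = 1` on `Ker Π`, the
closure of `Ran K_Σ` (`GaugeFixing.Pidag_sub`). With the weights moved to the right places, the
sum `c̃_1^+ + c̃_1^-` is therefore `Π† Π + B† K_Σ† + K_Σ B = Π† Π + (1 - Π†) + (1 - Π) = 1`, the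
decomposition `c_1^± = c̃_1^± + c_{1 reg}^±` is a cancellation (`GaugeFixing.c₁_eq`), and on `Ker
K_Σ†` only the term `Π† c_1^± Π` contributes to the hermitian form of `c̃_1^±`
(`GaugeFixing.pair_GS_cTilde`), which gives positivity.

For the Hadamard property, `λ_1Σ^±` and `λ̃_1Σ^±` differ by `±i⁻¹ G_1Σ c_{1 reg}^±`, which is
smoothing, and it remains to pull back with the Cauchy data map `ρG` of solutions
(`CauchyData.IsHadamard.of_isSmoothing`). This needs some functional analysis of `Γ(M;V)`.

* `ρG` has a weak adjoint `Γ_c(Σ) → Γ(M)`: by well-posedness and because every space-compact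
  solution is `G v` with `v` compactly supported (`GreenOps.exists_eq_G`), it sends `f` to the
  solution with Cauchy data `G_Σ⁻¹ f`. It extends to `(ρG)* : Γ(Σ) → Γ(M)`, since `ρG` maps the
  sections with support in one compact set to sections with support in another one
  (`exists_compact_supp`, by the Baire category theorem).
* An operator `Γ_c → Γ` with an adjoint of the same type is continuous
  (`continuousOnSecc_of_pair`), so that the pullbacks of two-point functions are two-point
  functions.
* Pairings of a smooth section with a section oscillating like `exp(i ξ·x)` decay rapidly in `ξ`
  (`IsSmoothMetric.exists_decay`). For oscillating sections `b_η` with covector `η`, the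
  functionals `(1 + |η|)^N ρG b_η` on `Γ(Σ)` are thus pointwise bounded, hence bounded in the
  strong dual by the Banach–Steinhaus theorem. A smoothing operator maps them to a bounded set of
  smooth sections, and the same argument for the other variable shows that the pullback of a
  smoothing operator has no wave front set (`IsSmoothing.exists_decay`).

The topology of `Γ(M;V)` is defined by all differential operators. That it behaves like a Fréchet
space is proved by mapping `ℓ¹` into it: a bounded family of sections can be summed with summable
coefficients (`HermBundle.exists_sum`), and a linear map from a Banach space to `Γ(M;V)` is
continuous if it is weakly continuous (`HermBundle.continuous_of_pair`), because the derivatives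
at a point are limits of difference quotients, values are limits of averages, and differential
operators depend on finitely many derivatives (`OrderLT.eq_zero_of_jet`).
-/

noncomputable section

set_option linter.checkUnivs false
set_option linter.unusedSectionVars false

namespace GaugeFix

/-! ### Cutoff functions and sections -/

section Basics

variable {n : ℕ} {M : Type u} [TopologicalSpace M] [ChartedSpace (EuclideanSpace ℝ (Fin n)) M]

theorem HermBundle.fmul_apply (V : HermBundle.{u, v, w} n M) (f : C^∞⟮𝓡 n, M; ℝ⟯) (s : V.Sec)
    (x : M) : V.fmul f s x = f x • s x := rfl

theorem HermBundle.add_apply (V : HermBundle.{u, v, w} n M) (s t : V.Sec) (x : M) :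
    (s + t) x = s x + t x := rfl

theorem HermBundle.sub_apply (V : HermBundle.{u, v, w} n M) (s t : V.Sec) (x : M) :
    (s - t) x = s x - t x := rfl

theorem HermBundle.neg_apply (V : HermBundle.{u, v, w} n M) (s : V.Sec) (x : M) :
    (-s) x = -s x := rfl

theorem HermBundle.smul_apply (V : HermBundle.{u, v, w} n M) (c : ℂ) (s : V.Sec) (x : M) :
    (c • s) x = c • s x := rfl

theorem HermBundle.zero_apply (V : HermBundle.{u, v, w} n M) (x : M) :
    (0 : V.Sec) x = 0 := rfl

theorem HermBundle.sec_ext {V : HermBundle.{u, v, w} n M} {s t : V.Sec} (h : ∀ x, s x = t x) :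
    s = t := Subtype.ext (funext h)

theorem HermBundle.isClosed_supp (V : HermBundle.{u, v, w} n M) (s : V.Sec) :
    IsClosed (V.supp s) := isClosed_closure

theorem HermBundle.eq_zero_of_notMem_supp {V : HermBundle.{u, v, w} n M} {s : V.Sec} {x : M}
    (hx : x ∉ V.supp s) : s x = 0 := by
  by_contra h
  exact hx (subset_closure h)

theorem HermBundle.supp_subset_of_closed {V : HermBundle.{u, v, w} n M} {s : V.Sec} {A : Set M}
    (hA : IsClosed A) (h : ∀ x, x ∉ A → s x = 0) : V.supp s ⊆ A := by
  refine closure_minimal (fun x hx ↦ ?_) hA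
  by_contra hxA
  exact hx (h x hxA)

theorem HermBundle.notMem_supp_iff {V : HermBundle.{u, v, w} n M} {s : V.Sec} {x : M} :
    x ∉ V.supp s ↔ ∀ᶠ y in 𝓝 x, s y = 0 := by
  unfold HermBundle.supp
  rw [mem_closure_iff_frequently, Filter.not_frequently]
  simp

theorem HermBundle.mem_Secc_of_subset {V : HermBundle.{u, v, w} n M} {s : V.Sec} {K : Set M}
    (hK : IsCompact K) (h : V.supp s ⊆ K) : s ∈ V.Secc :=
  hK.of_isClosed_subset (V.isClosed_supp s) h

theorem HermBundle.supp_fmul_subset {V : HermBundle.{u, v, w} n M} (f : C^∞⟮𝓡 n, M; ℝ⟯)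
    (s : V.Sec) : V.supp (V.fmul f s) ⊆ V.supp s ∩ tsupport f := by
  refine HermBundle.supp_subset_of_closed ((V.isClosed_supp s).inter (isClosed_tsupport f)) ?_
  intro x hx
  rw [V.fmul_apply]
  by_cases h : x ∈ V.supp s
  · rw [image_eq_zero_of_notMem_tsupport (fun h' ↦ hx ⟨h, h'⟩), zero_smul]
  · rw [HermBundle.eq_zero_of_notMem_supp h, smul_zero]

/-- The product of a compactly supported section with a smooth function. -/
def HermBundle.fmulc (V : HermBundle.{u, v, w} n M) (f : C^∞⟮𝓡 n, M; ℝ⟯) (s : V.Secc) : V.Secc :=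
  ⟨V.fmul f s.1, HermBundle.mem_Secc_of_subset s.2
    ((HermBundle.supp_fmul_subset f s.1).trans inter_subset_left)⟩

theorem HermBundle.fmul_mem_Secc (V : HermBundle.{u, v, w} n M) {f : C^∞⟮𝓡 n, M; ℝ⟯}
    (hf : HasCompactSupport f) (s : V.Sec) : V.fmul f s ∈ V.Secc :=
  HermBundle.mem_Secc_of_subset hf ((HermBundle.supp_fmul_subset f s).trans inter_subset_right)

theorem HermBundle.supp_add_subset {V : HermBundle.{u, v, w} n M} (s t : V.Sec) :
    V.supp (s + t) ⊆ V.supp s ∪ V.supp t := by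
  refine HermBundle.supp_subset_of_closed ((V.isClosed_supp s).union (V.isClosed_supp t)) ?_
  intro x hx
  rw [mem_union, not_or] at hx
  rw [V.add_apply, HermBundle.eq_zero_of_notMem_supp hx.1, HermBundle.eq_zero_of_notMem_supp hx.2,
    add_zero]

theorem HermBundle.supp_sub_subset {V : HermBundle.{u, v, w} n M} (s t : V.Sec) :
    V.supp (s - t) ⊆ V.supp s ∪ V.supp t := by
  refine HermBundle.supp_subset_of_closed ((V.isClosed_supp s).union (V.isClosed_supp t)) ?_
  intro x hx
  rw [mem_union, not_or] at hx
  rw [V.sub_apply, HermBundle.eq_zero_of_notMem_supp hx.1, HermBundle.eq_zero_of_notMem_supp hx.2,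
    sub_zero]

variable [T2Space M] [SecondCountableTopology M] [IsManifold (𝓡 n) ∞ M]

theorem exists_cutoff {K U : Set M} (hK : IsCompact K) (hU : IsOpen U) (hKU : K ⊆ U) :
    ∃ χ : C^∞⟮𝓡 n, M; ℝ⟯, (∀ᶠ x in 𝓝ˢ K, χ x = 1) ∧ HasCompactSupport χ ∧ tsupport χ ⊆ U ∧
      ∀ x, χ x ∈ Icc (0 : ℝ) 1 := by
  have : LocallyCompactSpace M := Manifold.locallyCompact_of_finiteDimensional (𝓡 n)
  obtain ⟨L, hL, hKL, hLU⟩ := exists_compact_between hK hU hKU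
  obtain ⟨χ, h1, h0, hI⟩ := exists_contMDiffMap_one_nhds_of_subset_interior (n := ⊤) (𝓡 n)
    hK.isClosed hKL
  have hs : tsupport χ ⊆ L := by
    refine closure_minimal (fun x hx ↦ ?_) hL.isClosed
    by_contra hxL
    exact hx (h0 x hxL)
  exact ⟨χ, h1, hL.of_isClosed_subset (isClosed_tsupport _) hs, hs.trans hLU, hI⟩

end Basics

/-! ### Local trivializations -/

section Local

variable {n : ℕ} {M : Type u} [TopologicalSpace M] [ChartedSpace (EuclideanSpace ℝ (Fin n)) M]

/-- The domain around `x₀` on which both the preferred chart of `M` and the preferred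
trivialization of `V` are defined. -/
def HermBundle.dom (V : HermBundle.{u, v, w} n M) (x₀ : M) : Set M :=
  (extChartAt (𝓡 n) x₀).source ∩ (trivializationAt V.F V.E x₀).baseSet

theorem HermBundle.isOpen_dom (V : HermBundle.{u, v, w} n M) (x₀ : M) : IsOpen (V.dom x₀) :=
  (isOpen_extChartAt_source x₀).inter (trivializationAt V.F V.E x₀).open_baseSet

theorem HermBundle.mem_dom (V : HermBundle.{u, v, w} n M) (x₀ : M) : x₀ ∈ V.dom x₀ :=
  ⟨mem_extChartAt_source x₀, FiberBundle.mem_baseSet_trivializationAt' x₀⟩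

/-- The trivialized value at `x` of a section, as an element of the model fibre. -/
def HermBundle.triv (V : HermBundle.{u, v, w} n M) (x₀ : M) (s : V.Sec) (x : M) : V.F :=
  (trivializationAt V.F V.E x₀ ⟨x, s x⟩).2

theorem HermBundle.contMDiffOn_triv (V : HermBundle.{u, v, w} n M) (x₀ : M) (s : V.Sec) :
    ContMDiffOn (𝓡 n) 𝓘(ℝ, V.F) ∞ (V.triv x₀ s) (trivializationAt V.F V.E x₀).baseSet :=
  ((trivializationAt V.F V.E x₀).contMDiffOn_section_baseSet_iff).1 s.2.contMDiffOn

theorem HermBundle.triv_add (V : HermBundle.{u, v, w} n M) {x₀ x : M} (hx : x ∈ V.dom x₀)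
    (s t : V.Sec) : V.triv x₀ (s + t) x = V.triv x₀ s x + V.triv x₀ t x :=
  ((trivializationAt V.F V.E x₀).linear ℂ hx.2).1 (s x) (t x)

theorem HermBundle.triv_smul (V : HermBundle.{u, v, w} n M) {x₀ x : M} (hx : x ∈ V.dom x₀)
    (c : ℂ) (s : V.Sec) : V.triv x₀ (c • s) x = c • V.triv x₀ s x :=
  ((trivializationAt V.F V.E x₀).linear ℂ hx.2).2 c (s x)

theorem HermBundle.triv_fmul (V : HermBundle.{u, v, w} n M) {x₀ x : M} (hx : x ∈ V.dom x₀)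
    (f : C^∞⟮𝓡 n, M; ℝ⟯) (s : V.Sec) : V.triv x₀ (V.fmul f s) x = f x • V.triv x₀ s x :=
  ((trivializationAt V.F V.E x₀).linear ℝ hx.2).2 (f x) (s x)

/-- The section `x ↦ χ(x) h(φ(x))` built from a function `h` with values in the model fibre, in
the preferred chart `φ` and the preferred trivialization at `x₀`. -/
def HermBundle.ofLocal (V : HermBundle.{u, v, w} n M) (x₀ : M)
    (g : EuclideanSpace ℝ (Fin n) → V.F) (χ : M → ℝ) (x : M) : V.E x :=
  χ x • (trivializationAt V.F V.E x₀).symm x (g (extChartAt (𝓡 n) x₀ x))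

theorem HermBundle.triv_ofLocal (V : HermBundle.{u, v, w} n M) {x₀ x : M} (hx : x ∈ V.dom x₀)
    (g : EuclideanSpace ℝ (Fin n) → V.F) (χ : M → ℝ) :
    (trivializationAt V.F V.E x₀ ⟨x, V.ofLocal x₀ g χ x⟩).2 =
      χ x • g (extChartAt (𝓡 n) x₀ x) := by
  unfold HermBundle.ofLocal
  rw [((trivializationAt V.F V.E x₀).linear ℝ hx.2).2]
  congr 1
  have := (trivializationAt V.F V.E x₀).apply_mk_symm hx.2 (g (extChartAt (𝓡 n) x₀ x))
  rw [this]

theorem HermBundle.isSmooth_of_eventually (V : HermBundle.{u, v, w} n M) {s : ∀ x, V.E x}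
    (h : ∀ x₀, ∃ t : V.Sec, ∀ᶠ x in 𝓝 x₀, s x = t x) : V.IsSmooth s := by
  intro x₀
  obtain ⟨t, ht⟩ := h x₀
  refine (t.2 x₀).congr_of_eventuallyEq ?_
  filter_upwards [ht] with x hx
  rw [hx]

/-- A section is determined at `x ∈ dom x₀` by its trivialized value. -/
theorem HermBundle.triv_inj (V : HermBundle.{u, v, w} n M) {x₀ x : M} (hx : x ∈ V.dom x₀)
    {a b : V.E x} (hab : (trivializationAt V.F V.E x₀ ⟨x, a⟩).2 =
      (trivializationAt V.F V.E x₀ ⟨x, b⟩).2) : a = b := by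
  have h1 := (trivializationAt V.F V.E x₀).symm_apply_apply_mk hx.2 a
  have h2 := (trivializationAt V.F V.E x₀).symm_apply_apply_mk hx.2 b
  rw [← h1, ← h2, hab]

variable [IsManifold (𝓡 n) ∞ M]

theorem HermBundle.isSmooth_ofLocal (V : HermBundle.{u, v, w} n M) (x₀ : M)
    {g : EuclideanSpace ℝ (Fin n) → V.F} {χ : C^∞⟮𝓡 n, M; ℝ⟯} (hχ : tsupport χ ⊆ V.dom x₀)
    (hg : ∀ x ∈ V.dom x₀, ContDiffAt ℝ ∞ g (extChartAt (𝓡 n) x₀ x)) :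
    V.IsSmooth (V.ofLocal x₀ g χ) := by
  intro x
  by_cases hx : x ∈ V.dom x₀
  · rw [(trivializationAt V.F V.E x₀).contMDiffAt_section_iff hx.2]
    have h1 : ContMDiffAt (𝓡 n) 𝓘(ℝ, V.F) ∞ (fun z ↦ χ z • g (extChartAt (𝓡 n) x₀ z)) x := by
      have h3 : ContMDiffAt (𝓡 n) 𝓘(ℝ, EuclideanSpace ℝ (Fin n)) ∞ (extChartAt (𝓡 n) x₀) x :=
        contMDiffAt_extChartAt' (by simpa using hx.1)
      exact χ.contMDiff.contMDiffAt.smul ((hg x hx).contMDiffAt.comp x h3)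
    refine h1.congr_of_eventuallyEq ?_
    filter_upwards [(V.isOpen_dom x₀).mem_nhds hx] with z hz
    exact V.triv_ofLocal hz g χ
  · have h0 : ∀ᶠ z in 𝓝 x, V.ofLocal x₀ g χ z = 0 := by
      filter_upwards [(isClosed_tsupport χ).isOpen_compl.mem_nhds (fun h ↦ hx (hχ h))] with z hz
      unfold HermBundle.ofLocal
      rw [image_eq_zero_of_notMem_tsupport hz, zero_smul]
    refine ((0 : V.Sec).2 x).congr_of_eventuallyEq ?_
    filter_upwards [h0] with z hz
    rw [hz]
    rfl

variable [T2Space M] [SecondCountableTopology M]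

/-- Every vector extends to a smooth section with compact support near its base point. -/
theorem HermBundle.exists_sec (V : HermBundle.{u, v, w} n M) (x₀ : M) (a : V.E x₀) :
    ∃ s : V.Secc, s.1 x₀ = a := by
  obtain ⟨χ, h1, hc, hs, -⟩ := exists_cutoff (n := n) (isCompact_singleton (x := x₀))
    (V.isOpen_dom x₀) (singleton_subset_iff.2 (V.mem_dom x₀))
  let g : EuclideanSpace ℝ (Fin n) → V.F := fun _ ↦ (trivializationAt V.F V.E x₀ ⟨x₀, a⟩).2
  let s : V.Sec := ⟨V.ofLocal x₀ g χ, V.isSmooth_ofLocal x₀ hs fun _ _ ↦ contDiffAt_const⟩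
  have hsc : s ∈ V.Secc := by
    refine HermBundle.mem_Secc_of_subset hc (HermBundle.supp_subset_of_closed
      (isClosed_tsupport χ) fun x hx ↦ ?_)
    change χ x • _ = _
    rw [image_eq_zero_of_notMem_tsupport hx, zero_smul]
  refine ⟨⟨s, hsc⟩, V.triv_inj (V.mem_dom x₀) ?_⟩
  refine (V.triv_ofLocal (V.mem_dom x₀) g χ).trans ?_
  rw [(h1.self_of_nhdsSet x₀ rfl), one_smul]

end Local

/-! ### Differential operators: locality, composition, continuity -/

section Order

variable {R X Y Z : Type*} [AddCommGroup X] [Module ℂ X] [AddCommGroup Y] [Module ℂ Y]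
  [AddCommGroup Z] [Module ℂ Z] {φ : R → X →ₗ[ℂ] X} {ψ : R → Y →ₗ[ℂ] Y} {θ : R → Z →ₗ[ℂ] Z}

theorem OrderLT.zero (k : ℕ) : OrderLT φ ψ k (0 : X →ₗ[ℂ] Y) := by
  induction k with
  | zero => rfl
  | succ k ih =>
    intro f
    simpa using ih

theorem OrderLT.add {k : ℕ} {A B : X →ₗ[ℂ] Y} (hA : OrderLT φ ψ k A) (hB : OrderLT φ ψ k B) :
    OrderLT φ ψ k (A + B) := by
  induction k generalizing A B with
  | zero =>
    change A + B = 0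
    rw [show A = 0 from hA, show B = 0 from hB, add_zero]
  | succ k ih =>
    intro f
    have := ih (hA f) (hB f)
    convert this using 1
    rw [LinearMap.add_comp, LinearMap.comp_add]
    abel

theorem OrderLT.succ {k : ℕ} {A : X →ₗ[ℂ] Y} (hA : OrderLT φ ψ k A) : OrderLT φ ψ (k + 1) A := by
  induction k generalizing A with
  | zero =>
    rw [show A = 0 from hA]
    exact OrderLT.zero _
  | succ k ih => exact fun f ↦ ih (hA f)

theorem OrderLT.mono {k l : ℕ} (hkl : k ≤ l) {A : X →ₗ[ℂ] Y} (hA : OrderLT φ ψ k A) :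
    OrderLT φ ψ l A := by
  induction hkl with
  | refl => exact hA
  | step _ ih => exact ih.succ

/-- The orders of differential operators add under composition: the commutator with a function obeys
the Leibniz rule. -/
theorem OrderLT.comp {k l : ℕ} {A : Y →ₗ[ℂ] Z} {B : X →ₗ[ℂ] Y} (hA : OrderLT ψ θ k A)
    (hB : OrderLT φ ψ l B) : OrderLT φ θ (k + l) (A ∘ₗ B) := by
  suffices H : ∀ m k l (A : Y →ₗ[ℂ] Z) (B : X →ₗ[ℂ] Y), k + l = m → OrderLT ψ θ k A →
      OrderLT φ ψ l B → OrderLT φ θ m (A ∘ₗ B) from H _ k l A B rfl hA hB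
  clear hA hB A B k l
  intro m
  induction m with
  | zero =>
    intro k l A B hkl hA hB
    obtain rfl : k = 0 := by omega
    rw [show A = 0 from hA, LinearMap.zero_comp]
    exact OrderLT.zero _
  | succ m ih =>
    intro k l A B hkl hA hB f
    have hsplit : (A ∘ₗ B) ∘ₗ φ f - θ f ∘ₗ A ∘ₗ B =
        A ∘ₗ (B ∘ₗ φ f - ψ f ∘ₗ B) + (A ∘ₗ ψ f - θ f ∘ₗ A) ∘ₗ B := by
      ext x
      simp
    rw [hsplit]
    refine OrderLT.add ?_ ?_
    · rcases l with _ | l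
      · rw [show B = 0 from hB]
        simpa using OrderLT.zero (φ := φ) (ψ := θ) m
      · exact ih k l _ _ (by omega) hA (hB f)
    · rcases k with _ | k
      · rw [show A = 0 from hA]
        simpa using OrderLT.zero (φ := φ) (ψ := θ) m
      · exact ih k l _ _ (by omega) (hA f) hB

end Order

section DiffOps

variable {n : ℕ} {M : Type u} [TopologicalSpace M] [ChartedSpace (EuclideanSpace ℝ (Fin n)) M]

/-- A differential operator composed with an evaluation at `x` only depends on the germ of the
section at `x`. -/
theorem OrderLT.eval_eq_zero [T2Space M] [SecondCountableTopology M] [IsManifold (𝓡 n) ∞ M]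
    {V : HermBundle.{u, v, w} n M} {Y Z : Type*} [AddCommGroup Y] [Module ℂ Y] [AddCommGroup Z]
    {ψ : C^∞⟮𝓡 n, M; ℝ⟯ → Y →ₗ[ℂ] Y} {x : M} (ev : Y →+ Z)
    (hev : ∀ f y, f x = 0 → ev (ψ f y) = 0) {k : ℕ} {A : V.Sec →ₗ[ℂ] Y}
    (hA : OrderLT V.fmul ψ k A) {s : V.Sec} (hs : ∀ᶠ y in 𝓝 x, s y = 0) : ev (A s) = 0 := by
  induction k generalizing A with
  | zero =>
    rw [show A = 0 from hA]
    simp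
  | succ k ih =>
    obtain ⟨U, hU, hUo, hxU⟩ := eventually_nhds_iff.1 hs
    obtain ⟨χ, h1, -, hsup, -⟩ := exists_cutoff (n := n) (isCompact_singleton (x := x))
      hUo (singleton_subset_iff.2 hxU)
    -- `s = (1 - χ) s` with `χ x = 1`, so that `A s` agrees at `x` with a commutator of lower order
    have hf : (V.fmul (1 - χ)) s = s := by
      refine HermBundle.sec_ext fun y ↦ ?_
      rw [V.fmul_apply]
      by_cases hy : y ∈ U
      · rw [hU y hy, smul_zero]
      · have : χ y = 0 := image_eq_zero_of_notMem_tsupport fun h ↦ hy (hsup h)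
        change (1 - χ y) • s y = s y
        rw [this, sub_zero, one_smul]
    have h2 := ih (hA (1 - χ))
    have h3 : ev (ψ (1 - χ) (A s)) = 0 := by
      refine hev _ _ ?_
      change 1 - χ x = 0
      rw [h1.self_of_nhdsSet x rfl, sub_self]
    simp only [LinearMap.sub_apply, LinearMap.comp_apply, hf, map_sub, h3, sub_zero] at h2
    exact h2

variable {V W U : HermBundle.{u, v, w} n M}

/-- Evaluation of a section at a point. -/
def HermBundle.evalHom (V : HermBundle.{u, v, w} n M) (x : M) : V.Sec →+ V.E x where
  toFun s := s x
  map_zero' := rfl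
  map_add' _ _ := rfl

section
variable [T2Space M] [SecondCountableTopology M] [IsManifold (𝓡 n) ∞ M]

theorem IsDiffOp.eq_zero_of_eventually {A : V.Sec →ₗ[ℂ] W.Sec} (hA : IsDiffOp A) {s : V.Sec} {x : M}
    (hs : ∀ᶠ y in 𝓝 x, s y = 0) : A s x = 0 := by
  obtain ⟨k, hk⟩ := hA
  refine OrderLT.eval_eq_zero (W.evalHom x) ?_ hk hs
  intro f y hf
  change f x • y x = 0
  rw [hf, zero_smul]

theorem IsDiffOp.congr_of_eventually {A : V.Sec →ₗ[ℂ] W.Sec} (hA : IsDiffOp A) {s t : V.Sec} {x : M}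
    (hs : ∀ᶠ y in 𝓝 x, s y = t y) : A s x = A t x := by
  have := hA.eq_zero_of_eventually (s := s - t) (x := x)
    (by filter_upwards [hs] with y hy; rw [V.sub_apply, hy, sub_self])
  rw [map_sub, W.sub_apply, sub_eq_zero] at this
  exact this

theorem IsDiffOp.supp_subset {A : V.Sec →ₗ[ℂ] W.Sec} (hA : IsDiffOp A) (s : V.Sec) :
    W.supp (A s) ⊆ V.supp s :=
  HermBundle.supp_subset_of_closed (V.isClosed_supp s) fun _ hx ↦
    hA.eq_zero_of_eventually (HermBundle.notMem_supp_iff.1 hx)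

/-- The action of a differential operator on compactly supported sections. -/
def IsDiffOp.onSecc {A : V.Sec →ₗ[ℂ] W.Sec} (hA : IsDiffOp A) (s : V.Secc) : W.Secc :=
  ⟨A s.1, HermBundle.mem_Secc_of_subset s.2 (hA.supp_subset s.1)⟩

end

theorem IsDiffOp.comp {A : W.Sec →ₗ[ℂ] U.Sec} {B : V.Sec →ₗ[ℂ] W.Sec} (hA : IsDiffOp A)
    (hB : IsDiffOp B) : IsDiffOp (A ∘ₗ B) :=
  ⟨_, hA.choose_spec.comp hB.choose_spec⟩

theorem IsDiffOp.add {A B : V.Sec →ₗ[ℂ] W.Sec} (hA : IsDiffOp A) (hB : IsDiffOp B) :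
    IsDiffOp (A + B) := by
  obtain ⟨k, hk⟩ := hA
  obtain ⟨l, hl⟩ := hB
  exact ⟨max k l, (hk.mono (le_max_left _ _)).add (hl.mono (le_max_right _ _))⟩

theorem isDiffOp_fmul (f : C^∞⟮𝓡 n, M; ℝ⟯) : IsDiffOp (V.fmul f) := by
  refine ⟨1, fun g ↦ ?_⟩
  change V.fmul f ∘ₗ V.fmul g - V.fmul g ∘ₗ V.fmul f = 0
  ext s
  refine sub_eq_zero.2 (HermBundle.sec_ext fun x ↦ ?_)
  exact smul_comm (f x) (g x) (s x)

theorem ScalarDiffOp.restrict_apply (D : ScalarDiffOp V) (K : TopologicalSpace.Compacts M)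
    (s : V.Sec) (x : K) : D.restrict K s x = D.op s x := rfl

theorem ScalarDiffOp.continuous_restrict (D : ScalarDiffOp V) (K : TopologicalSpace.Compacts M) :
    Continuous (D.restrict K) :=
  continuous_iInf_dom (i := (K, D)) continuous_induced_dom

/-- The composition of a scalar differential operator with a differential operator. -/
def ScalarDiffOp.comp (D : ScalarDiffOp W) {A : V.Sec →ₗ[ℂ] W.Sec} (hA : IsDiffOp A) :
    ScalarDiffOp V where
  op := D.op ∘ₗ A
  smooth s := D.smooth (A s)
  order := ⟨_, D.order.choose_spec.comp hA.choose_spec⟩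

theorem IsDiffOp.continuous {A : V.Sec →ₗ[ℂ] W.Sec} (hA : IsDiffOp A) : Continuous A := by
  refine continuous_iInf_rng.2 fun p ↦ continuous_induced_rng.2 ?_
  exact (p.2.comp hA).continuous_restrict p.1

end DiffOps

/-! ### Volume measures in charts -/

section Volume

variable {n : ℕ} {M : Type u} [TopologicalSpace M] [ChartedSpace (EuclideanSpace ℝ (Fin n)) M]

/-- The components `g_{ij}` of a metric in the preferred chart at `x`. -/
def metricEntry (g : ∀ x : M, TangentSpace (𝓡 n) x →ₗ[ℝ] TangentSpace (𝓡 n) x →ₗ[ℝ] ℝ) (x : M)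
    (i j : Fin n) (y : EuclideanSpace ℝ (Fin n)) : ℝ :=
  g ((extChartAt (𝓡 n) x).symm y)
    (mfderiv 𝓘(ℝ, EuclideanSpace ℝ (Fin n)) (𝓡 n) (extChartAt (𝓡 n) x).symm y
      (EuclideanSpace.single i (1 : ℝ)))
    (mfderiv 𝓘(ℝ, EuclideanSpace ℝ (Fin n)) (𝓡 n) (extChartAt (𝓡 n) x).symm y
      (EuclideanSpace.single j (1 : ℝ)))

/-- A smooth non-degenerate metric of arbitrary signature. -/
structure IsSmoothMetric
    (g : ∀ x : M, TangentSpace (𝓡 n) x →ₗ[ℝ] TangentSpace (𝓡 n) x →ₗ[ℝ] ℝ) : Prop where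
  smooth : ∀ x i j, ContDiffOn ℝ ∞ (metricEntry g x i j) (extChartAt (𝓡 n) x).target
  nondeg : ∀ x (a : TangentSpace (𝓡 n) x), (∀ b, g x a b = 0) → a = 0

/-- The volume density `|det g_{ij}|^{1/2}` in the preferred chart at `x`. -/
def density (g : ∀ x : M, TangentSpace (𝓡 n) x →ₗ[ℝ] TangentSpace (𝓡 n) x →ₗ[ℝ] ℝ) (x : M)
    (y : EuclideanSpace ℝ (Fin n)) : ℝ :=
  Real.sqrt |Matrix.det (Matrix.of fun i j : Fin n ↦ metricEntry g x i j y)|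

variable {g : ∀ x : M, TangentSpace (𝓡 n) x →ₗ[ℝ] TangentSpace (𝓡 n) x →ₗ[ℝ] ℝ}

/-- Expansion of the pullback of a bilinear form along `T` in the standard basis. -/
theorem bilin_expand {m : ℕ}
    (B : EuclideanSpace ℝ (Fin n) →ₗ[ℝ] EuclideanSpace ℝ (Fin n) →ₗ[ℝ] ℝ)
    (T : EuclideanSpace ℝ (Fin m) →L[ℝ] EuclideanSpace ℝ (Fin n)) (a b : EuclideanSpace ℝ (Fin m)) :
    B (T a) (T b) = ∑ k, ∑ l, a k * (b l *
      B (T (EuclideanSpace.single k 1)) (T (EuclideanSpace.single l 1))) := by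
  have hT : ∀ a : EuclideanSpace ℝ (Fin m),
      T a = ∑ i, a i • T (EuclideanSpace.single i (1 : ℝ)) := by
    intro a
    have := congrArg T ((EuclideanSpace.basisFun (Fin m) ℝ).sum_repr a)
    simpa using this.symm
  rw [hT a, hT b]
  simp only [map_sum, LinearMap.sum_apply, map_smul, LinearMap.smul_apply, smul_eq_mul]
  rw [Finset.sum_comm]
  refine Finset.sum_congr rfl fun i _ ↦ ?_
  simp only [Finset.mul_sum, mul_left_comm]

section
variable [IsManifold (𝓡 n) ∞ M]

theorem isInvertible_mfderiv_chart_symm (x : M) {y : EuclideanSpace ℝ (Fin n)}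
    (hy : y ∈ (extChartAt (𝓡 n) x).target) :
    (mfderiv 𝓘(ℝ, EuclideanSpace ℝ (Fin n)) (𝓡 n) (extChartAt (𝓡 n) x).symm y).IsInvertible := by
  have : IsManifold (𝓡 n) 1 M := IsManifold.of_le (n := ∞) (by simp)
  have h := isInvertible_mfderivWithin_extChartAt_symm (I := 𝓡 n) (x := x) hy
  rwa [ModelWithCorners.Boundaryless.range_eq_univ, mfderivWithin_univ] at h

/-- The determinant of the components of the metric has no zeros in a chart: a vector in the kernel
of the matrix corresponds to a tangent vector orthogonal to all others. -/
theorem IsSmoothMetric.det_ne_zero (hg : IsSmoothMetric g) (x : M) {y : EuclideanSpace ℝ (Fin n)}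
    (hy : y ∈ (extChartAt (𝓡 n) x).target) :
    Matrix.det (Matrix.of fun i j : Fin n ↦ metricEntry g x i j y) ≠ 0 := by
  intro h0
  obtain ⟨c, hc, hA⟩ := Matrix.exists_vecMul_eq_zero_iff.2 h0
  let T : EuclideanSpace ℝ (Fin n) →L[ℝ] EuclideanSpace ℝ (Fin n) :=
    mfderiv 𝓘(ℝ, EuclideanSpace ℝ (Fin n)) (𝓡 n) (extChartAt (𝓡 n) x).symm y
  let gE : EuclideanSpace ℝ (Fin n) →ₗ[ℝ] EuclideanSpace ℝ (Fin n) →ₗ[ℝ] ℝ :=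
    g ((extChartAt (𝓡 n) x).symm y)
  have hT : Function.Bijective T := (isInvertible_mfderiv_chart_symm x hy).bijective
  let c' : EuclideanSpace ℝ (Fin n) := WithLp.toLp 2 c
  have hzero : T c' = 0 := by
    refine hg.nondeg ((extChartAt (𝓡 n) x).symm y) (T c') fun b ↦ ?_
    obtain ⟨b', rfl⟩ := hT.surjective b
    refine (bilin_expand gE T c' b').trans ?_
    rw [Finset.sum_comm]
    refine Finset.sum_eq_zero fun j _ ↦ ?_
    have h1 := congrFun hA j
    calc ∑ i, c' i * (b' j * gE (T (EuclideanSpace.single i 1)) (T (EuclideanSpace.single j 1)))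
        = b' j * Matrix.vecMul c (Matrix.of fun i j : Fin n ↦ metricEntry g x i j y) j := by
          simp only [Matrix.vecMul, dotProduct, Matrix.of_apply, Finset.mul_sum]
          refine Finset.sum_congr rfl fun i _ ↦ ?_
          rw [mul_left_comm]
          rfl
      _ = 0 := by rw [h1]; simp
  apply hc
  have h1 : c' = 0 := hT.injective (hzero.trans (map_zero T).symm)
  funext i
  exact congrArg (fun a : EuclideanSpace ℝ (Fin n) ↦ a i) h1

theorem IsSmoothMetric.density_pos (hg : IsSmoothMetric g) (x : M) {y : EuclideanSpace ℝ (Fin n)}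
    (hy : y ∈ (extChartAt (𝓡 n) x).target) : 0 < density g x y :=
  Real.sqrt_pos.2 (abs_pos.2 (hg.det_ne_zero x hy))

theorem IsSmoothMetric.contDiffOn_density (hg : IsSmoothMetric g) (x : M) :
    ContDiffOn ℝ ∞ (density g x) (extChartAt (𝓡 n) x).target := by
  have h1 : ContDiffOn ℝ ∞ (fun y ↦ Matrix.det (Matrix.of fun i j : Fin n ↦ metricEntry g x i j y))
      (extChartAt (𝓡 n) x).target := by
    simp only [Matrix.det_apply]
    refine ContDiffOn.sum fun σ _ ↦ ?_
    refine ContDiffOn.const_smul _ ?_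
    exact contDiffOn_prod fun i _ ↦ hg.smooth x _ _
  intro y hy
  have h0 := hg.det_ne_zero x hy
  refine ContDiffWithinAt.sqrt ?_ (abs_pos.2 h0).ne'
  exact (h1 y hy).abs h0

variable [MeasurableSpace M] [BorelSpace M] {μ : Measure M}

omit [IsManifold (𝓡 n) ∞ M] in
theorem aemeasurable_chart (x : M) :
    AEMeasurable (extChartAt (𝓡 n) x) (μ.restrict (extChartAt (𝓡 n) x).source) :=
  (continuousOn_extChartAt x).aemeasurable (isOpen_extChartAt_source x).measurableSet

theorem IsSmoothMetric.isLocallyFiniteMeasure (hg : IsSmoothMetric g) (hμ : IsVolume g μ) :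
    IsLocallyFiniteMeasure μ := by
  refine ⟨fun x ↦ ?_⟩
  obtain ⟨r, hr, hball⟩ := Metric.nhds_basis_closedBall.mem_iff.1
    ((isOpen_extChartAt_target (I := 𝓡 n) x).mem_nhds (mem_extChartAt_target x))
  set φ := extChartAt (𝓡 n) x
  have hop : IsOpen (φ.source ∩ φ ⁻¹' Metric.ball (φ x) r) :=
    isOpen_extChartAt_preimage' x Metric.isOpen_ball
  refine ⟨φ.source ∩ φ ⁻¹' Metric.ball (φ x) r,
    hop.mem_nhds ⟨mem_extChartAt_source x, Metric.mem_ball_self hr⟩, ?_⟩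
  have h1 : μ (φ.source ∩ φ ⁻¹' Metric.ball (φ x) r) =
      Measure.map φ (μ.restrict φ.source) (Metric.ball (φ x) r) := by
    rw [Measure.map_apply_of_aemeasurable (aemeasurable_chart x) measurableSet_ball,
      Measure.restrict_apply' (isOpen_extChartAt_source x).measurableSet, inter_comm]
  obtain ⟨C, hC⟩ := (isCompact_closedBall (φ x) r).exists_bound_of_continuousOn
    ((hg.contDiffOn_density x).continuousOn.mono hball)
  rw [h1, hμ x, withDensity_apply _ measurableSet_ball]
  refine lt_of_le_of_lt (lintegral_mono' (Measure.restrict_mono subset_rfl Measure.restrict_le_self)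
    le_rfl) ?_
  refine lt_of_le_of_lt (setLIntegral_mono' measurableSet_ball
    (g := fun _ ↦ ENNReal.ofReal C) fun y hy ↦ ENNReal.ofReal_le_ofReal ?_) ?_
  · exact (le_abs_self _).trans (hC y (Metric.ball_subset_closedBall hy))
  · rw [setLIntegral_const]
    exact ENNReal.mul_lt_top ENNReal.ofReal_lt_top measure_ball_lt_top

theorem IsSmoothMetric.isOpenPosMeasure (hg : IsSmoothMetric g) (hμ : IsVolume g μ) :
    μ.IsOpenPosMeasure := by
  refine ⟨fun U hU ⟨x, hx⟩ h0 ↦ ?_⟩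
  set φ := extChartAt (𝓡 n) x
  set O : Set (EuclideanSpace ℝ (Fin n)) := φ.target ∩ φ.symm ⁻¹' U
  have hO : IsOpen O := (continuousOn_extChartAt_symm x).isOpen_inter_preimage
    (isOpen_extChartAt_target x) hU
  have hne : O.Nonempty := ⟨φ x, mem_extChartAt_target x, by
    change φ.symm (φ x) ∈ U
    rwa [extChartAt_to_inv]⟩
  have h1 : Measure.map φ (μ.restrict φ.source) O = 0 := by
    rw [Measure.map_apply_of_aemeasurable (aemeasurable_chart x) hO.measurableSet,
      Measure.restrict_apply' (isOpen_extChartAt_source x).measurableSet]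
    refine measure_mono_null ?_ h0
    rintro z ⟨⟨-, hz⟩, hzs⟩
    have : φ.symm (φ z) = z := φ.left_inv hzs
    rwa [mem_preimage, this] at hz
  rw [hμ x, withDensity_apply _ hO.measurableSet, Measure.restrict_restrict hO.measurableSet,
    inter_eq_left.2 (inter_subset_left : O ⊆ φ.target)] at h1
  have hpos : ∀ y ∈ O, 0 < ENNReal.ofReal (density g x y) := fun y hy ↦
    ENNReal.ofReal_pos.2 (hg.density_pos x hy.1)
  have hae : AEMeasurable (fun y ↦ ENNReal.ofReal (density g x y)) (volume.restrict O) :=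
    (((hg.contDiffOn_density x).continuousOn.mono inter_subset_left).aemeasurable
      hO.measurableSet).ennreal_ofReal
  have h2 := (lintegral_eq_zero_iff' hae).1 h1
  have h3 : volume O = 0 := by
    rw [← Measure.restrict_apply_self]
    refine measure_mono_null ?_ h2
    exact fun y hy h ↦ (hpos y hy).ne' h
  exact (hO.measure_pos volume hne).ne' h3

/-- Integration in a chart of a function supported in the domain of the chart. -/
theorem IsSmoothMetric.integral_chart (hg : IsSmoothMetric g) (hμ : IsVolume g μ) (x : M)
    {f : M → ℂ} (hf : Continuous f) (hs : Function.support f ⊆ (extChartAt (𝓡 n) x).source) :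
    ∫ z, f z ∂μ = ∫ y in (extChartAt (𝓡 n) x).target,
      (density g x y • f ((extChartAt (𝓡 n) x).symm y) : ℂ) := by
  set φ := extChartAt (𝓡 n) x
  have hcont : ContinuousOn (fun y ↦ f (φ.symm y)) φ.target :=
    hf.comp_continuousOn (continuousOn_extChartAt_symm x)
  have hdens : AEMeasurable (density g x) (volume.restrict φ.target) :=
    (hg.contDiffOn_density x).continuousOn.aemeasurable (isOpen_extChartAt_target x).measurableSet
  have hμ' : Measure.map φ (μ.restrict φ.source) = (volume.restrict φ.target).withDensity
      fun y ↦ ((Real.toNNReal (density g x y) : NNReal) : ENNReal) := hμ x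
  calc ∫ z, f z ∂μ = ∫ z in φ.source, f z ∂μ := (setIntegral_eq_integral_of_forall_compl_eq_zero
        fun z hz ↦ by by_contra h; exact hz (hs h)).symm
    _ = ∫ z in φ.source, f (φ.symm (φ z)) ∂μ :=
        setIntegral_congr_fun (isOpen_extChartAt_source x).measurableSet fun z hz ↦ by
          rw [φ.left_inv hz]
    _ = ∫ y, f (φ.symm y) ∂(Measure.map φ (μ.restrict φ.source)) := by
        rw [integral_map (aemeasurable_chart x)]
        rw [hμ']
        exact ((hcont.aestronglyMeasurable (isOpen_extChartAt_target x).measurableSet).mono_ac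
          (withDensity_absolutelyContinuous _ _))
    _ = _ := by
        rw [hμ', integral_withDensity_eq_integral_smul₀ hdens.real_toNNReal]
        refine integral_congr_ae (Eventually.of_forall fun y ↦ ?_)
        change ((Real.toNNReal (density g x y) : NNReal) : ℝ) • f (φ.symm y) = _
        rw [Real.coe_toNNReal (density g x y) (Real.sqrt_nonneg _)]

end

end Volume

/-! ### The volume measures of a spacetime and of a Cauchy surface -/

section Lorentz

variable {n : ℕ} {M : Type u} [TopologicalSpace M] [ChartedSpace (EuclideanSpace ℝ (Fin n)) M]
  [IsManifold (𝓡 n) ∞ M] [T2Space M] [SecondCountableTopology M]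

/-- A coordinate vector field agrees near any point of the chart domain with a global smooth
vector field. -/
theorem exists_vectorField (x : M) (a : EuclideanSpace ℝ (Fin n)) {z : M}
    (hz : z ∈ (extChartAt (𝓡 n) x).source) :
    ∃ Y : ∀ x : M, TangentSpace (𝓡 n) x,
      ContMDiff (𝓡 n) (𝓡 n).tangent ∞ (fun x ↦ (⟨x, Y x⟩ : TangentBundle (𝓡 n) M)) ∧
      ∀ᶠ y in 𝓝 (extChartAt (𝓡 n) x z), Y ((extChartAt (𝓡 n) x).symm y) =
        mfderiv 𝓘(ℝ, EuclideanSpace ℝ (Fin n)) (𝓡 n) (extChartAt (𝓡 n) x).symm y a := by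
  have : IsManifold (𝓡 n) 1 M := IsManifold.of_le (n := ∞) (by simp)
  obtain ⟨χ, h1, -, hs, -⟩ := exists_cutoff (n := n) (isCompact_singleton (x := z))
    (isOpen_extChartAt_source (I := 𝓡 n) x) (singleton_subset_iff.2 hz)
  set e := trivializationAt (EuclideanSpace ℝ (Fin n)) (TangentSpace (𝓡 n)) x
  have hbase : e.baseSet = (extChartAt (𝓡 n) x).source := by
    rw [extChartAt_source]
    rfl
  refine ⟨fun p ↦ χ p • e.symmL ℝ p a, ?_, ?_⟩
  · intro p
    by_cases hp : p ∈ (extChartAt (𝓡 n) x).source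
    · have hp' : p ∈ e.baseSet := hbase ▸ hp
      refine (e.contMDiffAt_section_iff hp').2 ?_
      have h3 : ContMDiffAt (𝓡 n) 𝓘(ℝ, EuclideanSpace ℝ (Fin n)) ∞ (fun q ↦ χ q • a) p :=
        χ.contMDiff.contMDiffAt.smul contMDiffAt_const
      refine h3.congr_of_eventuallyEq ?_
      filter_upwards [e.open_baseSet.mem_nhds hp'] with q hq
      rw [(e.linear ℝ hq).2]
      congr 1
      have := e.apply_mk_symm hq a
      rw [Bundle.Trivialization.symmL_apply e hq, this]
    · have h0 : ∀ᶠ q in 𝓝 p, χ q = 0 := by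
        filter_upwards [(isClosed_tsupport χ).isOpen_compl.mem_nhds (fun h ↦ hp (hs h))] with q hq
        exact image_eq_zero_of_notMem_tsupport hq
      have h3 : ContMDiffAt (𝓡 n) (𝓡 n).tangent ∞
          (fun q ↦ (⟨q, (0 : TangentSpace (𝓡 n) q)⟩ : TangentBundle (𝓡 n) M)) p :=
        Bundle.contMDiff_zeroSection ℝ (TangentSpace (𝓡 n) (M := M)) p
      refine h3.congr_of_eventuallyEq ?_
      filter_upwards [h0] with q hq
      rw [hq, zero_smul]
  · have hcont : ContinuousAt (extChartAt (𝓡 n) x).symm (extChartAt (𝓡 n) x z) :=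
      continuousAt_extChartAt_symm' hz
    have hz' : (extChartAt (𝓡 n) x).symm (extChartAt (𝓡 n) x z) = z :=
      (extChartAt (𝓡 n) x).left_inv hz
    have h1' : ∀ᶠ p in 𝓝 z, χ p = 1 := by rwa [nhdsSet_singleton] at h1
    filter_upwards [hcont.eventually (by rwa [hz']),
      (isOpen_extChartAt_target (I := 𝓡 n) x).mem_nhds ((extChartAt (𝓡 n) x).map_source hz)]
      with y hy hyt
    have hys : (extChartAt (𝓡 n) x).symm y ∈ (chartAt (EuclideanSpace ℝ (Fin n)) x).source := by
      simpa using (extChartAt (𝓡 n) x).map_target hyt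
    have h4 := TangentBundle.symmL_trivializationAt (I := 𝓡 n) hys
    rw [ModelWithCorners.Boundaryless.range_eq_univ, mfderivWithin_univ,
      (extChartAt (𝓡 n) x).right_inv hyt] at h4
    rw [hy, one_smul, h4]
    rfl

/-- The metric of a spacetime is smooth in charts, because coordinate vector fields extend locally
to global vector fields, and non-degenerate, because the orthogonal complement of a timelike vector
is spacelike. -/
theorem PreSpacetime.isSmoothMetric (X : PreSpacetime n M) : IsSmoothMetric X.g where
  smooth x i j y hy := by
    set φ := extChartAt (𝓡 n) x
    have hz : φ.symm y ∈ φ.source := φ.map_target hy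
    obtain ⟨Y, hY, hYe⟩ := exists_vectorField x (EuclideanSpace.single i (1 : ℝ)) hz
    obtain ⟨Z, hZ, hZe⟩ := exists_vectorField x (EuclideanSpace.single j (1 : ℝ)) hz
    rw [φ.right_inv hy] at hYe hZe
    have h1 : ContMDiffOn 𝓘(ℝ, EuclideanSpace ℝ (Fin n)) 𝓘(ℝ, ℝ) ∞
        (fun y ↦ X.g (φ.symm y) (Y (φ.symm y)) (Z (φ.symm y))) φ.target :=
      (X.g_smooth Y Z hY hZ).comp_contMDiffOn (contMDiffOn_extChartAt_symm x)
    refine ((contMDiffOn_iff_contDiffOn.1 h1) y hy).congr_of_eventuallyEq ?_ ?_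
    · refine Filter.Eventually.filter_mono nhdsWithin_le_nhds ?_
      filter_upwards [hYe, hZe] with y' h2 h3
      rw [h2, h3]
      rfl
    · rw [hYe.self_of_nhds, hZe.self_of_nhds]
      rfl
  nondeg x a ha := by
    obtain ⟨t, ht, hpos⟩ := X.g_lorentz x
    by_contra h0
    have := hpos a (by rw [X.g_symm]; exact ha t) h0
    rw [ha a] at this
    exact lt_irrefl _ this

end Lorentz

section Cauchy

variable {d : ℕ} {M : Type u} [TopologicalSpace M]
  [ChartedSpace (EuclideanSpace ℝ (Fin (d + 1))) M] [IsManifold (𝓡 (d + 1)) ∞ M]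
  [MeasurableSpace M]
  {S : Type u} [TopologicalSpace S] [ChartedSpace (EuclideanSpace ℝ (Fin d)) S]
  [IsManifold (𝓡 d) ∞ S] [MeasurableSpace S]

/-- The induced metric of a Cauchy surface. Its components are those of the spacetime metric
contracted with the derivative of the embedding expressed in charts. -/
theorem CauchySurface.isSmoothMetric [T2Space M] [SecondCountableTopology M]
    {X : Spacetime (d + 1) M} (Sg : CauchySurface X S) :
    IsSmoothMetric (fun x ↦ (X.g (Sg.ι x)).compl₁₂
      (mfderiv (𝓡 d) (𝓡 (d + 1)) Sg.ι x).toLinearMap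
      (mfderiv (𝓡 d) (𝓡 (d + 1)) Sg.ι x).toLinearMap) where
  smooth x i j y₀ hy₀ := by
    set φ := extChartAt (𝓡 d) x with hφ
    set p := Sg.ι (φ.symm y₀) with hp
    set ψ := extChartAt (𝓡 (d + 1)) p with hψ
    set c : EuclideanSpace ℝ (Fin d) → EuclideanSpace ℝ (Fin (d + 1)) :=
      fun y ↦ ψ (Sg.ι (φ.symm y)) with hc
    have hιφ : ContMDiffOn 𝓘(ℝ, EuclideanSpace ℝ (Fin d)) (𝓡 (d + 1)) ∞
        (fun y ↦ Sg.ι (φ.symm y)) φ.target :=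
      Sg.ι.contMDiff.comp_contMDiffOn (contMDiffOn_extChartAt_symm x)
    set Ω : Set (EuclideanSpace ℝ (Fin d)) := φ.target ∩ (fun y ↦ Sg.ι (φ.symm y)) ⁻¹' ψ.source
    have hΩ : IsOpen Ω := hιφ.continuousOn.isOpen_inter_preimage (isOpen_extChartAt_target x)
      (isOpen_extChartAt_source p)
    have hy₀Ω : y₀ ∈ Ω := ⟨hy₀, mem_extChartAt_source p⟩
    have hcΩ : ContDiffOn ℝ ∞ c Ω := by
      refine contMDiffOn_iff_contDiffOn.1 ?_
      exact (contMDiffOn_extChartAt (n := ∞) (x := p)).comp (hιφ.mono inter_subset_left)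
        fun y hy ↦ by simpa [hψ] using hy.2
    have hcd : ∀ y ∈ Ω, DifferentiableAt ℝ c y := fun y hy ↦
      (hcΩ.contDiffAt (hΩ.mem_nhds hy)).differentiableAt (by simp)
    have hct : ∀ y ∈ Ω, c y ∈ ψ.target := fun y hy ↦ ψ.map_source hy.2
    have hback : ∀ y ∈ Ω, ψ.symm (c y) = Sg.ι (φ.symm y) := fun y hy ↦ ψ.left_inv hy.2
    -- chain rule: `dι ∘ dφ⁻¹ = dψ⁻¹ ∘ dc`
    have hchain : ∀ y ∈ Ω, ∀ a : EuclideanSpace ℝ (Fin d),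
        (mfderiv (𝓡 d) (𝓡 (d + 1)) Sg.ι (φ.symm y)
          (mfderiv 𝓘(ℝ, EuclideanSpace ℝ (Fin d)) (𝓡 d) φ.symm y a) :
            EuclideanSpace ℝ (Fin (d + 1))) =
        mfderiv 𝓘(ℝ, EuclideanSpace ℝ (Fin (d + 1))) (𝓡 (d + 1)) ψ.symm (c y)
          (fderiv ℝ c y a) := by
      intro y hy a
      have d1 : MDifferentiableAt 𝓘(ℝ, EuclideanSpace ℝ (Fin d)) (𝓡 d) φ.symm y :=
        ((contMDiffOn_extChartAt_symm (n := ∞) x).contMDiffAt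
          ((isOpen_extChartAt_target x).mem_nhds hy.1)).mdifferentiableAt (by simp)
      have d2 : MDifferentiableAt (𝓡 d) (𝓡 (d + 1)) Sg.ι (φ.symm y) :=
        Sg.ι.contMDiff.contMDiffAt.mdifferentiableAt (by simp)
      have d3 : MDifferentiableAt 𝓘(ℝ, EuclideanSpace ℝ (Fin (d + 1))) (𝓡 (d + 1)) ψ.symm (c y) :=
        ((contMDiffOn_extChartAt_symm (n := ∞) p).contMDiffAt
          ((isOpen_extChartAt_target p).mem_nhds (hct y hy))).mdifferentiableAt (by simp)
      have d4 : MDifferentiableAt 𝓘(ℝ, EuclideanSpace ℝ (Fin d))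
          𝓘(ℝ, EuclideanSpace ℝ (Fin (d + 1))) c y := (hcd y hy).mdifferentiableAt
      have e1 := mfderiv_comp y d2 d1
      have e2 := mfderiv_comp y d3 d4
      have e3 : (Sg.ι ∘ φ.symm) =ᶠ[𝓝 y] (ψ.symm ∘ c) := by
        filter_upwards [hΩ.mem_nhds hy] with y' hy'
        exact (hback y' hy').symm
      have e4 := e3.mfderiv_eq (I := 𝓘(ℝ, EuclideanSpace ℝ (Fin d))) (I' := 𝓡 (d + 1))
      have e5 := congrArg (fun L : EuclideanSpace ℝ (Fin d) →L[ℝ] EuclideanSpace ℝ (Fin (d + 1)) ↦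
        L a) (e1.symm.trans (e4.trans e2))
      rw [mfderiv_eq_fderiv] at e5
      exact e5
    have hexp : ∀ y ∈ Ω, metricEntry (fun x ↦ (X.g (Sg.ι x)).compl₁₂
        (mfderiv (𝓡 d) (𝓡 (d + 1)) Sg.ι x).toLinearMap
        (mfderiv (𝓡 d) (𝓡 (d + 1)) Sg.ι x).toLinearMap) x i j y =
        ∑ k, ∑ l, (fderiv ℝ c y (EuclideanSpace.single i 1) k) *
          ((fderiv ℝ c y (EuclideanSpace.single j 1) l) * metricEntry X.g p k l (c y)) := by
      intro y hy
      let T : EuclideanSpace ℝ (Fin (d + 1)) →L[ℝ] EuclideanSpace ℝ (Fin (d + 1)) :=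
        mfderiv 𝓘(ℝ, EuclideanSpace ℝ (Fin (d + 1))) (𝓡 (d + 1)) ψ.symm (c y)
      let gE : EuclideanSpace ℝ (Fin (d + 1)) →ₗ[ℝ] EuclideanSpace ℝ (Fin (d + 1)) →ₗ[ℝ] ℝ :=
        X.g (Sg.ι (φ.symm y))
      have h1 : metricEntry (fun x ↦ (X.g (Sg.ι x)).compl₁₂
          (mfderiv (𝓡 d) (𝓡 (d + 1)) Sg.ι x).toLinearMap
          (mfderiv (𝓡 d) (𝓡 (d + 1)) Sg.ι x).toLinearMap) x i j y =
          gE (T (fderiv ℝ c y (EuclideanSpace.single i 1)))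
            (T (fderiv ℝ c y (EuclideanSpace.single j 1))) :=
        congrArg₂ (fun a b ↦ gE a b) (hchain y hy _) (hchain y hy _)
      have h2 : ∀ k l, metricEntry X.g p k l (c y) =
          gE (T (EuclideanSpace.single k 1)) (T (EuclideanSpace.single l 1)) := by
        intro k l
        have : ∀ q, q = Sg.ι (φ.symm y) → ∀ a b : EuclideanSpace ℝ (Fin (d + 1)),
            X.g q a b = gE a b := by
          rintro q rfl a b
          rfl
        exact this _ (hback y hy) _ _
      rw [h1, bilin_expand gE T]
      exact Finset.sum_congr rfl fun k _ ↦ Finset.sum_congr rfl fun l _ ↦ by rw [h2]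
    have hd : ∀ (a : EuclideanSpace ℝ (Fin d)) (k : Fin (d + 1)),
        ContDiffAt ℝ ∞ (fun y ↦ fderiv ℝ c y a k) y₀ := by
      intro a k
      have h1 : ContDiffAt ℝ ∞ (fderiv ℝ c) y₀ :=
        (hcΩ.contDiffAt (hΩ.mem_nhds hy₀Ω)).fderiv_right (by simp)
      have h2 : ContDiffAt ℝ ∞ (fun y ↦ fderiv ℝ c y a) y₀ := h1.clm_apply contDiffAt_const
      exact (EuclideanSpace.proj (𝕜 := ℝ) k).contDiff.contDiffAt.comp y₀ h2
    have hm : ∀ k l, ContDiffAt ℝ ∞ (fun y ↦ metricEntry X.g p k l (c y)) y₀ := by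
      intro k l
      exact ((X.toPreSpacetime.isSmoothMetric.smooth p k l).contDiffAt
        ((isOpen_extChartAt_target p).mem_nhds (hct y₀ hy₀Ω))).comp y₀
          (hcΩ.contDiffAt (hΩ.mem_nhds hy₀Ω))
    refine ContDiffAt.contDiffWithinAt ?_
    refine ContDiffAt.congr_of_eventuallyEq (f := fun y ↦ ∑ k, ∑ l,
      (fderiv ℝ c y (EuclideanSpace.single i 1) k) *
          ((fderiv ℝ c y (EuclideanSpace.single j 1) l) * metricEntry X.g p k l (c y))) ?_ ?_
    · exact ContDiffAt.sum fun k _ ↦ ContDiffAt.sum fun l _ ↦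
        (hd _ k).mul ((hd _ l).mul (hm k l))
    · filter_upwards [hΩ.mem_nhds hy₀Ω] with y hy
      exact hexp y hy
  nondeg x a ha := by
    by_contra h0
    have := Sg.spacelike x a h0
    have h1 := ha a
    simp only [LinearMap.compl₁₂_apply, ContinuousLinearMap.coe_coe] at h1
    rw [h1] at this
    exact lt_irrefl _ this

end Cauchy

/-! ### The pairing of sections -/

section Pairing

variable {n : ℕ} {M : Type u} [TopologicalSpace M] [ChartedSpace (EuclideanSpace ℝ (Fin n)) M]
  {V W : HermBundle.{u, v, w} n M}

theorem HermBundle.form_fmul_left (V : HermBundle.{u, v, w} n M) (f : C^∞⟮𝓡 n, M; ℝ⟯)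
    (s t : V.Sec) (x : M) : V.form x (V.fmul f s x) (t x) = (f x : ℂ) * V.form x (s x) (t x) := by
  rw [V.fmul_apply, show f x • s x = (f x : ℂ) • s x from (Complex.coe_smul (f x) (s x)).symm,
    LinearMap.map_smulₛₗ, LinearMap.smul_apply, conj_ofReal, smul_eq_mul]

theorem HermBundle.form_fmul_right (V : HermBundle.{u, v, w} n M) (f : C^∞⟮𝓡 n, M; ℝ⟯)
    (s t : V.Sec) (x : M) : V.form x (s x) (V.fmul f t x) = (f x : ℂ) * V.form x (s x) (t x) := by
  rw [V.fmul_apply, show f x • t x = (f x : ℂ) • t x from (Complex.coe_smul (f x) (t x)).symm,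
    map_smul, smul_eq_mul]

/-- The order zero operator `t ↦ (s|t)` given by a smooth section `s`. -/
def HermBundle.formOp (V : HermBundle.{u, v, w} n M) (s : V.Sec) : ScalarDiffOp V where
  op :=
    { toFun := fun t x ↦ V.form x (s x) (t x)
      map_add' := fun t t' ↦ by
        funext x
        exact map_add (V.form x (s x)) (t x) (t' x)
      map_smul' := fun c t ↦ by
        funext x
        exact map_smul (V.form x (s x)) c (t x) }
  smooth t := V.form_smooth s t s.2 t.2
  order := by
    refine ⟨1, fun f ↦ ?_⟩
    change _ = _
    ext t x
    simp only [LinearMap.sub_apply, LinearMap.comp_apply, LinearMap.coe_mk, AddHom.coe_mk,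
      Pi.sub_apply, LinearMap.zero_apply, Pi.zero_apply]
    rw [V.form_fmul_right, sub_eq_zero]
    exact (real_smul (x := f x) (z := V.form x (s x) (t x))).symm

theorem HermBundle.continuous_form (V : HermBundle.{u, v, w} n M) (s t : V.Sec) :
    Continuous fun x ↦ V.form x (s x) (t x) :=
  (V.form_smooth s t s.2 t.2).continuous

theorem HermBundle.form_eq_zero {V : HermBundle.{u, v, w} n M} {s t : V.Sec} {x : M}
    (hx : x ∉ V.supp s ∩ V.supp t) : V.form x (s x) (t x) = 0 := by
  rw [mem_inter_iff, not_and_or] at hx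
  rcases hx with hx | hx
  · rw [HermBundle.eq_zero_of_notMem_supp hx, map_zero, LinearMap.zero_apply]
  · rw [HermBundle.eq_zero_of_notMem_supp hx, map_zero]

theorem HermBundle.hasCompactSupport_form {V : HermBundle.{u, v, w} n M} {s t : V.Sec}
    (h : IsCompact (V.supp s ∩ V.supp t)) :
    HasCompactSupport fun x ↦ V.form x (s x) (t x) := by
  refine h.of_isClosed_subset (isClosed_tsupport _) ?_
  refine closure_minimal (fun x hx ↦ ?_) ((V.isClosed_supp s).inter (V.isClosed_supp t))
  by_contra h'
  exact hx (HermBundle.form_eq_zero h')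

theorem HermBundle.isCompact_left (f : V.Secc) (t : V.Sec) : IsCompact (V.supp f.1 ∩ V.supp t) :=
  IsCompact.inter_right f.2 (V.isClosed_supp t)

variable [MeasurableSpace M] {μ : Measure M}

theorem HermBundle.pair_conj (s t : V.Sec) : V.pair μ s t = starRingEnd ℂ (V.pair μ t s) := by
  unfold HermBundle.pair
  rw [← integral_conj]
  exact integral_congr_ae (Eventually.of_forall fun x ↦ V.form_symm x _ _)

theorem HermBundle.pair_smul_right (s t : V.Sec) (c : ℂ) :
    V.pair μ s (c • t) = c * V.pair μ s t := by
  unfold HermBundle.pair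
  rw [← integral_const_mul]
  exact integral_congr_ae (Eventually.of_forall fun x ↦ map_smul (V.form x (s x)) c (t x))

theorem HermBundle.pair_smul_left (s t : V.Sec) (c : ℂ) :
    V.pair μ (c • s) t = starRingEnd ℂ c * V.pair μ s t := by
  rw [V.pair_conj, V.pair_smul_right, map_mul, ← V.pair_conj]

theorem HermBundle.pair_neg_right (s t : V.Sec) : V.pair μ s (-t) = -V.pair μ s t := by
  rw [← neg_one_smul ℂ t, V.pair_smul_right, neg_one_mul]

theorem HermBundle.pair_neg_left (s t : V.Sec) : V.pair μ (-s) t = -V.pair μ s t := by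
  rw [V.pair_conj, V.pair_neg_right, map_neg, ← V.pair_conj]

theorem HermBundle.pair_zero_right (s : V.Sec) : V.pair μ s 0 = 0 := by
  rw [← zero_smul ℂ (0 : V.Sec), V.pair_smul_right, zero_mul]

theorem HermBundle.pair_zero_left (s : V.Sec) : V.pair μ 0 s = 0 := by
  rw [V.pair_conj, V.pair_zero_right, map_zero]

theorem HermBundle.pair_fmul (f : C^∞⟮𝓡 n, M; ℝ⟯) (s t : V.Sec) :
    V.pair μ (V.fmul f s) t = V.pair μ s (V.fmul f t) := by
  unfold HermBundle.pair
  refine integral_congr_ae (Eventually.of_forall fun x ↦ ?_)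
  change V.form x (V.fmul f s x) (t x) = V.form x (s x) (V.fmul f t x)
  rw [V.form_fmul_left, V.form_fmul_right]

/-- The pairing only depends on the values of the second section near the support of the first. -/
theorem HermBundle.pair_congr_right {s t t' : V.Sec} (h : ∀ x ∈ V.supp s, t x = t' x) :
    V.pair μ s t = V.pair μ s t' := by
  unfold HermBundle.pair
  refine integral_congr_ae (Eventually.of_forall fun x ↦ ?_)
  by_cases hx : x ∈ V.supp s
  · change V.form x (s x) (t x) = _
    rw [h x hx]
  · change V.form x (s x) (t x) = V.form x (s x) (t' x)
    rw [HermBundle.eq_zero_of_notMem_supp hx, map_zero, LinearMap.zero_apply, LinearMap.zero_apply]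

theorem IsFormalAdj.symm {A : V.Sec →ₗ[ℂ] W.Sec} {A' : W.Sec →ₗ[ℂ] V.Sec}
    (h : IsFormalAdj μ A A') : IsFormalAdj μ A' A := fun s t ↦ by
  rw [V.pair_conj, ← h t s, ← W.pair_conj]

variable [BorelSpace M] [IsFiniteMeasureOnCompacts μ]

theorem HermBundle.integrable_form {s t : V.Sec}
    (h : IsCompact (V.supp s ∩ V.supp t)) : Integrable (fun x ↦ V.form x (s x) (t x)) μ :=
  (V.continuous_form s t).integrable_of_hasCompactSupport (HermBundle.hasCompactSupport_form h)

theorem HermBundle.pair_add_right' {s t t' : V.Sec} (h : IsCompact (V.supp s ∩ V.supp t))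
    (h' : IsCompact (V.supp s ∩ V.supp t')) :
    V.pair μ s (t + t') = V.pair μ s t + V.pair μ s t' := by
  unfold HermBundle.pair
  rw [← integral_add (HermBundle.integrable_form h) (HermBundle.integrable_form h')]
  exact integral_congr_ae (Eventually.of_forall fun x ↦ map_add (V.form x (s x)) (t x) (t' x))

/-- The pairing with a compactly supported section, as a linear form. -/
def HermBundle.pairL (V : HermBundle.{u, v, w} n M) (μ : Measure M) [IsFiniteMeasureOnCompacts μ]
    (f : V.Secc) : V.Sec →ₗ[ℂ] ℂ where
  toFun t := V.pair μ f.1 t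
  map_add' t t' := HermBundle.pair_add_right' (HermBundle.isCompact_left f t)
    (HermBundle.isCompact_left f t')
  map_smul' c t := V.pair_smul_right f.1 t c

theorem HermBundle.pair_add_right (f : V.Secc) (t t' : V.Sec) :
    V.pair μ f.1 (t + t') = V.pair μ f.1 t + V.pair μ f.1 t' := map_add (V.pairL μ f) t t'

theorem HermBundle.pair_sub_right (f : V.Secc) (t t' : V.Sec) :
    V.pair μ f.1 (t - t') = V.pair μ f.1 t - V.pair μ f.1 t' := map_sub (V.pairL μ f) t t'

theorem HermBundle.pair_add_left (f : V.Secc) (t t' : V.Sec) :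
    V.pair μ (t + t') f.1 = V.pair μ t f.1 + V.pair μ t' f.1 := by
  rw [V.pair_conj, V.pair_add_right, map_add, ← V.pair_conj, ← V.pair_conj]

theorem HermBundle.pair_sub_left (f : V.Secc) (t t' : V.Sec) :
    V.pair μ (t - t') f.1 = V.pair μ t f.1 - V.pair μ t' f.1 := by
  rw [V.pair_conj, V.pair_sub_right, map_sub, ← V.pair_conj, ← V.pair_conj]

theorem HermBundle.norm_pair_le (f : V.Secc) (K : TopologicalSpace.Compacts M)
    (hK : V.supp f.1 ⊆ K) (t : V.Sec) :
    ‖V.pair μ f.1 t‖ ≤ ‖(V.formOp f.1).restrict K t‖ * μ.real (V.supp f.1) := by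
  have h2 : V.pair μ f.1 t = ∫ x in V.supp f.1, V.form x (f.1 x) (t x) ∂μ :=
    (setIntegral_eq_integral_of_forall_compl_eq_zero fun x hx ↦
      HermBundle.form_eq_zero fun h ↦ hx h.1).symm
  rw [h2]
  refine norm_setIntegral_le_of_norm_le_const (IsCompact.measure_lt_top f.2) fun x hx ↦ ?_
  exact ((V.formOp f.1).restrict K t).norm_coe_le_norm ⟨x, hK hx⟩

theorem HermBundle.continuous_pair (f : V.Secc) : Continuous fun t ↦ V.pair μ f.1 t := by
  let K : TopologicalSpace.Compacts M := ⟨V.supp f.1, f.2⟩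
  refine continuous_of_continuousAt_zero (V.pairL μ f) ?_
  rw [ContinuousAt, map_zero]
  refine squeeze_zero_norm (a := fun t ↦ ‖(V.formOp f.1).restrict K t‖ * μ.real (V.supp f.1))
    (fun t ↦ HermBundle.norm_pair_le f K subset_rfl t) ?_
  have h1 : Continuous fun t ↦ ‖(V.formOp f.1).restrict K t‖ * μ.real (V.supp f.1) :=
    ((V.formOp f.1).continuous_restrict K).norm.mul continuous_const
  simpa using h1.tendsto 0

/-- The pairing with a compactly supported section, as a continuous linear form. -/
def HermBundle.pairCL (V : HermBundle.{u, v, w} n M) (μ : Measure M) [IsFiniteMeasureOnCompacts μ]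
    (f : V.Secc) : V.Sec →L[ℂ] ℂ := ⟨V.pairL μ f, HermBundle.continuous_pair f⟩

variable [T2Space M] [SecondCountableTopology M] [IsManifold (𝓡 n) ∞ M]

/-- The pairing is non-degenerate on every open set. -/
theorem HermBundle.eq_zero_of_pair_eq_zero [μ.IsOpenPosMeasure] {t : V.Sec} {U : Set M}
    (hU : IsOpen U) (h : ∀ f : V.Secc, V.supp f.1 ⊆ U → V.pair μ f.1 t = 0) :
    ∀ x ∈ U, t x = 0 := by
  intro x hx
  by_contra h0
  obtain ⟨b, hb⟩ : ∃ b, V.form x b (t x) ≠ 0 := by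
    by_contra! hcon
    exact h0 (V.form_nondeg x _ fun b ↦ by rw [V.form_symm, hcon b, map_zero])
  -- the test section is `χ r s`, where `s x` is a multiple of `b` with `(s x|t x) > 0` and
  -- `r = Re (s|t)`, so that the real part of the integrand is `χ r² ≥ 0`
  set c := V.form x b (t x) with hc
  obtain ⟨s, hs⟩ := V.exists_sec x (c • b)
  obtain ⟨χ, h1, hcs, hsup, hI⟩ := exists_cutoff (n := n) (isCompact_singleton (x := x))
    hU (singleton_subset_iff.2 hx)
  let r : C^∞⟮𝓡 n, M; ℝ⟯ := ⟨fun y ↦ (V.form y (s.1 y) (t y)).re,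
    Complex.reCLM.contDiff.contMDiff.comp (V.form_smooth s.1 t s.1.2 t.2)⟩
  have hr : r x ≠ 0 := by
    change (V.form x (s.1 x) (t x)).re ≠ 0
    rw [hs, LinearMap.map_smulₛₗ, LinearMap.smul_apply, smul_eq_mul, ← hc,
      ← normSq_eq_conj_mul_self, ofReal_re]
    exact (normSq_pos.2 hb).ne'
  let f : V.Secc := V.fmulc χ (V.fmulc r s)
  have hf := h f ((HermBundle.supp_fmul_subset χ _).trans (inter_subset_right.trans hsup))
  have hre : ∀ y, (V.form y (f.1 y) (t y)).re = χ y * (r y * r y) := by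
    intro y
    have e1 : V.form y (f.1 y) (t y) = (χ y : ℂ) * ((r y : ℂ) * V.form y (s.1 y) (t y)) := by
      change V.form y (V.fmul χ (V.fmul r s.1) y) (t y) = _
      rw [V.form_fmul_left, V.form_fmul_left]
    rw [e1, re_ofReal_mul, re_ofReal_mul]
    rfl
  have hint : Integrable (fun y ↦ V.form y (f.1 y) (t y)) μ :=
    HermBundle.integrable_form (HermBundle.isCompact_left f t)
  have h2 : ∫ y, χ y * (r y * r y) ∂μ = 0 := by
    have h3 := Complex.reCLM.integral_comp_comm hint
    unfold HermBundle.pair at hf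
    rw [hf] at h3
    simpa [hre] using h3
  have hcont : Continuous fun y ↦ χ y * (r y * r y) :=
    χ.contMDiff.continuous.mul (r.contMDiff.continuous.mul r.contMDiff.continuous)
  have h4 := hcont.integral_pos_of_hasCompactSupport_nonneg_nonzero (μ := μ) (x := x)
    (hcs.mul_right) (fun y ↦ mul_nonneg (hI y).1 (mul_self_nonneg _)) (by
      rw [h1.self_of_nhdsSet x rfl, one_mul]
      exact mul_self_ne_zero.2 hr)
  exact h4.ne' h2

theorem HermBundle.ext_of_pair [μ.IsOpenPosMeasure] {t t' : V.Sec}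
    (h : ∀ f : V.Secc, V.pair μ f.1 t = V.pair μ f.1 t') : t = t' := by
  rw [← sub_eq_zero]
  refine HermBundle.sec_ext fun x ↦ ?_
  refine HermBundle.eq_zero_of_pair_eq_zero (μ := μ) isOpen_univ (fun f _ ↦ ?_) x (mem_univ x)
  rw [V.pair_sub_right, h, sub_self]

/-- Sections with the same pairings are equal, so the topology of `Γ(M;V)` is Hausdorff. -/
theorem HermBundle.t2Space_sec [μ.IsOpenPosMeasure] : T2Space V.Sec := by
  refine T2Space.of_injective_continuous (f := fun t : V.Sec ↦ fun f : V.Secc ↦ V.pair μ f.1 t)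
    (fun t t' h ↦ HermBundle.ext_of_pair (μ := μ) fun f ↦ congrFun h f) ?_
  exact continuous_pi fun f ↦ HermBundle.continuous_pair f

omit [IsFiniteMeasureOnCompacts μ] [BorelSpace M] in
/-- Formal adjoints can be moved across the pairing of two sections whose supports have compact
intersection. -/
theorem IsFormalAdj.pair_eq {A : V.Sec →ₗ[ℂ] W.Sec} {A' : W.Sec →ₗ[ℂ] V.Sec}
    (h : IsFormalAdj μ A A') (hA : IsDiffOp A) (hA' : IsDiffOp A') {t : W.Sec} {s : V.Sec}
    (hK : IsCompact (W.supp t ∩ V.supp s)) : W.pair μ t (A s) = V.pair μ (A' t) s := by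
  obtain ⟨χ, h1, hc, -, -⟩ := exists_cutoff (n := n) hK isOpen_univ (subset_univ _)
  have h1' : ∀ x ∈ W.supp t ∩ V.supp s, ∀ᶠ y in 𝓝 x, χ y = 1 := fun x hx ↦
    Filter.Eventually.filter_mono (nhds_le_nhdsSet hx) h1
  let s' : V.Secc := ⟨V.fmul χ s, V.fmul_mem_Secc hc s⟩
  let t' : W.Secc := ⟨W.fmul χ t, W.fmul_mem_Secc hc t⟩
  have hs' : ∀ x ∉ V.supp s, x ∉ V.supp s'.1 := fun x hx hx' ↦
    hx (HermBundle.supp_fmul_subset χ s hx').1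
  have ht' : ∀ x ∉ W.supp t, x ∉ W.supp t'.1 := fun x hx hx' ↦
    hx (HermBundle.supp_fmul_subset χ t hx').1
  have e1 : W.pair μ t (A s) = W.pair μ t'.1 (A s'.1) := by
    unfold HermBundle.pair
    refine integral_congr_ae (Eventually.of_forall fun x ↦ ?_)
    change W.form x (t x) (A s x) = W.form x (t'.1 x) (A s'.1 x)
    by_cases hx : x ∈ W.supp t ∩ V.supp s
    · have e2 : A s'.1 x = A s x := hA.congr_of_eventually (by
        filter_upwards [h1' x hx] with y hy
        change χ y • s y = s y
        rw [hy, one_smul])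
      have e3 : t'.1 x = t x := by
        change χ x • t x = t x
        rw [(h1' x hx).self_of_nhds, one_smul]
      rw [e2, e3]
    · rw [HermBundle.form_eq_zero fun h ↦ hx ⟨h.1, hA.supp_subset s h.2⟩,
        HermBundle.form_eq_zero fun h ↦ hx ⟨by_contra fun h' ↦ ht' x h' h.1,
          by_contra fun h' ↦ hs' x h' (hA.supp_subset _ h.2)⟩]
  have e2 : V.pair μ (A' t) s = V.pair μ (A' t'.1) s'.1 := by
    unfold HermBundle.pair
    refine integral_congr_ae (Eventually.of_forall fun x ↦ ?_)
    change V.form x (A' t x) (s x) = V.form x (A' t'.1 x) (s'.1 x)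
    by_cases hx : x ∈ W.supp t ∩ V.supp s
    · have e2 : A' t'.1 x = A' t x := hA'.congr_of_eventually (by
        filter_upwards [h1' x hx] with y hy
        change χ y • t y = t y
        rw [hy, one_smul])
      have e3 : s'.1 x = s x := by
        change χ x • s x = s x
        rw [(h1' x hx).self_of_nhds, one_smul]
      rw [e2, e3]
    · rw [HermBundle.form_eq_zero fun h ↦ hx ⟨hA'.supp_subset t h.1, h.2⟩,
        HermBundle.form_eq_zero fun h ↦ hx ⟨by_contra fun h' ↦ ht' x h' (hA'.supp_subset _ h.1),
          by_contra fun h' ↦ hs' x h' h.2⟩]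
  rw [e1, e2, h s' t']

omit [IsFiniteMeasureOnCompacts μ] [BorelSpace M] in
theorem IsFormalAdj.pair_left {A : V.Sec →ₗ[ℂ] W.Sec} {A' : W.Sec →ₗ[ℂ] V.Sec}
    (h : IsFormalAdj μ A A') (hA : IsDiffOp A) (hA' : IsDiffOp A') (f : W.Secc) (s : V.Sec) :
    W.pair μ f.1 (A s) = V.pair μ (A' f.1) s :=
  h.pair_eq hA hA' (IsCompact.inter_right f.2 (V.isClosed_supp s))

omit [IsFiniteMeasureOnCompacts μ] [BorelSpace M] in
theorem IsFormalAdj.pair_right {A : V.Sec →ₗ[ℂ] W.Sec} {A' : W.Sec →ₗ[ℂ] V.Sec}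
    (h : IsFormalAdj μ A A') (hA : IsDiffOp A) (hA' : IsDiffOp A') (t : W.Sec) (f : V.Secc) :
    W.pair μ t (A f.1) = V.pair μ (A' t) f.1 := by
  rw [V.pair_conj, h.symm.pair_left hA' hA f t, ← W.pair_conj]

end Pairing

/-! ### Green operators and the Cauchy problem -/

section Causal

variable {n : ℕ} {M : Type u} [TopologicalSpace M] [ChartedSpace (EuclideanSpace ℝ (Fin n)) M]
  [IsManifold (𝓡 n) ∞ M]

theorem PreSpacetime.subset_Jplus (X : PreSpacetime n M) (A : Set M) : A ⊆ X.Jplus A :=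
  fun p hp ↦ ⟨p, hp, Or.inl rfl⟩

theorem PreSpacetime.subset_Jminus (X : PreSpacetime n M) (A : Set M) : A ⊆ X.Jminus A :=
  fun p hp ↦ ⟨p, hp, Or.inl rfl⟩

theorem PreSpacetime.Jplus_mono (X : PreSpacetime n M) {A B : Set M} (h : A ⊆ B) :
    X.Jplus A ⊆ X.Jplus B := fun _ ⟨p, hp, hq⟩ ↦ ⟨p, h hp, hq⟩

theorem PreSpacetime.Jminus_mono (X : PreSpacetime n M) {A B : Set M} (h : A ⊆ B) :
    X.Jminus A ⊆ X.Jminus B := fun _ ⟨p, hp, hq⟩ ↦ ⟨p, h hp, hq⟩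

variable [MeasurableSpace M] [T2Space M] [SecondCountableTopology M] (X : Spacetime n M)

/-- Compactness of causal diamonds between a compact set and a convergent sequence makes causal
futures of compact sets closed. -/
theorem Spacetime.isClosed_Jplus {K : Set M} (hK : IsCompact K) : IsClosed (X.Jplus K) := by
  refine IsSeqClosed.isClosed fun q p hq hqp ↦ ?_
  have hL := hqp.isCompact_insert_range
  have h1 := (X.diamond K _ hK hL).isClosed
  have h2 : ∀ k, q k ∈ X.Jplus K ∩ X.Jminus (insert p (range q)) := fun k ↦
    ⟨hq k, X.subset_Jminus _ (mem_insert_of_mem _ (mem_range_self k))⟩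
  exact (h1.mem_of_tendsto hqp (Eventually.of_forall h2)).1

theorem Spacetime.isClosed_Jminus {K : Set M} (hK : IsCompact K) : IsClosed (X.Jminus K) := by
  refine IsSeqClosed.isClosed fun q p hq hqp ↦ ?_
  have hL := hqp.isCompact_insert_range
  have h1 := (X.diamond _ K hL hK).isClosed
  have h2 : ∀ k, q k ∈ X.Jplus (insert p (range q)) ∩ X.Jminus K := fun k ↦
    ⟨X.subset_Jplus _ (mem_insert_of_mem _ (mem_range_self k)), hq k⟩
  exact (h1.mem_of_tendsto hqp (Eventually.of_forall h2)).2

variable [BorelSpace M]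

instance : IsFiniteMeasureOnCompacts X.vol :=
  haveI := X.toPreSpacetime.isSmoothMetric.isLocallyFiniteMeasure X.isVolume
  inferInstance

instance : X.vol.IsOpenPosMeasure := X.toPreSpacetime.isSmoothMetric.isOpenPosMeasure X.isVolume

end Causal

section Green

variable {n : ℕ} {M : Type u} [TopologicalSpace M] [ChartedSpace (EuclideanSpace ℝ (Fin n)) M]
  [IsManifold (𝓡 n) ∞ M] [MeasurableSpace M] [T2Space M] [SecondCountableTopology M]
  [BorelSpace M] {X : Spacetime n M} {V : HermBundle.{u, v, w} n M} {D : V.Sec →ₗ[ℂ] V.Sec}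
  (Gr : GreenOps X V D)

theorem GreenOps.G_apply (v : V.Secc) : Gr.G v = Gr.ret v - Gr.adv v := rfl

theorem GreenOps.D_G (v : V.Secc) : D (Gr.G v) = 0 := by
  rw [Gr.G_apply, map_sub, Gr.D_ret, Gr.D_adv, sub_self]

theorem GreenOps.spaceCompact_G (v : V.Secc) : X.SpaceCompact V (Gr.G v) := by
  refine ⟨V.supp v.1, v.2, (HermBundle.supp_sub_subset _ _).trans ?_⟩
  exact union_subset_union (Gr.supp_ret v) (Gr.supp_adv v)

section
variable (hD : IsDiffOp D) (hadj : IsFormalAdj X.vol D D)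
include Gr hD hadj

/-- The advanced operator is the adjoint of the retarded one: the causal diamond of the two supports
is compact, so that `D` can be moved across the pairing. -/
theorem GreenOps.pair_ret (v f : V.Secc) :
    V.pair X.vol v.1 (Gr.ret f) = V.pair X.vol (Gr.adv v) f.1 := by
  conv_lhs => rw [← Gr.D_adv v]
  rw [← hadj.pair_eq hD hD, Gr.D_ret]
  refine (X.diamond _ _ f.2 v.2).of_isClosed_subset
    ((V.isClosed_supp _).inter (V.isClosed_supp _)) ?_
  exact fun x hx ↦ ⟨Gr.supp_ret f hx.2, Gr.supp_adv v hx.1⟩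

theorem GreenOps.pair_G (v f : V.Secc) :
    V.pair X.vol v.1 (Gr.G f) = -V.pair X.vol (Gr.G v) f.1 := by
  have h1 := Gr.pair_ret hD hadj v f
  have h2 : V.pair X.vol v.1 (Gr.adv f) = V.pair X.vol (Gr.ret v) f.1 := by
    rw [V.pair_conj, ← Gr.pair_ret hD hadj f v, ← V.pair_conj]
  rw [Gr.G_apply, Gr.G_apply, V.pair_sub_right, V.pair_sub_left, h1, h2, neg_sub]

/-- Uniqueness of solutions supported in the causal future of a compact set. -/
theorem GreenOps.eq_zero_of_future {L : Set M} (hL : IsCompact L) {f : V.Sec}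
    (hf : V.supp f ⊆ X.Jplus L) (h0 : D f = 0) : f = 0 := by
  refine HermBundle.ext_of_pair (μ := X.vol) fun g ↦ ?_
  rw [← Gr.D_adv g, ← hadj.pair_eq hD hD, h0, V.pair_zero_right, V.pair_zero_right]
  refine (X.diamond _ _ hL g.2).of_isClosed_subset
    ((V.isClosed_supp _).inter (V.isClosed_supp _)) ?_
  exact fun x hx ↦ ⟨hf hx.2, Gr.supp_adv g hx.1⟩

/-- Uniqueness of solutions supported in the causal past of a compact set. -/
theorem GreenOps.eq_zero_of_past {L : Set M} (hL : IsCompact L) {f : V.Sec}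
    (hf : V.supp f ⊆ X.Jminus L) (h0 : D f = 0) : f = 0 := by
  refine HermBundle.ext_of_pair (μ := X.vol) fun g ↦ ?_
  rw [← Gr.D_ret g, ← hadj.pair_eq hD hD, h0, V.pair_zero_right, V.pair_zero_right]
  refine (X.diamond _ _ g.2 hL).of_isClosed_subset
    ((V.isClosed_supp _).inter (V.isClosed_supp _)) ?_
  exact fun x hx ↦ ⟨Gr.supp_ret g hx.1, hf hx.2⟩

theorem GreenOps.ret_eq {L : Set M} (hL : IsCompact L) {f : V.Sec} {v : V.Secc}
    (hf : V.supp f ⊆ X.Jplus L) (h0 : D f = v.1) : Gr.ret v = f := by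
  rw [← sub_eq_zero]
  refine Gr.eq_zero_of_future hD hadj (L := V.supp v.1 ∪ L) (IsCompact.union v.2 hL) ?_ ?_
  · refine (HermBundle.supp_sub_subset _ _).trans (union_subset ?_ ?_)
    · exact (Gr.supp_ret v).trans (X.Jplus_mono subset_union_left)
    · exact hf.trans (X.Jplus_mono subset_union_right)
  · rw [map_sub, Gr.D_ret, h0, sub_self]

theorem GreenOps.adv_eq {L : Set M} (hL : IsCompact L) {f : V.Sec} {v : V.Secc}
    (hf : V.supp f ⊆ X.Jminus L) (h0 : D f = v.1) : Gr.adv v = f := by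
  rw [← sub_eq_zero]
  refine Gr.eq_zero_of_past hD hadj (L := V.supp v.1 ∪ L) (IsCompact.union v.2 hL) ?_ ?_
  · refine (HermBundle.supp_sub_subset _ _).trans (union_subset ?_ ?_)
    · exact (Gr.supp_adv v).trans (X.Jminus_mono subset_union_left)
    · exact hf.trans (X.Jminus_mono subset_union_right)
  · rw [map_sub, Gr.D_adv, h0, sub_self]

end

omit [BorelSpace M] in
/-- A section with space-compact support splits into a part with future-compact and a part with
past-compact support: away from the compact set `J⁺(L) ∩ J⁻(L)` the closed sets `J⁺(L)` and
`J⁻(L)` are disjoint. -/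
theorem Spacetime.SpaceCompact.split {f : V.Sec} (hf : X.SpaceCompact V f) :
    ∃ (L : Set M) (p q : V.Sec), IsCompact L ∧ V.supp p ⊆ X.Jplus L ∧ V.supp q ⊆ X.Jminus L ∧
      f = p + q := by
  classical
  obtain ⟨L, hL, hsupp⟩ := hf
  have hN : IsCompact (X.Jplus L ∩ X.Jminus L) := X.diamond L L hL hL
  obtain ⟨χ, h1, hc, -, -⟩ := exists_cutoff (n := n) hN isOpen_univ (subset_univ _)
  have h1' : ∀ x ∈ X.Jplus L ∩ X.Jminus L, ∀ᶠ y in 𝓝 x, χ y = 1 := fun x hx ↦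
    Filter.Eventually.filter_mono (nhds_le_nhdsSet hx) h1
  set r : V.Sec := V.fmul (1 - χ) f with hr
  have hr1 : ∀ y, χ y = 1 → r y = 0 := by
    intro y hy
    change (1 - χ y) • f y = 0
    rw [hy, sub_self, zero_smul]
  have hr0 : ∀ y, y ∉ V.supp f → r y = 0 := by
    intro y hy
    change (1 - χ y) • f y = 0
    rw [HermBundle.eq_zero_of_notMem_supp hy, smul_zero]
  let p₀ : V.Sec := ⟨fun x ↦ if x ∈ X.Jplus L then r x else 0, by
    refine V.isSmooth_of_eventually fun x ↦ ?_
    by_cases hxp : x ∈ X.Jplus L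
    · by_cases hxm : x ∈ X.Jminus L
      · refine ⟨0, ?_⟩
        filter_upwards [h1' x ⟨hxp, hxm⟩] with y hy
        rw [hr1 y hy, ite_self]
        rfl
      · refine ⟨r, ?_⟩
        filter_upwards [(X.isClosed_Jminus hL).isOpen_compl.mem_nhds hxm] with y hy
        split_ifs with h
        · rfl
        · exact (hr0 y fun h' ↦ (hsupp h').elim h hy).symm
    · refine ⟨0, ?_⟩
      filter_upwards [(X.isClosed_Jplus hL).isOpen_compl.mem_nhds hxp] with y hy
      rw [if_neg hy]
      rfl⟩
  have hp₀ : ∀ x, p₀ x = if x ∈ X.Jplus L then r x else 0 := fun _ ↦ rfl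
  refine ⟨L ∪ tsupport χ, p₀ + V.fmul χ f, r - p₀, hL.union hc, ?_, ?_, ?_⟩
  · refine (HermBundle.supp_add_subset _ _).trans (union_subset ?_ ?_)
    · refine HermBundle.supp_subset_of_closed (X.isClosed_Jplus (hL.union hc)) fun x hx ↦ ?_
      rw [hp₀, if_neg fun h ↦ hx (X.Jplus_mono subset_union_left h)]
    · exact (HermBundle.supp_fmul_subset χ f).trans (inter_subset_right.trans
        (subset_union_right.trans (X.subset_Jplus _)))
  · refine HermBundle.supp_subset_of_closed (X.isClosed_Jminus (hL.union hc)) fun x hx ↦ ?_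
    rw [V.sub_apply, hp₀]
    split_ifs with h
    · exact sub_self _
    · rw [sub_zero]
      exact hr0 x fun h' ↦ (hsupp h').elim h fun h ↦ hx (X.Jminus_mono subset_union_left h)
  · refine HermBundle.sec_ext fun x ↦ ?_
    change f x = p₀ x + χ x • f x + ((1 - χ x) • f x - p₀ x)
    rw [sub_smul, one_smul]
    abel

/-- Space-compact solutions are of the form `G v` with `v` compactly supported. -/
theorem GreenOps.exists_eq_G (hD : IsDiffOp D) (hadj : IsFormalAdj X.vol D D) {f : V.Sec}
    (hf : X.SpaceCompact V f) (h0 : D f = 0) : ∃ v : V.Secc, Gr.G v = f := by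
  obtain ⟨L, p, q, hL, hp, hq, rfl⟩ := hf.split
  -- `D p = -D q` is supported in `J⁺(L) ∩ J⁻(L)`, and `G (D p) = p - (-q)`
  have hpq : D p = -D q := by
    rw [map_add] at h0
    exact eq_neg_of_add_eq_zero_left h0
  have hsc : D p ∈ V.Secc := by
    refine HermBundle.mem_Secc_of_subset (X.diamond L L hL hL) fun x hx ↦ ⟨?_, ?_⟩
    · exact hp (hD.supp_subset p hx)
    · refine hq (hD.supp_subset q ?_)
      rw [hpq, ← map_neg] at hx
      have : V.supp (D (-q)) ⊆ V.supp (D q) :=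
        HermBundle.supp_subset_of_closed (V.isClosed_supp _) fun y hy ↦ by
          rw [map_neg, V.neg_apply, HermBundle.eq_zero_of_notMem_supp hy, neg_zero]
      exact this hx
  refine ⟨⟨D p, hsc⟩, ?_⟩
  have hq' : V.supp (-q) ⊆ X.Jminus L :=
    HermBundle.supp_subset_of_closed (X.isClosed_Jminus hL) fun y hy ↦ by
      rw [V.neg_apply, HermBundle.eq_zero_of_notMem_supp fun h ↦ hy (hq h), neg_zero]
  rw [Gr.G_apply, Gr.ret_eq hD hadj hL hp rfl,
    Gr.adv_eq hD hadj hL hq' (by rw [map_neg, ← hpq]), sub_neg_eq_add]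

end Green

section Cauchy

variable {d : ℕ} {M : Type u} [TopologicalSpace M]
  [ChartedSpace (EuclideanSpace ℝ (Fin (d + 1))) M] [IsManifold (𝓡 (d + 1)) ∞ M]
  [MeasurableSpace M] [T2Space M] [SecondCountableTopology M]
  {S : Type u} [TopologicalSpace S] [ChartedSpace (EuclideanSpace ℝ (Fin d)) S]
  [IsManifold (𝓡 d) ∞ S] [MeasurableSpace S]
  {X : Spacetime (d + 1) M} (Sg : CauchySurface X S)

section
variable [BorelSpace S]

instance : IsFiniteMeasureOnCompacts Sg.vol :=
  haveI := Sg.isSmoothMetric.isLocallyFiniteMeasure Sg.isVolume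
  inferInstance

instance : Sg.vol.IsOpenPosMeasure := Sg.isSmoothMetric.isOpenPosMeasure Sg.isVolume

end

variable [BorelSpace M] {Sg} {V : HermBundle.{u, v, w} (d + 1) M}
  {D : V.Sec →ₗ[ℂ] V.Sec} {Gr : GreenOps X V D}
  (C : CauchyData Sg Gr)

/-- The Cauchy data `ρ G v` of the solution `G v`. -/
def CauchyData.ρG (v : V.Secc) : C.W.Secc := ⟨C.ρ (Gr.G v), C.ρ_sc _ (Gr.spaceCompact_G v)⟩

theorem CauchyData.ρG_coe (v : V.Secc) : (C.ρG v).1 = C.ρ (Gr.G v) := rfl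

/-- The space-compact solution with given Cauchy data. -/
def CauchyData.sol (φ : C.W.Secc) : V.Sec := (C.wellPosed φ).choose

theorem CauchyData.sol_spec (φ : C.W.Secc) :
    X.SpaceCompact V (C.sol φ) ∧ D (C.sol φ) = 0 ∧ C.ρ (C.sol φ) = φ.1 :=
  (C.wellPosed φ).choose_spec.1

theorem CauchyData.exists_G_eq_sol (hD : IsDiffOp D) (hadj : IsFormalAdj X.vol D D)
    (φ : C.W.Secc) : ∃ v : V.Secc, Gr.G v = C.sol φ :=
  Gr.exists_eq_G hD hadj (C.sol_spec φ).1 (C.sol_spec φ).2.1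

theorem CauchyData.ρG_surjective (hD : IsDiffOp D) (hadj : IsFormalAdj X.vol D D) :
    Function.Surjective C.ρG := fun φ ↦ by
  obtain ⟨v, hv⟩ := C.exists_G_eq_sol hD hadj φ
  refine ⟨v, Subtype.ext ?_⟩
  rw [C.ρG_coe, hv, (C.sol_spec φ).2.2]

/-- The solution with Cauchy data `φ` is `(ρG)* G_Σ φ`. -/
theorem CauchyData.pair_sol (hD : IsDiffOp D) (hadj : IsFormalAdj X.vol D D) (f : V.Secc)
    (φ : C.W.Secc) : V.pair X.vol f.1 (C.sol φ) = C.W.pair Sg.vol (C.ρG f).1 (C.GS φ.1) := by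
  obtain ⟨v, hv⟩ := C.exists_G_eq_sol hD hadj φ
  rw [← hv, C.GS_def, C.ρG_coe, hv, (C.sol_spec φ).2.2]

variable {T : GaugeTheory.{u, v, w} X}

theorem GaugeTheory.D₀_diff (T : GaugeTheory.{u, v, w} X) : IsDiffOp (T.Kstar ∘ₗ T.K) :=
  T.Kstar_diff.comp T.K_diff

theorem GaugeTheory.D₁_diff (T : GaugeTheory.{u, v, w} X) : IsDiffOp (T.P + T.K ∘ₗ T.Kstar) :=
  T.P_diff.add (T.K_diff.comp T.Kstar_diff)

theorem GaugeTheory.D₀_adj (T : GaugeTheory.{u, v, w} X) :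
    IsFormalAdj X.vol (T.Kstar ∘ₗ T.K) (T.Kstar ∘ₗ T.K) := fun s t ↦ by
  have h1 := T.K_adj (T.Kstar_diff.onSecc (T.K_diff.onSecc s)) (T.K_diff.onSecc t)
  have h2 := T.K_adj s (T.K_diff.onSecc t)
  have h3 := T.K_adj.symm (T.K_diff.onSecc s) t
  exact h3.trans h2

theorem GaugeTheory.D₁_adj (T : GaugeTheory.{u, v, w} X) :
    IsFormalAdj X.vol (T.P + T.K ∘ₗ T.Kstar) (T.P + T.K ∘ₗ T.Kstar) := fun s t ↦ by
  have h2 := T.K_adj (T.Kstar_diff.onSecc s) t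
  have h3 := T.K_adj.symm s (T.Kstar_diff.onSecc t)
  have h4 := h2.trans h3
  rw [LinearMap.add_apply, LinearMap.add_apply, HermBundle.pair_add_right,
    HermBundle.pair_add_left, T.P_adj s t]
  congr 1

/-- The causal propagators intertwine `K`. -/
theorem GaugeTheory.K_G (T : GaugeTheory.{u, v, w} X) (f : T.V₀.Secc) :
    T.K (T.Gr₀.G f) = T.Gr₁.G (T.K_diff.onSecc f) := by
  have hint : ∀ s, (T.P + T.K ∘ₗ T.Kstar) (T.K s) = T.K ((T.Kstar ∘ₗ T.K) s) := by
    intro s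
    have : T.P (T.K s) = 0 := LinearMap.congr_fun T.PK s
    rw [LinearMap.add_apply, this, zero_add]
    rfl
  have h1 := T.Gr₁.ret_eq T.D₁_diff T.D₁_adj f.2 (v := T.K_diff.onSecc f)
    ((T.K_diff.supp_subset _).trans (T.Gr₀.supp_ret f)) (by rw [hint, T.Gr₀.D_ret]; rfl)
  have h2 := T.Gr₁.adv_eq T.D₁_diff T.D₁_adj f.2 (v := T.K_diff.onSecc f)
    ((T.K_diff.supp_subset _).trans (T.Gr₀.supp_adv f)) (by rw [hint, T.Gr₀.D_adv]; rfl)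
  rw [GreenOps.G_apply, GreenOps.G_apply, map_sub, h1, h2]

/-- The causal propagators intertwine `K*`. -/
theorem GaugeTheory.Kstar_G (T : GaugeTheory.{u, v, w} X) (f : T.V₁.Secc) :
    T.Kstar (T.Gr₁.G f) = T.Gr₀.G (T.Kstar_diff.onSecc f) := by
  refine HermBundle.ext_of_pair (μ := X.vol) fun g ↦ ?_
  have h0 := T.K_adj.symm.pair_left T.Kstar_diff T.K_diff g (T.Gr₁.G f)
  have h1 := T.Gr₁.pair_G T.D₁_diff T.D₁_adj (T.K_diff.onSecc g) f
  have h2 := T.Gr₀.pair_G T.D₀_diff T.D₀_adj g (T.Kstar_diff.onSecc f)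
  have h3 := T.K_adj.symm.pair_right T.Kstar_diff T.K_diff (T.Gr₀.G g) f
  rw [T.K_G] at h3
  exact h0.trans (h1.trans ((congrArg Neg.neg h3.symm).trans h2.symm))

variable [T2Space S] [SecondCountableTopology S] [BorelSpace S]

variable (Q : SurfaceTheory.{u, v, w} Sg T)

theorem SurfaceTheory.KS_ρG (f : T.V₀.Secc) :
    Q.KS (Q.C₀.ρG f).1 = Q.C₁.ρ (T.K (T.Gr₀.G f)) :=
  Q.KS_def _ (T.Gr₀.spaceCompact_G f) (T.Gr₀.D_G f)

/-- `K_Σ† ρ₁ = ρ₀ K*` on space-compact solutions. -/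
theorem SurfaceTheory.Kdag_ρG (f : T.V₁.Secc) :
    Q.Kdag (Q.C₁.ρG f).1 = (Q.C₀.ρG (T.Kstar_diff.onSecc f)).1 := by
  have key : Q.KSstar (Q.C₁.GS (Q.C₁.ρG f).1) =
      Q.C₀.GS (Q.C₀.ρG (T.Kstar_diff.onSecc f)).1 := by
    refine HermBundle.ext_of_pair (μ := Sg.vol) fun φ ↦ ?_
    obtain ⟨g, rfl⟩ := Q.C₀.ρG_surjective T.D₀_diff T.D₀_adj φ
    have h1 := Q.KS_adj.symm.pair_left Q.KSstar_diff Q.KS_diff (Q.C₀.ρG g)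
      (Q.C₁.GS (Q.C₁.ρG f).1)
    -- both sides are paired with Cauchy data `ρ₀ G₀ g`, and the identity `K G₀ = G₁ K` is
    -- transposed
    have h2 : Q.KS (Q.C₀.ρG g).1 = Q.C₁.ρ (T.Gr₁.G (T.K_diff.onSecc g)) := by
      rw [Q.KS_ρG, T.K_G]
    have h3 := Q.C₁.GS_def (T.K_diff.onSecc g) f
    have h4 := Q.C₀.GS_def g (T.Kstar_diff.onSecc f)
    have h5 := T.K_adj.symm.pair_left T.Kstar_diff T.K_diff g (T.Gr₁.G f)
    rw [T.Kstar_G] at h5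
    rw [h2] at h1
    exact h1.trans (h3.symm.trans (h5.symm.trans h4))
  change Q.C₀.GSinv (Q.KSstar (Q.C₁.GS _)) = _
  rw [key]
  exact LinearMap.congr_fun Q.C₀.inv_GS _

theorem SurfaceTheory.Kdag_diff : IsDiffOp Q.Kdag :=
  Q.C₀.GSinv_diff.comp (Q.KSstar_diff.comp Q.C₁.GS_diff)

/-- `K_Σ† K_Σ = 0`, because `K* K` annihilates the solutions of `D₀`. -/
theorem SurfaceTheory.Kdag_KS (s : Q.C₀.W.Sec) : Q.Kdag (Q.KS s) = 0 := by
  have hc : ∀ φ : Q.C₀.W.Secc, Q.Kdag (Q.KS φ.1) = 0 := by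
    intro φ
    obtain ⟨g, rfl⟩ := Q.C₀.ρG_surjective T.D₀_diff T.D₀_adj φ
    rw [Q.KS_ρG, T.K_G, ← Q.C₁.ρG_coe, Q.Kdag_ρG, Q.C₀.ρG_coe, ← T.Kstar_G, ← T.K_G]
    have : T.Kstar (T.K (T.Gr₀.G g)) = 0 := T.Gr₀.D_G g
    rw [this, map_zero]
  refine HermBundle.sec_ext fun x ↦ ?_
  obtain ⟨χ, h1, hcs, -, -⟩ := exists_cutoff (n := d) (isCompact_singleton (x := x))
    isOpen_univ (subset_univ _)
  have h2 := hc ⟨Q.C₀.W.fmul χ s, Q.C₀.W.fmul_mem_Secc hcs s⟩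
  have h3 := (Q.Kdag_diff.comp Q.KS_diff).congr_of_eventually (s := s) (x := x)
    (t := Q.C₀.W.fmul χ s) (by
      rw [nhdsSet_singleton] at h1
      filter_upwards [h1] with y hy
      rw [Q.C₀.W.fmul_apply, hy, one_smul])
  rw [LinearMap.comp_apply, LinearMap.comp_apply, h2] at h3
  exact h3

end Cauchy

/-! ### Operators with a formal adjoint on test spaces -/

section Adjoints

variable {n : ℕ} {M : Type u} [TopologicalSpace M] [ChartedSpace (EuclideanSpace ℝ (Fin n)) M]
  {V W : HermBundle.{u, v, w} n M}

theorem OrderLT.smul {R X Y : Type*} [AddCommGroup X] [Module ℂ X] [AddCommGroup Y] [Module ℂ Y]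
    {φ : R → X →ₗ[ℂ] X} {ψ : R → Y →ₗ[ℂ] Y} {k : ℕ} {A : X →ₗ[ℂ] Y} (c : ℂ)
    (hA : OrderLT φ ψ k A) : OrderLT φ ψ k (c • A) := by
  induction k generalizing A with
  | zero =>
    rw [show A = 0 from hA, smul_zero]
    rfl
  | succ k ih =>
    intro f
    have := ih (hA f)
    rwa [smul_sub, ← LinearMap.smul_comp, ← LinearMap.comp_smul] at this

theorem IsDiffOp.neg {A : V.Sec →ₗ[ℂ] W.Sec} (hA : IsDiffOp A) : IsDiffOp (-A) := by
  rw [← neg_one_smul ℂ A]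
  exact ⟨_, hA.choose_spec.smul (-1)⟩

end Adjoints

section AntiHermitian

variable {d : ℕ} {M : Type u} [TopologicalSpace M]
  [ChartedSpace (EuclideanSpace ℝ (Fin (d + 1))) M] [IsManifold (𝓡 (d + 1)) ∞ M]
  [MeasurableSpace M] [T2Space M] [SecondCountableTopology M] [BorelSpace M]
  {S : Type u} [TopologicalSpace S] [ChartedSpace (EuclideanSpace ℝ (Fin d)) S]
  [IsManifold (𝓡 d) ∞ S] [MeasurableSpace S] [T2Space S] [SecondCountableTopology S] [BorelSpace S]
  {X : Spacetime (d + 1) M} {Sg : CauchySurface X S}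
  {V : HermBundle.{u, v, w} (d + 1) M} {D : V.Sec →ₗ[ℂ] V.Sec} {Gr : GreenOps X V D}
  (C : CauchyData Sg Gr)

/-- `G_Σ` is antihermitian, because `G` is. -/
theorem CauchyData.GS_adj (hD : IsDiffOp D) (hadj : IsFormalAdj X.vol D D) :
    IsFormalAdj Sg.vol C.GS (-C.GS) := fun s t ↦ by
  obtain ⟨a, rfl⟩ := C.ρG_surjective hD hadj s
  obtain ⟨b, rfl⟩ := C.ρG_surjective hD hadj t
  have h1 := C.GS_def b a
  have h2 := C.GS_def a b
  have h3 := Gr.pair_G hD hadj b a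
  rw [V.pair_conj (Gr.G b), h2] at h3
  rw [LinearMap.neg_apply, C.W.pair_neg_left, C.W.pair_conj (C.GS _)]
  exact h1.symm.trans h3

theorem CauchyData.pair_GS_left (hD : IsDiffOp D) (hadj : IsFormalAdj X.vol D D)
    (f : C.W.Secc) (t : C.W.Sec) :
    C.W.pair Sg.vol f.1 (C.GS t) = -C.W.pair Sg.vol (C.GS f.1) t := by
  rw [(C.GS_adj hD hadj).pair_left C.GS_diff C.GS_diff.neg, LinearMap.neg_apply, C.W.pair_neg_left]

theorem CauchyData.pair_GS_right (hD : IsDiffOp D) (hadj : IsFormalAdj X.vol D D)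
    (t : C.W.Sec) (f : C.W.Secc) :
    C.W.pair Sg.vol t (C.GS f.1) = -C.W.pair Sg.vol (C.GS t) f.1 := by
  rw [(C.GS_adj hD hadj).pair_right C.GS_diff C.GS_diff.neg, LinearMap.neg_apply, C.W.pair_neg_left]

theorem CauchyData.GS_GSinv (t : C.W.Sec) : C.GS (C.GSinv t) = t := LinearMap.congr_fun C.GS_inv t

theorem CauchyData.GSinv_GS (t : C.W.Sec) : C.GSinv (C.GS t) = t := LinearMap.congr_fun C.inv_GS t

theorem CauchyData.pair_GSinv_right (hD : IsDiffOp D) (hadj : IsFormalAdj X.vol D D)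
    (t : C.W.Sec) (f : C.W.Secc) :
    C.W.pair Sg.vol (C.GSinv t) f.1 = -C.W.pair Sg.vol t (C.GSinv f.1) := by
  have := C.pair_GS_right hD hadj (C.GSinv t) (C.GSinv_diff.onSecc f)
  rw [C.GS_GSinv] at this
  change C.W.pair Sg.vol (C.GSinv t) (C.GS (C.GSinv f.1)) = _ at this
  rw [C.GS_GSinv] at this
  exact this

end AntiHermitian

section TestSpaces

variable {d : ℕ} {S : Type u} [TopologicalSpace S] [ChartedSpace (EuclideanSpace ℝ (Fin d)) S]
  [IsManifold (𝓡 d) ∞ S] [MeasurableSpace S] [T2Space S] [SecondCountableTopology S] [BorelSpace S]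
  {W W' W'' : HermBundle.{u, v, w} d S} {μ : Measure S} [IsFiniteMeasureOnCompacts μ]
  [μ.IsOpenPosMeasure]
  {Y : TestSpace.{u, v, w, h} W μ} {Y' : TestSpace.{u, v, w, h} W' μ}
  {Y'' : TestSpace.{u, v, w, h} W'' μ}

variable (Y) in
include Y in
/-- A test space is Hausdorff because it embeds continuously into the space of sections. -/
theorem TestSpace.t2Space : T2Space Y.H :=
  have := W.t2Space_sec (μ := μ)
  T2Space.of_injective_continuous Y.incl_inj Y.incl.continuous

/-- The continuous form `(f|·)` on a test space. -/
def TestSpace.pairCL (Y : TestSpace.{u, v, w, h} W μ) (f : W.Secc) : Y.H →L[ℂ] ℂ :=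
  (W.pairCL μ f) ∘L Y.incl

theorem TestSpace.ext_pair {y y' : Y.H}
    (hy : ∀ f : W.Secc, W.pair μ f.1 (Y.incl y) = W.pair μ f.1 (Y.incl y')) : y = y' :=
  Y.incl_inj (HermBundle.ext_of_pair (μ := μ) hy)

/-- Continuous operators on a test space that agree on `Γ_c` are equal. -/
theorem TestSpace.ext_ofc {A B : Y.H →L[ℂ] Y'.H} (hAB : ∀ f, A (Y.ofc f) = B (Y.ofc f)) :
    A = B := by
  have := Y'.t2Space
  ext1 y
  exact congrFun (Y.ofc_dense.equalizer A.continuous B.continuous (funext hAB)) y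

/-- Interchange of the roles of an operator and its adjoint. -/
def AdjOp.symm (A : AdjOp Y Y') : AdjOp Y' Y where
  op := A.adj
  adj := A.op
  spec f g := by
    rw [W.pair_conj, ← A.spec g f, ← W'.pair_conj]

/-- The composition of operators with adjoints. The symmetry of the pairing of elements of
`ℋ ∩ ℋ'` makes the composition of the adjoints the adjoint of the composition. -/
def AdjOp.comp (B : AdjOp Y' Y'') (A : AdjOp Y Y') : AdjOp Y Y'' where
  op := B.op ∘L A.op
  adj := A.adj ∘L B.adj
  spec f g := by
    have h1 := Y'.compat (A.op (Y.ofc f)) (B.adj (Y''.ofc g)) (Y.pairCL f ∘L A.adj)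
      (Y''.pairCL g ∘L B.op) (fun k ↦ A.symm.spec k f) (fun k ↦ B.spec k g)
    change W.pair μ f.1 (Y.incl (A.adj (B.adj (Y''.ofc g)))) =
      starRingEnd ℂ (W''.pair μ g.1 (Y''.incl (B.op (A.op (Y.ofc f))))) at h1
    rw [W.pair_conj]
    exact ((congrArg (starRingEnd ℂ) h1).trans (Complex.conj_conj _)).symm

theorem AdjOp.spec' (A : AdjOp Y Y') (f : W.Secc) (g : W'.Secc) :
    W.pair μ f.1 (Y.incl (A.adj (Y'.ofc g))) = W'.pair μ (Y'.incl (A.op (Y.ofc f))) g.1 :=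
  A.symm.spec g f

theorem AdjOp.adj_ext {A B : AdjOp Y Y'} (hAB : A.op = B.op) : A.adj = B.adj := by
  refine TestSpace.ext_ofc fun g ↦ TestSpace.ext_pair fun f ↦ ?_
  rw [A.spec', B.spec', hAB]

/-- Operators that are formally self-adjoint on `Γ_c`. -/
def AdjOp.ofSelfAdj (A : Y.H →L[ℂ] Y.H) (hA : ∀ f g : W.Secc,
    W.pair μ f.1 (Y.incl (A (Y.ofc g))) = W.pair μ (Y.incl (A (Y.ofc f))) g.1) : AdjOp Y Y where
  op := A
  adj := A
  spec f g := hA g f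

/-- The operator `1 - A`. -/
def AdjOp.oneSub (A : AdjOp Y Y) : AdjOp Y Y where
  op := ContinuousLinearMap.id ℂ _ - A.op
  adj := ContinuousLinearMap.id ℂ _ - A.adj
  spec f g := by
    change W.pair μ g.1 (Y.incl (Y.ofc f - A.op (Y.ofc f))) =
      W.pair μ (Y.incl (Y.ofc g - A.adj (Y.ofc g))) f.1
    rw [map_sub, map_sub, HermBundle.pair_sub_right, HermBundle.pair_sub_left, A.spec, Y.incl_ofc,
      Y.incl_ofc]

theorem Restr.op_ofc {A : W.Sec →ₗ[ℂ] W'.Sec} (R : Restr Y Y' A) (hA : IsDiffOp A) (f : W.Secc) :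
    R.op (Y.ofc f) = Y'.ofc (hA.onSecc f) :=
  Y'.incl_inj (by rw [R.spec, Y.incl_ofc, Y'.incl_ofc]; rfl)

/-- The restrictions of a differential operator and of its formal adjoint to test spaces. -/
def Restr.adjOp {A : W.Sec →ₗ[ℂ] W'.Sec} {A' : W'.Sec →ₗ[ℂ] W.Sec} (R : Restr Y Y' A)
    (R' : Restr Y' Y A') (hA : IsFormalAdj μ A A') : AdjOp Y Y' where
  op := R.op
  adj := R'.op
  spec f g := by
    rw [R.spec, R'.spec, Y.incl_ofc, Y'.incl_ofc]
    exact hA f g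

end TestSpaces

section Weights

variable {d : ℕ} {S : Type u} [TopologicalSpace S] [ChartedSpace (EuclideanSpace ℝ (Fin d)) S]
  {W : HermBundle.{u, v, w} d S}

theorem Weight.fmul_wt_inv (a : Weight d S) (s : W.Sec) : W.fmul a.wt (W.fmul a.inv s) = s :=
  HermBundle.sec_ext fun x ↦ by
    rw [W.fmul_apply, W.fmul_apply, smul_smul]
    change (a.wt x * (a.wt x)⁻¹) • s x = s x
    rw [mul_inv_cancel₀ (a.pos x).ne', one_smul]

theorem Weight.fmul_inv_wt (a : Weight d S) (s : W.Sec) : W.fmul a.inv (W.fmul a.wt s) = s :=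
  HermBundle.sec_ext fun x ↦ by
    rw [W.fmul_apply, W.fmul_apply, smul_smul]
    change ((a.wt x)⁻¹ * a.wt x) • s x = s x
    rw [inv_mul_cancel₀ (a.pos x).ne', one_smul]

end Weights

/-! ### The algebra of the modified projections -/

section Projections

variable {d : ℕ} {M : Type u} [TopologicalSpace M]
  [ChartedSpace (EuclideanSpace ℝ (Fin (d + 1))) M] [IsManifold (𝓡 (d + 1)) ∞ M]
  [MeasurableSpace M] [T2Space M] [SecondCountableTopology M] [BorelSpace M]
  {S : Type u} [TopologicalSpace S] [ChartedSpace (EuclideanSpace ℝ (Fin d)) S]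
  [IsManifold (𝓡 d) ∞ S] [MeasurableSpace S] [T2Space S] [SecondCountableTopology S] [BorelSpace S]
  {X : Spacetime (d + 1) M} {Sg : CauchySurface X S} {T : GaugeTheory.{u, v, w} X}
  {Q : SurfaceTheory.{u, v, w} Sg T}

section
variable (L : TwoPointData.{u, v, w, h} Q)

theorem TwoPointData.G₁_G₁inv (y : L.H₁.H) : L.G₁.op (L.G₁inv.op y) = y :=
  L.H₁.incl_inj (by rw [L.G₁.spec, L.G₁inv.spec, Q.C₁.GS_GSinv])

theorem TwoPointData.G₁inv_G₁ (y : L.H₁.H) : L.G₁inv.op (L.G₁.op y) = y :=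
  L.H₁.incl_inj (by rw [L.G₁inv.spec, L.G₁.spec, Q.C₁.GSinv_GS])

theorem TwoPointData.G₀inv_G₀ (y : L.H₀.H) : L.G₀inv.op (L.G₀.op y) = y :=
  L.H₀.incl_inj (by rw [L.G₀inv.spec, L.G₀.spec, Q.C₀.GSinv_GS])

theorem TwoPointData.c₀_add (y : L.H₀.H) : L.c₀ 1 y + L.c₀ (-1) y = y := by
  have h1 : L.lam₀ 1 y - L.lam₀ (-1) y = I⁻¹ • L.G₀.op y := DFunLike.congr_fun L.lam₀_ccr y
  have h2 : ∀ s, L.c₀ s y = (((s : ℤ) : ℂ) * I) • L.G₀inv.op (L.lam₀ s y) := fun _ ↦ rfl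
  rw [h2, h2, Units.val_one, Units.val_neg, Units.val_one, Int.cast_one, Int.cast_neg, Int.cast_one,
    one_mul, neg_one_mul, neg_smul, ← sub_eq_add_neg, ← smul_sub, ← map_sub, h1, map_smul,
    L.G₀inv_G₀, smul_smul, mul_inv_cancel₀ I_ne_zero, one_smul]

theorem TwoPointData.c₁_add (y : L.H₁.H) : L.c₁ 1 y + L.c₁ (-1) y = y := by
  have h1 : L.lam₁ 1 y - L.lam₁ (-1) y = I⁻¹ • L.G₁.op y := DFunLike.congr_fun L.lam₁_ccr y
  have h2 : ∀ s, L.c₁ s y = (((s : ℤ) : ℂ) * I) • L.G₁inv.op (L.lam₁ s y) := fun _ ↦ rfl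
  rw [h2, h2, Units.val_one, Units.val_neg, Units.val_one, Int.cast_one, Int.cast_neg, Int.cast_one,
    one_mul, neg_one_mul, neg_smul, ← sub_eq_add_neg, ← smul_sub, ← map_sub, h1, map_smul,
    L.G₁inv_G₁, smul_smul, mul_inv_cancel₀ I_ne_zero, one_smul]

theorem TwoPointData.incl_KdagH (y : L.H₁.H) : L.H₀.incl (L.KdagH y) = Q.Kdag (L.H₁.incl y) := by
  change L.H₀.incl (L.G₀inv.op (L.Kstar.op (L.G₁.op y))) = _
  rw [L.G₀inv.spec, L.Kstar.spec, L.G₁.spec]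
  rfl

/-- `K_Σ* G_1Σ = G_0Σ K_Σ†`. -/
theorem SurfaceTheory.KSstar_GS (Q : SurfaceTheory.{u, v, w} Sg T) (s : Q.C₁.W.Sec) :
    Q.KSstar (Q.C₁.GS s) = Q.C₀.GS (Q.Kdag s) := (Q.C₀.GS_GSinv _).symm

end

namespace GaugeFixing

variable {L : TwoPointData.{u, v, w, h} Q} (A : GaugeFixing L)

/-- `⟨x⟩⁻¹ K_Σ ⟨x⟩` with its adjoint `⟨x⟩ K_Σ* ⟨x⟩⁻¹`. -/
def xKop : AdjOp L.H₀ L.H₁ := A.xK.adjOp A.xKstar fun f g ↦ by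
  change Q.C₁.W.pair _ g.1 (Q.C₁.W.fmul A.x.inv (Q.KS (Q.C₀.W.fmul A.x.wt f.1))) =
    Q.C₀.W.pair _ (Q.C₀.W.fmul A.x.wt (Q.KSstar (Q.C₁.W.fmul A.x.inv g.1))) f.1
  exact (HermBundle.pair_fmul A.x.inv g.1 _).symm.trans
    ((Q.KS_adj (Q.C₀.W.fmulc A.x.wt f) (Q.C₁.W.fmulc A.x.inv g)).trans
      (HermBundle.pair_fmul A.x.wt _ f.1).symm)

/-- Multiplication by `⟨x⟩⁻¹` on `ℋ_1`. -/
def xinvop : AdjOp L.H₁ L.H₁ := A.xinv₁.adjOp A.xinv₁ fun _ _ ↦ (HermBundle.pair_fmul _ _ _).symm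

theorem ofc_eq_xinv₁ (f : Q.C₁.W.Secc) :
    L.H₁.ofc f = A.xinv₁.op (L.H₁.ofc (Q.C₁.W.fmulc A.x.wt f)) :=
  L.H₁.incl_inj (by
    rw [A.xinv₁.spec, L.H₁.incl_ofc, L.H₁.incl_ofc]
    exact (A.x.fmul_inv_wt f.1).symm)

theorem xK_b (y : L.H₁.H) : A.xK.op (A.b.op y) = A.xinv₁.op (y - A.Pi.op y) :=
  L.H₁.incl_inj (by
    rw [A.xK.spec, A.xinv₁.spec, map_sub, ← A.K_B]
    rfl)

/-- The adjoint of `K_Σ B = 1 - Π`. -/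
theorem b_adj_xKstar (y : L.H₁.H) :
    A.b.adj (A.xKstar.op y) = A.xinv₁.op y - A.Pi.adj (A.xinv₁.op y) := by
  have h1 : (A.xKop.comp A.b).op = (A.xinvop.comp A.Pi.oneSub).op :=
    ContinuousLinearMap.ext fun y ↦ A.xK_b y
  exact DFunLike.congr_fun (AdjOp.adj_ext h1) y

theorem Pi_K (y : L.H₀.H) : A.Pi.op (L.K.op y) = 0 := by
  have : L.K.op y ∈ {f | A.Pi.op f = 0} := A.Pi_ker ▸ subset_closure (mem_range_self y)
  exact this

theorem Kstar_Pi_adj (y : L.H₁.H) : L.Kstar.op (A.Pi.adj y) = 0 := by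
  let Kop : AdjOp L.H₀ L.H₁ := L.K.adjOp L.Kstar Q.KS_adj
  let Z : AdjOp L.H₀ L.H₁ :=
    { op := 0, adj := 0, spec := fun f g ↦ by
        simp [HermBundle.pair_zero_left, HermBundle.pair_zero_right] }
  have h1 : (A.Pi.comp Kop).op = Z.op := ContinuousLinearMap.ext fun y ↦ A.Pi_K y
  exact DFunLike.congr_fun (AdjOp.adj_ext h1) y

theorem Pi_Pi (y : L.H₁.H) : A.Pi.op (A.Pi.op y) = A.Pi.op y := DFunLike.congr_fun A.Pi_proj y

section Bdag

theorem Bdag_eq {g : Q.C₀.W.Sec} {e : L.H₀.H}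
    (he : L.H₀.incl e = Q.C₀.W.fmul A.x.wt (Q.C₀.GS g)) :
    A.Bdag g = L.H₁.incl (L.G₁inv.op (A.b.adj e)) := by
  have hg : A.InDomBdag g := ⟨e, he⟩
  rw [Bdag, dif_pos hg, L.H₀.incl_inj (hg.choose_spec.trans he.symm)]

theorem Bdag_zero : A.Bdag 0 = 0 := by
  rw [A.Bdag_eq (e := 0) (by rw [map_zero, map_zero, map_zero]), map_zero, map_zero, map_zero]

/-- The adjoint of `⟨x⟩⁻¹ c_0^± ⟨x⟩` is `⟨x⟩ (c_0^±)* ⟨x⟩⁻¹`, and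
`(c_0^±)* = G_0Σ c_0^± G_0Σ⁻¹`. -/
theorem incl_xc₀_adj (s : ℤˣ) (y : L.H₀.H) : L.H₀.incl ((A.xc₀ s).adj y) =
    Q.C₀.W.fmul A.x.wt (Q.C₀.GS (L.H₀.incl (L.c₀ s (L.G₀inv.op (A.xinv₀.op y))))) := by
  have := Q.C₀.W.t2Space_sec (μ := Sg.vol)
  have hcont : Continuous fun y ↦
      Q.C₀.W.fmul A.x.wt (Q.C₀.GS (L.H₀.incl (L.c₀ s (L.G₀inv.op (A.xinv₀.op y))))) :=
    (isDiffOp_fmul _).continuous.comp (Q.C₀.GS_diff.continuous.comp (L.H₀.incl.continuous.comp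
      ((L.c₀ s).continuous.comp (L.G₀inv.op.continuous.comp A.xinv₀.op.continuous))))
  refine congrFun (L.H₀.ofc_dense.equalizer
    (L.H₀.incl.continuous.comp (A.xc₀ s).adj.continuous) hcont (funext fun g ↦ ?_)) y
  refine HermBundle.ext_of_pair (μ := Sg.vol) fun f ↦ ?_
  change Q.C₀.W.pair Sg.vol f.1 (L.H₀.incl ((A.xc₀ s).adj (L.H₀.ofc g))) =
    Q.C₀.W.pair Sg.vol f.1 (Q.C₀.W.fmul A.x.wt (Q.C₀.GS
      (L.H₀.incl (L.c₀ s (L.G₀inv.op (A.xinv₀.op (L.H₀.ofc g)))))))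
  let f' : Q.C₀.W.Secc := Q.C₀.W.fmulc A.x.wt f
  let g' : Q.C₀.W.Secc := Q.C₀.W.fmulc A.x.inv g
  let h' : Q.C₀.W.Secc := Q.C₀.GSinv_diff.onSecc g'
  have e1 : L.G₀inv.op (A.xinv₀.op (L.H₀.ofc g)) = L.H₀.ofc h' :=
    L.H₀.incl_inj (by
      rw [L.G₀inv.spec, A.xinv₀.spec, L.H₀.incl_ofc, L.H₀.incl_ofc]
      rfl)
  have e2 : ∀ k, Q.C₀.GS (L.H₀.incl (L.c₀ s k)) =
      (((s : ℤ) : ℂ) * I) • L.H₀.incl (L.lam₀ s k) := by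
    intro k
    change Q.C₀.GS (L.H₀.incl ((((s : ℤ) : ℂ) * I) • (L.G₀inv.op (L.lam₀ s k)))) = _
    rw [map_smul, map_smul, L.G₀inv.spec, Q.C₀.GS_GSinv]
  have e3 : L.H₀.incl (L.c₀ s (L.H₀.ofc f')) =
      (((s : ℤ) : ℂ) * I) • Q.C₀.GSinv (L.H₀.incl (L.lam₀ s (L.H₀.ofc f'))) := by
    rw [← L.G₀inv.spec, ← map_smul]
    rfl
  rw [(A.xc₀ s).spec', A.xc₀_spec s f f' rfl, HermBundle.pair_fmul, e1, e2,
    ← HermBundle.pair_fmul A.x.wt f.1, HermBundle.pair_smul_right, e3, HermBundle.pair_smul_left]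
  change _ * Q.C₀.W.pair Sg.vol _ g'.1 = _ * Q.C₀.W.pair Sg.vol f'.1 _
  rw [Q.C₀.pair_GSinv_right T.D₀_diff T.D₀_adj, L.lam₀_adj s f' h', map_mul, conj_I, map_intCast]
  change _ * -Q.C₀.W.pair Sg.vol _ h'.1 = _
  ring

/-- `⟨x⟩ K_Σ* ⟨x⟩⁻¹ (⟨x⟩ G_1Σ ⟨x⟩⁻¹)`, the conjugate of `K_Σ* G_1Σ`. -/
def xKG : L.H₁.H →L[ℂ] L.H₀.H := A.xKstar.op ∘L A.xG₁.op

theorem incl_xKG (k : L.H₁.H) : L.H₀.incl (A.xKG k) =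
    Q.C₀.W.fmul A.x.wt (Q.KSstar (Q.C₁.GS (L.H₁.incl (A.xinv₁.op k)))) := by
  change L.H₀.incl (A.xKstar.op (A.xG₁.op k)) = _
  rw [A.xKstar.spec, A.xG₁.spec, A.xinv₁.spec]
  simp only [LinearMap.comp_apply, A.x.fmul_inv_wt]

theorem incl_xc₀_adj_xKG (s : ℤˣ) (k : L.H₁.H) : L.H₀.incl ((A.xc₀ s).adj (A.xKG k)) =
    Q.C₀.W.fmul A.x.wt (Q.C₀.GS (L.H₀.incl (L.c₀ s (L.KdagH (A.xinv₁.op k))))) := by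
  have : L.G₀inv.op (A.xinv₀.op (A.xKG k)) = L.KdagH (A.xinv₁.op k) :=
    L.H₀.incl_inj (by
      rw [L.G₀inv.spec, A.xinv₀.spec, A.incl_xKG, L.incl_KdagH, A.x.fmul_inv_wt]
      rfl)
  rw [A.incl_xc₀_adj, this]

theorem Bdag_c₀ (s : ℤˣ) (k : L.H₁.H) : A.Bdag (L.H₀.incl (L.c₀ s (L.KdagH (A.xinv₁.op k)))) =
    L.H₁.incl (L.G₁inv.op (A.b.adj ((A.xc₀ s).adj (A.xKG k)))) :=
  A.Bdag_eq (A.incl_xc₀_adj_xKG s k)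

/-- The adjoint identity `B† K_Σ† = 1 - Π†`. -/
theorem b_adj_xKG (k : L.H₁.H) :
    L.G₁inv.op (A.b.adj (A.xKG k)) = A.xinv₁.op k - A.Pidag (A.xinv₁.op k) := by
  have h1 : A.xinv₁.op (A.xG₁.op k) = L.G₁.op (A.xinv₁.op k) :=
    L.H₁.incl_inj (by
      rw [A.xinv₁.spec, A.xG₁.spec, L.G₁.spec, A.xinv₁.spec]
      simp only [LinearMap.comp_apply, A.x.fmul_inv_wt])
  change L.G₁inv.op (A.b.adj (A.xKstar.op (A.xG₁.op k))) = _
  rw [A.b_adj_xKstar, h1, map_sub, L.G₁inv_G₁]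
  rfl

end Bdag

theorem cTilde_eq (s : ℤˣ) (k : L.H₁.H) : A.cTilde s (A.xinv₁.op k) =
    L.H₁.incl (A.Pidag (L.c₁ s (A.Pi.op (A.xinv₁.op k)))) +
      L.H₁.incl (L.G₁inv.op (A.b.adj ((A.xc₀ s).adj (A.xKG k)))) +
      Q.KS (Q.C₀.W.fmul A.x.wt (L.H₀.incl ((A.xc₀ s).op (A.b.op (A.xinv₁.op k))))) := by
  rw [cTilde, A.Bdag_c₀]

/-- `⟨x⟩⁻¹ c̃_1^± ⟨x⟩⁻¹`, as a continuous operator on `ℋ_1`. -/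
def cTildeH (s : ℤˣ) : L.H₁.H →L[ℂ] L.H₁.H :=
  A.xinv₁.op ∘L A.Pidag ∘L L.c₁ s ∘L A.Pi.op ∘L A.xinv₁.op +
    A.xinv₁.op ∘L L.G₁inv.op ∘L A.b.adj ∘L (A.xc₀ s).adj ∘L A.xKG +
    A.xK.op ∘L (A.xc₀ s).op ∘L A.b.op ∘L A.xinv₁.op

theorem cTilde_xinv (s : ℤˣ) (k : L.H₁.H) :
    A.cTilde s (A.xinv₁.op k) = Q.C₁.W.fmul A.x.wt (L.H₁.incl (A.cTildeH s k)) := by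
  have e : A.cTildeH s k = A.xinv₁.op (A.Pidag (L.c₁ s (A.Pi.op (A.xinv₁.op k)))) +
    A.xinv₁.op (L.G₁inv.op (A.b.adj ((A.xc₀ s).adj (A.xKG k)))) +
    A.xK.op ((A.xc₀ s).op (A.b.op (A.xinv₁.op k))) := rfl
  rw [e]
  simp only [map_add, A.xinv₁.spec (A.Pidag _), A.xinv₁.spec (L.G₁inv.op _), A.xK.spec,
    LinearMap.comp_apply, A.x.fmul_wt_inv]
  rw [cTilde, A.Bdag_c₀]

/-- The action of `c̃_1^±` on `Γ_c`, as a linear map. -/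
def cTildeL (s : ℤˣ) : Q.C₁.W.Secc →ₗ[ℂ] Q.C₁.W.Sec :=
  Q.C₁.W.fmul A.x.wt ∘ₗ L.H₁.incl.toLinearMap ∘ₗ (A.cTildeH s).toLinearMap ∘ₗ L.H₁.ofc ∘ₗ
    (Q.C₁.W.fmul A.x.wt).restrict (p := Q.C₁.W.Secc) (q := Q.C₁.W.Secc)
      (fun f hf ↦ (Q.C₁.W.fmulc A.x.wt ⟨f, hf⟩).2)

theorem cTildeL_apply (s : ℤˣ) (f : Q.C₁.W.Secc) : A.cTildeL s f = A.cTilde s (L.H₁.ofc f) := by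
  rw [A.ofc_eq_xinv₁, A.cTilde_xinv]
  rfl

theorem isLinearMap_cTilde (s : ℤˣ) :
    IsLinearMap ℂ (fun f : Q.C₁.W.Secc ↦ A.cTilde s (L.H₁.ofc f)) := by
  simp_rw [← A.cTildeL_apply]
  exact (A.cTildeL s).isLinear

theorem continuousOnSecc_cTilde (s : ℤˣ) :
    ContinuousOnSecc Q.C₁.W (fun f ↦ A.cTilde s (L.H₁.ofc f)) := by
  intro K hK
  have h1 : ContinuousOn (fun f ↦ L.H₁.ofc (Q.C₁.W.fmulc A.x.wt f))
      {f : Q.C₁.W.Secc | Q.C₁.W.supp f.1 ⊆ K} := by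
    refine (L.H₁.ofc_cont K hK).comp (Continuous.continuousOn ?_) fun f hf ↦ ?_
    · exact Continuous.subtype_mk ((isDiffOp_fmul _).continuous.comp continuous_subtype_val) _
    · exact (HermBundle.supp_fmul_subset _ _).trans (inter_subset_left.trans hf)
  have h2 := ((isDiffOp_fmul A.x.wt).continuous.comp (L.H₁.incl.continuous.comp
    (A.cTildeH s).continuous)).comp_continuousOn h1
  refine h2.congr fun f _ ↦ ?_
  exact (A.cTildeL_apply s f).symm

theorem GS_Pidag (y : L.H₁.H) : Q.C₁.GS (L.H₁.incl (A.Pidag y)) =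
    L.H₁.incl (A.Pi.adj (L.G₁.op y)) := by
  change Q.C₁.GS (L.H₁.incl (L.G₁inv.op (A.Pi.adj (L.G₁.op y)))) = _
  rw [L.G₁inv.spec, Q.C₁.GS_GSinv]

theorem _root_.GaugeFix.TwoPointData.G₁_c₁ (L : TwoPointData.{u, v, w, h} Q) (s : ℤˣ)
    (y : L.H₁.H) : L.G₁.op (L.c₁ s y) = (((s : ℤ) : ℂ) * I) • L.lam₁ s y := by
  change L.G₁.op ((((s : ℤ) : ℂ) * I) • L.G₁inv.op (L.lam₁ s y)) = _
  rw [map_smul, L.G₁_G₁inv]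

/-- The sesquilinear form of `G_1Σ c̃_1^±`: a multiple of the form of `Π* λ_1Σ^± Π`, which is
hermitian, plus two terms that are minus the adjoints of each other. -/
theorem pair_GS_cTilde (s : ℤˣ) (f g : Q.C₁.W.Secc) :
    Q.C₁.W.pair Sg.vol f.1 (Q.C₁.GS (A.cTilde s (L.H₁.ofc g))) =
      (((s : ℤ) : ℂ) * I) * Q.C₁.W.pair Sg.vol f.1
        (L.H₁.incl (A.Pi.adj (L.lam₁ s (A.Pi.op (L.H₁.ofc g))))) +
      Q.C₀.W.pair Sg.vol (L.H₀.incl ((A.xc₀ s).op (A.b.op (L.H₁.ofc f))))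
        (Q.C₀.W.fmul A.x.wt (Q.KSstar (Q.C₁.GS g.1))) -
      Q.C₀.W.pair Sg.vol (Q.C₀.W.fmul A.x.wt (Q.KSstar (Q.C₁.GS f.1)))
        (L.H₀.incl ((A.xc₀ s).op (A.b.op (L.H₁.ofc g)))) := by
  let γ : Q.C₁.W.Secc → Q.C₀.W.Secc := fun k ↦
    Q.C₀.W.fmulc A.x.wt (Q.KSstar_diff.onSecc (Q.C₁.GS_diff.onSecc k))
  have hγ : A.xKG (L.H₁.ofc (Q.C₁.W.fmulc A.x.wt g)) = L.H₀.ofc (γ g) :=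
    L.H₀.incl_inj (by
      rw [A.incl_xKG, ← A.ofc_eq_xinv₁, L.H₁.incl_ofc, L.H₀.incl_ofc]
      rfl)
  have e1 : Q.C₁.GS (A.cTilde s (L.H₁.ofc g)) =
      (((s : ℤ) : ℂ) * I) • L.H₁.incl (A.Pi.adj (L.lam₁ s (A.Pi.op (L.H₁.ofc g)))) +
      L.H₁.incl (A.b.adj ((A.xc₀ s).adj (L.H₀.ofc (γ g)))) +
      Q.C₁.GS (Q.KS (Q.C₀.W.fmul A.x.wt (L.H₀.incl ((A.xc₀ s).op (A.b.op (L.H₁.ofc g)))))) := by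
    have h1 := A.Bdag_c₀ s (L.H₁.ofc (Q.C₁.W.fmulc A.x.wt g))
    rw [← A.ofc_eq_xinv₁, hγ] at h1
    rw [cTilde, map_add, map_add, A.GS_Pidag, L.G₁_c₁, map_smul, map_smul, h1, L.G₁inv.spec,
      Q.C₁.GS_GSinv]
  have hsplit : ∀ (z : ℂ) (p q r : Q.C₁.W.Sec),
      Q.C₁.W.pair Sg.vol f.1 (z • p + q + Q.C₁.GS r) = z * Q.C₁.W.pair Sg.vol f.1 p +
        Q.C₁.W.pair Sg.vol f.1 q - Q.C₁.W.pair Sg.vol (Q.C₁.GS f.1) r := by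
    intro z p q r
    rw [HermBundle.pair_add_right, HermBundle.pair_add_right, HermBundle.pair_smul_right,
      Q.C₁.pair_GS_left T.D₁_diff T.D₁_adj, ← sub_eq_add_neg]
  rw [e1, hsplit]
  have e2 := ((A.xc₀ s).comp A.b).spec' f (γ g)
  have e3 := Q.KS_adj.pair_left Q.KS_diff Q.KSstar_diff (Q.C₁.GS_diff.onSecc f)
    (Q.C₀.W.fmul A.x.wt (L.H₀.incl ((A.xc₀ s).op (A.b.op (L.H₁.ofc g)))))
  rw [← HermBundle.pair_fmul] at e3
  exact congrArg₂ _ (congrArg₂ _ rfl e2) e3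

/-- `Π* λ_1Σ^± Π` is hermitian on `Γ_c`. -/
theorem pair_Pi_lam_Pi (s : ℤˣ) (f g : Q.C₁.W.Secc) :
    Q.C₁.W.pair Sg.vol f.1 (L.H₁.incl (A.Pi.adj (L.lam₁ s (A.Pi.op (L.H₁.ofc g))))) =
      starRingEnd ℂ (Q.C₁.W.pair Sg.vol g.1
        (L.H₁.incl (A.Pi.adj (L.lam₁ s (A.Pi.op (L.H₁.ofc f)))))) := by
  rw [← HermBundle.pair_conj]
  exact ((A.Pi.symm.comp (AdjOp.ofSelfAdj (L.lam₁ s) (L.lam₁_adj s))).comp A.Pi).spec g f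

theorem cTilde_adj (s : ℤˣ) (f g : Q.C₁.W.Secc) :
    Q.C₁.W.pair Sg.vol f.1 (Q.C₁.GS (A.cTilde s (L.H₁.ofc g))) =
      Q.C₁.W.pair Sg.vol (A.cTilde s (L.H₁.ofc f)) (Q.C₁.GS g.1) := by
  rw [Q.C₁.pair_GS_right T.D₁_diff T.D₁_adj, Q.C₁.W.pair_conj (Q.C₁.GS _) g.1, A.pair_GS_cTilde,
    A.pair_GS_cTilde, A.pair_Pi_lam_Pi s f g]
  simp only [map_sub, map_add, map_mul, conj_I, map_intCast, ← HermBundle.pair_conj]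
  ring

theorem pair_lamTilde (s : ℤˣ) (f g : Q.C₁.W.Secc) (hf : Q.Kdag f.1 = 0) (hg : Q.Kdag g.1 = 0) :
    Q.C₁.W.pair Sg.vol f.1 (A.lamTilde s g) =
      Q.C₁.W.pair Sg.vol f.1 (L.H₁.incl (A.Pi.adj (L.lam₁ s (A.Pi.op (L.H₁.ofc g))))) := by
  rw [lamTilde, HermBundle.pair_smul_right, A.pair_GS_cTilde, Q.KSstar_GS, Q.KSstar_GS, hf, hg]
  simp only [map_zero, HermBundle.pair_zero_left, HermBundle.pair_zero_right, add_zero, sub_zero]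
  have hs : ((s : ℤ) : ℂ) * ((s : ℤ) : ℂ) = 1 := by
    rcases Int.units_eq_one_or s with rfl | rfl <;> simp
  rw [← mul_assoc, mul_mul_mul_comm, hs, inv_mul_cancel₀ I_ne_zero, one_mul, one_mul]

/-- On `Ker K_Σ†` the form of `λ̃_1Σ^±` is that of `Π* λ_1Σ^± Π`, which is hermitian, so that its
imaginary part vanishes on the diagonal. -/
theorem lamTilde_nonneg (s : ℤˣ) (hpos : ∀ f : Q.C₁.W.Secc, Q.Kdag f.1 = 0 →
      0 ≤ (Q.C₁.W.pair Sg.vol f.1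
        (L.H₁.incl (A.Pi.adj (L.lam₁ s (A.Pi.op (L.H₁.ofc f)))))).re)
    (f : Q.C₁.W.Secc) (hf : Q.Kdag f.1 = 0) :
    0 ≤ (Q.C₁.W.pair Sg.vol f.1 (A.lamTilde s f)).re ∧
      (Q.C₁.W.pair Sg.vol f.1 (A.lamTilde s f)).im = 0 := by
  rw [A.pair_lamTilde s f f hf hf]
  exact ⟨hpos f hf, conj_eq_iff_im.1 (A.pair_Pi_lam_Pi s f f).symm⟩

/-- `Π† K_Σ = K_Σ`: by `1 - Π† = B† K_Σ†` this is `B† K_Σ† K_Σ = 0`. It holds on `Γ_c`, where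
`K_Σ† K_Σ = 0`, and extends by density. -/
theorem incl_Pidag_K (y : L.H₀.H) : A.Pidag (L.K.op y) = L.K.op y := by
  suffices H : A.Pidag ∘L L.K.op = L.K.op from DFunLike.congr_fun H y
  refine TestSpace.ext_ofc fun f ↦ ?_
  change A.Pidag (L.K.op (L.H₀.ofc f)) = L.K.op (L.H₀.ofc f)
  rw [L.K.op_ofc Q.KS_diff, A.ofc_eq_xinv₁, eq_comm, ← sub_eq_zero, ← A.b_adj_xKG]
  have : A.xKG (L.H₁.ofc (Q.C₁.W.fmulc A.x.wt (Q.KS_diff.onSecc f))) = 0 :=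
    L.H₀.incl_inj (by
      rw [A.incl_xKG, ← A.ofc_eq_xinv₁, L.H₁.incl_ofc, Q.KSstar_GS]
      change Q.C₀.W.fmul A.x.wt (Q.C₀.GS (Q.Kdag (Q.KS f.1))) = _
      rw [Q.Kdag_KS, map_zero, map_zero, map_zero])
  rw [this, map_zero, map_zero]

/-- `Π†` is the identity on the kernel of `Π`, the closure of the range of `K_Σ`. -/
theorem Pidag_sub (y : L.H₁.H) : A.Pidag (y - A.Pi.op y) = y - A.Pi.op y := by
  have := L.H₁.t2Space
  have h1 : IsClosed {z | A.Pidag z = z} := isClosed_eq A.Pidag.continuous continuous_id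
  have h2 : closure (range L.K.op) ⊆ {z | A.Pidag z = z} :=
    closure_minimal (by rintro _ ⟨z, rfl⟩; exact A.incl_Pidag_K z) h1
  refine h2 ?_
  rw [← A.Pi_ker]
  change A.Pi.op (y - A.Pi.op y) = 0
  rw [map_sub, A.Pi_Pi, sub_self]

theorem xc₀_op_add (y : L.H₀.H) : (A.xc₀ 1).op y + (A.xc₀ (-1)).op y = y := by
  suffices H : (A.xc₀ 1).op + (A.xc₀ (-1)).op = ContinuousLinearMap.id ℂ _ from
    DFunLike.congr_fun H y
  refine TestSpace.ext_ofc fun f ↦ L.H₀.incl_inj ?_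
  change L.H₀.incl ((A.xc₀ 1).op (L.H₀.ofc f) + (A.xc₀ (-1)).op (L.H₀.ofc f)) = _
  rw [map_add, A.xc₀_spec 1 f (Q.C₀.W.fmulc A.x.wt f) rfl,
    A.xc₀_spec (-1) f (Q.C₀.W.fmulc A.x.wt f) rfl, ← map_add, ← map_add, L.c₀_add, L.H₀.incl_ofc]
  exact (A.x.fmul_inv_wt f.1).trans (L.H₀.incl_ofc f).symm

theorem xc₀_adj_add (k : L.H₁.H) :
    (A.xc₀ 1).adj (A.xKG k) + (A.xc₀ (-1)).adj (A.xKG k) = A.xKG k :=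
  L.H₀.incl_inj (by
    rw [map_add, A.incl_xc₀_adj_xKG, A.incl_xc₀_adj_xKG, ← map_add, ← map_add, ← map_add,
      L.c₀_add, A.incl_xKG, L.incl_KdagH, ← Q.KSstar_GS])

/-- `c̃_1^+ + c̃_1^- = 1`: the sum is `Π† Π + B† K_Σ† + K_Σ B = Π† Π + (1 - Π†) + (1 - Π)`, and
`Π† (1 - Π) = 1 - Π`. -/
theorem cTilde_add (k : L.H₁.H) :
    A.cTilde 1 (A.xinv₁.op k) + A.cTilde (-1) (A.xinv₁.op k) = L.H₁.incl (A.xinv₁.op k) := by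
  have e1 : A.Pidag (L.c₁ 1 (A.Pi.op (A.xinv₁.op k))) + A.Pidag (L.c₁ (-1) (A.Pi.op (A.xinv₁.op k))) =
      A.Pidag (A.Pi.op (A.xinv₁.op k)) := by rw [← map_add A.Pidag, L.c₁_add]
  have e2 : L.G₁inv.op (A.b.adj ((A.xc₀ 1).adj (A.xKG k))) +
      L.G₁inv.op (A.b.adj ((A.xc₀ (-1)).adj (A.xKG k))) =
      A.xinv₁.op k - A.Pidag (A.xinv₁.op k) := by
    rw [← map_add L.G₁inv.op, ← map_add A.b.adj, A.xc₀_adj_add, A.b_adj_xKG]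
  have e3 : Q.KS (Q.C₀.W.fmul A.x.wt (L.H₀.incl ((A.xc₀ 1).op (A.b.op (A.xinv₁.op k))))) +
      Q.KS (Q.C₀.W.fmul A.x.wt (L.H₀.incl ((A.xc₀ (-1)).op (A.b.op (A.xinv₁.op k))))) =
      L.H₁.incl (A.xinv₁.op k - A.Pi.op (A.xinv₁.op k)) := by
    let KB : L.H₀.H →ₗ[ℂ] Q.C₁.W.Sec := Q.KS ∘ₗ Q.C₀.W.fmul A.x.wt ∘ₗ L.H₀.incl.toLinearMap
    have h1 := map_add KB ((A.xc₀ 1).op (A.b.op (A.xinv₁.op k)))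
      ((A.xc₀ (-1)).op (A.b.op (A.xinv₁.op k)))
    rw [A.xc₀_op_add] at h1
    exact h1.symm.trans ((A.K_B _).trans (map_sub L.H₁.incl _ _).symm)
  have e4 := A.Pidag_sub (A.xinv₁.op k)
  rw [map_sub A.Pidag] at e4
  have e5 : A.xinv₁.op k = A.Pidag (A.Pi.op (A.xinv₁.op k)) +
      (A.xinv₁.op k - A.Pidag (A.xinv₁.op k)) + (A.xinv₁.op k - A.Pi.op (A.xinv₁.op k)) := by
    rw [← e4]
    abel
  have f1 := (map_add L.H₁.incl _ _).symm.trans (congrArg L.H₁.incl e1)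
  have f2 := (map_add L.H₁.incl _ _).symm.trans (congrArg L.H₁.incl e2)
  have f5 := congrArg L.H₁.incl e5
  have f6 := (map_add L.H₁.incl _ _).trans
    (congrArg (· + L.H₁.incl (A.xinv₁.op k - A.Pi.op (A.xinv₁.op k))) (map_add L.H₁.incl
      (A.Pidag (A.Pi.op (A.xinv₁.op k))) (A.xinv₁.op k - A.Pidag (A.xinv₁.op k))))
  have f7 : ∀ p q r p' q' r' : Q.C₁.W.Sec,
      p + q + r + (p' + q' + r') = p + p' + (q + q') + (r + r') := fun p q r p' q' r' ↦ by abel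
  exact (congrArg₂ _ (A.cTilde_eq 1 k) (A.cTilde_eq (-1) k)).trans ((f7 _ _ _ _ _ _).trans
    ((congrArg₂ _ (congrArg₂ _ f1 f2) e3).trans (f6.symm.trans f5.symm)))

/-- On `Ker K_Σ†` the term with `B†` vanishes, and `K_Σ†` annihilates the other two because of
`K_Σ† Π† = (Π K_Σ)† = 0` and `K_Σ† K_Σ = 0`. -/
theorem Kdag_cTilde (s : ℤˣ) (k : L.H₁.H) (hk : Q.Kdag (L.H₁.incl (A.xinv₁.op k)) = 0) :
    Q.Kdag (A.cTilde s (A.xinv₁.op k)) = 0 := by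
  have h1 : ∀ y, Q.Kdag (L.H₁.incl (A.Pidag y)) = 0 := by
    intro y
    change Q.C₀.GSinv (Q.KSstar (Q.C₁.GS (L.H₁.incl (A.Pidag y)))) = 0
    rw [A.GS_Pidag, ← L.Kstar.spec, A.Kstar_Pi_adj, map_zero, map_zero]
  have h2 : L.KdagH (A.xinv₁.op k) = 0 := L.H₀.incl_inj (by rw [L.incl_KdagH, hk, map_zero])
  rw [cTilde, map_add, map_add, h1, h2, Q.Kdag_KS, map_zero, map_zero, A.Bdag_zero, map_zero,
    zero_add, zero_add]

/-- On `Ran K_Σ` only the term `K_Σ c_0^± B` remains, because of `Π K_Σ = 0` and `K_Σ† K_Σ = 0`. -/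
theorem cTilde_of_range (s : ℤˣ) (k : L.H₁.H) (e : L.H₀.H) (hk : A.xinv₁.op k = L.K.op e) :
    A.cTilde s (A.xinv₁.op k) = Q.KS (Q.C₀.W.fmul A.x.wt
      (L.H₀.incl ((A.xc₀ s).op (A.b.op (A.xinv₁.op k))))) := by
  have h2 : L.KdagH (A.xinv₁.op k) = 0 :=
    L.H₀.incl_inj (by rw [L.incl_KdagH, hk, L.K.spec, Q.Kdag_KS, map_zero])
  have h3 : A.Pi.op (A.xinv₁.op k) = 0 := by rw [hk, A.Pi_K]
  rw [cTilde, h2, h3, map_zero, map_zero, map_zero, map_zero, map_zero, A.Bdag_zero, zero_add,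
    zero_add]

/-- The continuous extension of `B† K_Σ†` is `1 - Π†`. -/
theorem extendsBK : A.ExtendsBK (ContinuousLinearMap.id ℂ _ - A.Pidag) := by
  intro f
  have he : L.H₀.incl (A.xKG (L.H₁.ofc (Q.C₁.W.fmulc A.x.wt f))) =
      Q.C₀.W.fmul A.x.wt (Q.C₀.GS (Q.Kdag f.1)) := by
    rw [A.incl_xKG, ← A.ofc_eq_xinv₁, L.H₁.incl_ofc, Q.KSstar_GS]
  refine ⟨⟨_, he⟩, ?_⟩
  rw [A.Bdag_eq he, A.b_adj_xKG, ← A.ofc_eq_xinv₁]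
  rfl

/-- The continuous extension of `Π† K_Σ` is `K_Σ`. -/
theorem extendsPiK : A.ExtendsPiK A.xK.op := by
  intro f g hg
  rw [A.incl_Pidag_K, A.xK.spec, L.K.spec, L.H₀.incl_ofc, L.H₀.incl_ofc, hg]
  exact A.x.fmul_wt_inv _

/-- `c_1^± = c̃_1^± + c_{1 reg}^±`. For the upper sign all terms but `c_1^+` cancel; the lower sign
follows since the `c_1^±` and the `c̃_1^±` each add up to `1` and the `c_{1 reg}^±` to `0`. -/
theorem c₁_eq (s : ℤˣ) (k : L.H₁.H) : L.H₁.incl (L.c₁ s (A.xinv₁.op k)) =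
    A.cTilde s (A.xinv₁.op k) +
      A.cReg (ContinuousLinearMap.id ℂ _ - A.Pidag) A.xK.op s (A.xinv₁.op k) := by
  set k' := A.xinv₁.op k with hk'
  have h1 : L.H₁.incl (L.c₁ 1 k') =
      A.cTilde 1 k' + A.cReg (ContinuousLinearMap.id ℂ _ - A.Pidag) A.xK.op 1 k' := by
    have e1 : (ContinuousLinearMap.id ℂ L.H₁.H - A.Pidag) (L.c₁ 1 k') =
      L.c₁ 1 k' - A.Pidag (L.c₁ 1 k') := rfl
    have e2 : Q.C₁.W.fmul A.x.wt (L.H₁.incl (A.xK.op ((A.xc₀ 1).op (A.b.op k')))) =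
        Q.KS (Q.C₀.W.fmul A.x.wt (L.H₀.incl ((A.xc₀ 1).op (A.b.op k')))) := by
      rw [A.xK.spec]
      exact A.x.fmul_wt_inv _
    rw [cTilde, cReg, e1, e2]
    simp only [Units.val_one, Int.cast_one, one_smul, map_sub]
    abel
  rcases Int.units_eq_one_or s with rfl | rfl
  · exact h1
  · have h2 : A.cReg (ContinuousLinearMap.id ℂ _ - A.Pidag) A.xK.op (-1) k' =
        -A.cReg (ContinuousLinearMap.id ℂ _ - A.Pidag) A.xK.op 1 k' := by
      simp only [cReg, Units.val_one, Units.val_neg, Int.cast_neg, Int.cast_one, one_smul, neg_smul]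
    have h3 := A.cTilde_add k
    have h4 : L.H₁.incl (L.c₁ 1 k') + L.H₁.incl (L.c₁ (-1) k') = L.H₁.incl k' := by
      rw [← map_add, L.c₁_add]
    rw [h2]
    rw [← h4, h1] at h3
    have h5 : A.cTilde (-1) k' = A.cReg (ContinuousLinearMap.id ℂ _ - A.Pidag) A.xK.op 1 k' +
        L.H₁.incl (L.c₁ (-1) k') := by
      rw [add_assoc] at h3
      exact add_left_cancel h3
    rw [h5]
    abel

end GaugeFixing

end Projections

/-! ### Iterated partial derivatives -/

section Words

variable {n : ℕ} {F : Type*} [NormedAddCommGroup F] [NormedSpace ℝ F]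

/-- The partial derivative in the `j`-th coordinate direction. -/
def partialDeriv (j : Fin n) (g : EuclideanSpace ℝ (Fin n) → F) : EuclideanSpace ℝ (Fin n) → F :=
  fun y ↦ fderiv ℝ g y (EuclideanSpace.single j 1)

/-- The iterated partial derivative along a word in the coordinate directions. -/
def wordDeriv (l : List (Fin n)) (g : EuclideanSpace ℝ (Fin n) → F) :
    EuclideanSpace ℝ (Fin n) → F := l.foldr partialDeriv g

theorem wordDeriv_nil (g : EuclideanSpace ℝ (Fin n) → F) : wordDeriv [] g = g := rfl

theorem wordDeriv_cons (j : Fin n) (l : List (Fin n)) (g : EuclideanSpace ℝ (Fin n) → F) :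
    wordDeriv (j :: l) g = partialDeriv j (wordDeriv l g) := rfl

theorem wordDeriv_append (l l' : List (Fin n)) (g : EuclideanSpace ℝ (Fin n) → F) :
    wordDeriv (l ++ l') g = wordDeriv l (wordDeriv l' g) := List.foldr_append

theorem contDiff_partialDeriv {g : EuclideanSpace ℝ (Fin n) → F} (hg : ContDiff ℝ ∞ g)
    (j : Fin n) : ContDiff ℝ ∞ (partialDeriv j g) :=
  (hg.fderiv_right (m := ∞) (by simp)).clm_apply contDiff_const

theorem contDiff_wordDeriv {g : EuclideanSpace ℝ (Fin n) → F} (hg : ContDiff ℝ ∞ g)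
    (l : List (Fin n)) : ContDiff ℝ ∞ (wordDeriv l g) := by
  induction l with
  | nil => exact hg
  | cons j l ih => exact contDiff_partialDeriv ih j

theorem hasCompactSupport_partialDeriv {g : EuclideanSpace ℝ (Fin n) → F}
    (hg : HasCompactSupport g) (j : Fin n) : HasCompactSupport (partialDeriv j g) :=
  hg.fderiv_apply ℝ _

theorem hasCompactSupport_wordDeriv {g : EuclideanSpace ℝ (Fin n) → F}
    (hg : HasCompactSupport g) (l : List (Fin n)) : HasCompactSupport (wordDeriv l g) := by
  induction l with
  | nil => exact hg
  | cons j l ih => exact hasCompactSupport_partialDeriv ih j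

theorem partialDeriv_congr {g g' : EuclideanSpace ℝ (Fin n) → F} {y : EuclideanSpace ℝ (Fin n)}
    (h : g =ᶠ[𝓝 y] g') (j : Fin n) : partialDeriv j g =ᶠ[𝓝 y] partialDeriv j g' := by
  filter_upwards [h.fderiv (𝕜 := ℝ)] with z hz
  simp only [partialDeriv, hz]

theorem wordDeriv_congr {g g' : EuclideanSpace ℝ (Fin n) → F} {y : EuclideanSpace ℝ (Fin n)}
    (h : g =ᶠ[𝓝 y] g') (l : List (Fin n)) : wordDeriv l g =ᶠ[𝓝 y] wordDeriv l g' := by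
  induction l with
  | nil => exact h
  | cons j l ih => exact partialDeriv_congr ih j

theorem fderiv_eq_sum_partialDeriv (g : EuclideanSpace ℝ (Fin n) → F)
    (y : EuclideanSpace ℝ (Fin n)) :
    fderiv ℝ g y = ∑ j, (EuclideanSpace.proj j : EuclideanSpace ℝ (Fin n) →L[ℝ] ℝ).smulRight
      (partialDeriv j g y) := by
  ext v
  have hv : v = ∑ j, v j • EuclideanSpace.single j (1 : ℝ) := by
    ext i
    simp [Pi.single_apply]
  conv_lhs => rw [hv, map_sum]
  rw [sum_apply]
  refine Finset.sum_congr rfl fun j _ ↦ ?_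
  rw [map_smul]
  rfl

theorem norm_fderiv_le_sum (g : EuclideanSpace ℝ (Fin n) → F) (y : EuclideanSpace ℝ (Fin n)) :
    ‖fderiv ℝ g y‖ ≤ ∑ j, ‖partialDeriv j g y‖ := by
  rw [fderiv_eq_sum_partialDeriv]
  refine (norm_sum_le _ _).trans (Finset.sum_le_sum fun j _ ↦ ?_)
  rw [ContinuousLinearMap.norm_smulRight_apply]
  refine (mul_le_mul_of_nonneg_right ?_ (norm_nonneg _)).trans (one_mul _).le
  refine ContinuousLinearMap.opNorm_le_bound _ zero_le_one fun v ↦ ?_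
  rw [one_mul]
  exact PiLp.norm_apply_le v j

/-- A class of differentiable functions that is stable under partial derivatives consists of smooth
functions. -/
theorem contDiff_of_partialDeriv_mem (𝒞 : Set (EuclideanSpace ℝ (Fin n) → F))
    (hd : ∀ g ∈ 𝒞, Differentiable ℝ g) (hp : ∀ g ∈ 𝒞, ∀ j, partialDeriv j g ∈ 𝒞)
    {g : EuclideanSpace ℝ (Fin n) → F} (hg : g ∈ 𝒞) : ContDiff ℝ ∞ g := by
  rw [contDiff_infty]
  intro m
  induction m generalizing g with
  | zero => exact contDiff_zero.2 (hd g hg).continuous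
  | succ m ih =>
    refine (contDiff_succ_iff_fderiv (n := m)).2 ⟨hd g hg, by simp, ?_⟩
    have : fderiv ℝ g = fun y ↦ ∑ j,
        (EuclideanSpace.proj j : EuclideanSpace ℝ (Fin n) →L[ℝ] ℝ).smulRight
          (partialDeriv j g y) := funext fun y ↦ fderiv_eq_sum_partialDeriv g y
    rw [this]
    exact ContDiff.sum fun j _ ↦ contDiff_const.smulRight (ih (hp g hg j))

end Words

section Series

variable {n : ℕ} {F : Type*} [NormedAddCommGroup F] [NormedSpace ℂ F] [CompleteSpace F]
  {ι : Type*}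

theorem summable_smul_of_bounded (a : lp (fun _ : ι ↦ ℂ) 1) {b : ι → F} {C : ℝ}
    (hb : ∀ i, ‖b i‖ ≤ C) : Summable fun i ↦ a i • b i := by
  have h1 : Summable fun i ↦ ‖a i‖ := by
    have := (lp.memℓp a).summable (by simp)
    simpa using this
  refine Summable.of_norm_bounded (h1.mul_right C) fun i ↦ ?_
  rw [norm_smul]
  exact mul_le_mul_of_nonneg_left (hb i) (norm_nonneg _)

theorem hasFDerivAt_tsum_smul (a : lp (fun _ : ι ↦ ℂ) 1) {g : ι → EuclideanSpace ℝ (Fin n) → F}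
    (hg : ∀ i, ContDiff ℝ ∞ (g i))
    (hb : ∀ l, ∃ C, ∀ i y, ‖wordDeriv l (g i) y‖ ≤ C) (y : EuclideanSpace ℝ (Fin n)) :
    HasFDerivAt (fun y ↦ ∑' i, a i • g i y) (∑' i, a i • fderiv ℝ (g i) y) y ∧
      Summable fun i ↦ a i • fderiv ℝ (g i) y := by
  choose C hC using hb
  have h1 : ∀ i y, ‖fderiv ℝ (g i) y‖ ≤ ∑ j, C [j] := fun i y ↦
    (norm_fderiv_le_sum _ _).trans (Finset.sum_le_sum fun j _ ↦ hC [j] i y)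
  have h0 : Summable fun i ↦ ‖a i‖ := by
    have := (lp.memℓp a).summable (by simp)
    simpa using this
  refine ⟨hasFDerivAt_tsum (h0.mul_right (∑ j, C [j])) (fun i x ↦
    (((hg i).differentiable (by simp) x).hasFDerivAt).const_smul (a i)) (fun i x ↦ ?_)
    (x₀ := y) (summable_smul_of_bounded a fun i ↦ hC [] i y) y, ?_⟩
  · rw [norm_smul]
    exact mul_le_mul_of_nonneg_left (h1 i x) (norm_nonneg _)
  · exact summable_smul_of_bounded a fun i ↦ h1 i y

theorem partialDeriv_tsum_smul (a : lp (fun _ : ι ↦ ℂ) 1) {g : ι → EuclideanSpace ℝ (Fin n) → F}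
    (hg : ∀ i, ContDiff ℝ ∞ (g i))
    (hb : ∀ l, ∃ C, ∀ i y, ‖wordDeriv l (g i) y‖ ≤ C) (j : Fin n) :
    partialDeriv j (fun y ↦ ∑' i, a i • g i y) = fun y ↦ ∑' i, a i • partialDeriv j (g i) y := by
  funext y
  obtain ⟨h1, h2⟩ := hasFDerivAt_tsum_smul a hg hb y
  rw [partialDeriv, h1.fderiv]
  exact ((ContinuousLinearMap.apply ℝ F (EuclideanSpace.single j (1 : ℝ))).map_tsum h2)

/-- An absolutely convergent series of smooth functions with uniformly bounded derivatives is
smooth. -/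
theorem contDiff_tsum_smul (a : lp (fun _ : ι ↦ ℂ) 1) {g : ι → EuclideanSpace ℝ (Fin n) → F}
    (hg : ∀ i, ContDiff ℝ ∞ (g i))
    (hb : ∀ l, ∃ C, ∀ i y, ‖wordDeriv l (g i) y‖ ≤ C) :
    ContDiff ℝ ∞ (fun y ↦ ∑' i, a i • g i y) := by
  refine contDiff_of_partialDeriv_mem
    {G | ∃ g : ι → EuclideanSpace ℝ (Fin n) → F, (∀ i, ContDiff ℝ ∞ (g i)) ∧
      (∀ l, ∃ C, ∀ i y, ‖wordDeriv l (g i) y‖ ≤ C) ∧ G = fun y ↦ ∑' i, a i • g i y} ?_ ?_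
    ⟨g, hg, hb, rfl⟩
  · rintro _ ⟨g, hg, hb, rfl⟩ y
    exact (hasFDerivAt_tsum_smul a hg hb y).1.differentiableAt
  · rintro _ ⟨g, hg, hb, rfl⟩ j
    refine ⟨fun i ↦ partialDeriv j (g i), fun i ↦ contDiff_partialDeriv (hg i) j, fun l ↦ ?_,
      partialDeriv_tsum_smul a hg hb j⟩
    obtain ⟨C, hC⟩ := hb (l ++ [j])
    exact ⟨C, fun i y ↦ by simpa [wordDeriv_append, wordDeriv_cons, wordDeriv_nil] using hC i y⟩

end Series

/-! ### Taylor expansion with smooth remainder -/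

section Hadamard

variable {n : ℕ} {F : Type*} [NormedAddCommGroup F] [NormedSpace ℝ F] [CompleteSpace F]

/-- The radial average `∫₀¹ t^m g(y₀ + t(y - y₀)) dt`. -/
def radialAvg (y₀ : EuclideanSpace ℝ (Fin n)) (m : ℕ) (g : EuclideanSpace ℝ (Fin n) → F)
    (y : EuclideanSpace ℝ (Fin n)) : F := ∫ t in (0 : ℝ)..1, t ^ m • g (y₀ + t • (y - y₀))

theorem hasFDerivAt_radialAvg (y₀ : EuclideanSpace ℝ (Fin n)) (m : ℕ)
    {g : EuclideanSpace ℝ (Fin n) → F} (hg : ContDiff ℝ ∞ g) (hc : HasCompactSupport g)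
    (y : EuclideanSpace ℝ (Fin n)) :
    HasFDerivAt (radialAvg y₀ m g)
      (∫ t in (0 : ℝ)..1, t ^ (m + 1) • fderiv ℝ g (y₀ + t • (y - y₀))) y := by
  have hg' : Continuous (fderiv ℝ g) := hg.continuous_fderiv (by simp)
  obtain ⟨C, hC⟩ := (hc.fderiv ℝ).exists_bound_of_continuous hg'
  have hC0 : 0 ≤ C := (norm_nonneg _).trans (hC 0)
  refine (intervalIntegral.hasFDerivAt_integral_of_dominated_of_fderiv_le (𝕜 := ℝ)
    (μ := volume) (a := 0) (b := 1) (s := univ) (F := fun y t ↦ t ^ m • g (y₀ + t • (y - y₀)))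
    (F' := fun y t ↦ t ^ (m + 1) • fderiv ℝ g (y₀ + t • (y - y₀))) (bound := fun _ ↦ C)
    (x₀ := y) univ_mem ?_ ?_ ?_ ?_ ?_ ?_)
  · refine Eventually.of_forall fun z ↦ Continuous.aestronglyMeasurable ?_
    have := hg.continuous
    fun_prop
  · refine Continuous.intervalIntegrable ?_ _ _
    have := hg.continuous
    fun_prop
  · have : SecondCountableTopologyEither ℝ (EuclideanSpace ℝ (Fin n) →L[ℝ] F) :=
      secondCountableTopologyEither_of_left _ _
    refine Continuous.aestronglyMeasurable ?_
    fun_prop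
  · refine Eventually.of_forall fun t ht z _ ↦ ?_
    rw [uIoc_of_le zero_le_one] at ht
    rw [norm_smul, norm_pow, Real.norm_of_nonneg ht.1.le]
    exact (mul_le_of_le_one_left (norm_nonneg _) (pow_le_one₀ ht.1.le ht.2)).trans (hC _)
  · exact intervalIntegrable_const
  · refine Eventually.of_forall fun t _ z _ ↦ ?_
    have h1 : HasFDerivAt (fun z : EuclideanSpace ℝ (Fin n) ↦ y₀ + t • (z - y₀))
        (t • ContinuousLinearMap.id ℝ _) z :=
      (((hasFDerivAt_id z).sub_const y₀).const_smul t).const_add y₀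
    have h2 := (((hg.differentiable (by simp) _).hasFDerivAt).comp z h1).const_smul (t ^ m)
    rw [ContinuousLinearMap.comp_smul, ContinuousLinearMap.comp_id, smul_smul, ← pow_succ] at h2
    exact h2

theorem partialDeriv_radialAvg (y₀ : EuclideanSpace ℝ (Fin n)) (m : ℕ)
    {g : EuclideanSpace ℝ (Fin n) → F} (hg : ContDiff ℝ ∞ g) (hc : HasCompactSupport g)
    (j : Fin n) : partialDeriv j (radialAvg y₀ m g) = radialAvg y₀ (m + 1) (partialDeriv j g) := by
  funext y
  have hg' : Continuous (fderiv ℝ g) := hg.continuous_fderiv (by simp)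
  rw [partialDeriv, (hasFDerivAt_radialAvg y₀ m hg hc y).fderiv, radialAvg]
  refine (ContinuousLinearMap.intervalIntegral_apply ?_ _)
  refine Continuous.intervalIntegrable ?_ _ _
  fun_prop

theorem contDiff_radialAvg (y₀ : EuclideanSpace ℝ (Fin n)) (m : ℕ)
    {g : EuclideanSpace ℝ (Fin n) → F} (hg : ContDiff ℝ ∞ g) (hc : HasCompactSupport g) :
    ContDiff ℝ ∞ (radialAvg y₀ m g) := by
  -- the partial derivatives of radial averages are radial averages with a higher power of `t`
  refine contDiff_of_partialDeriv_mem {G | ∃ m, ∃ g : EuclideanSpace ℝ (Fin n) → F,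
    ContDiff ℝ ∞ g ∧ HasCompactSupport g ∧ G = radialAvg y₀ m g} ?_ ?_ ⟨m, g, hg, hc, rfl⟩
  · rintro _ ⟨m, g, hg, hc, rfl⟩ y
    exact (hasFDerivAt_radialAvg y₀ m hg hc y).differentiableAt
  · rintro _ ⟨m, g, hg, hc, rfl⟩ j
    exact ⟨m + 1, partialDeriv j g, contDiff_partialDeriv hg j,
      hasCompactSupport_partialDeriv hc j, partialDeriv_radialAvg y₀ m hg hc j⟩

theorem wordDeriv_radialAvg (y₀ : EuclideanSpace ℝ (Fin n)) (m : ℕ)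
    {g : EuclideanSpace ℝ (Fin n) → F} (hg : ContDiff ℝ ∞ g) (hc : HasCompactSupport g)
    (l : List (Fin n)) :
    wordDeriv l (radialAvg y₀ m g) = radialAvg y₀ (m + l.length) (wordDeriv l g) := by
  induction l with
  | nil => rfl
  | cons j l ih =>
    rw [wordDeriv_cons, ih, partialDeriv_radialAvg y₀ _ (contDiff_wordDeriv hg l)
      (hasCompactSupport_wordDeriv hc l)]
    rfl

theorem radialAvg_self (y₀ : EuclideanSpace ℝ (Fin n)) (m : ℕ)
    {g : EuclideanSpace ℝ (Fin n) → F} (hg : g y₀ = 0) : radialAvg y₀ m g y₀ = 0 := by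
  simp [radialAvg, hg]

/-- Hadamard's lemma: a smooth function vanishing at `y₀` is a combination of the functions `y j -
y₀ j` with smooth coefficients. -/
theorem eq_sum_radialAvg (y₀ : EuclideanSpace ℝ (Fin n)) {g : EuclideanSpace ℝ (Fin n) → F}
    (hg : ContDiff ℝ ∞ g) (h0 : g y₀ = 0) (y : EuclideanSpace ℝ (Fin n)) :
    g y = ∑ j, (y j - y₀ j) • radialAvg y₀ 0 (partialDeriv j g) y := by
  have hg' : Continuous (fderiv ℝ g) := hg.continuous_fderiv (by simp)
  have h1 : ∀ t : ℝ, HasDerivAt (fun t : ℝ ↦ g (y₀ + t • (y - y₀)))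
      (fderiv ℝ g (y₀ + t • (y - y₀)) (y - y₀)) t := by
    intro t
    have h2 : HasDerivAt (fun t : ℝ ↦ y₀ + t • (y - y₀)) (y - y₀) t := by
      simpa using ((hasDerivAt_id t).smul_const (y - y₀)).const_add y₀
    exact ((hg.differentiable (by simp) _).hasFDerivAt).comp_hasDerivAt t h2
  have h3 := intervalIntegral.integral_eq_sub_of_hasDerivAt (a := 0) (b := 1) (fun t _ ↦ h1 t)
    (Continuous.intervalIntegrable (by fun_prop) _ _)
  simp only [one_smul, zero_smul, add_zero, add_sub_cancel, h0, sub_zero] at h3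
  rw [← h3]
  have h4 : ∀ j, Continuous (partialDeriv j g) := fun j ↦ (contDiff_partialDeriv hg j).continuous
  have h5 : ∀ t : ℝ, fderiv ℝ g (y₀ + t • (y - y₀)) (y - y₀) =
      ∑ j, (y j - y₀ j) • partialDeriv j g (y₀ + t • (y - y₀)) := by
    intro t
    rw [fderiv_eq_sum_partialDeriv, sum_apply]
    rfl
  simp_rw [h5]
  rw [intervalIntegral.integral_finsetSum]
  · refine Finset.sum_congr rfl fun j _ ↦ ?_
    rw [intervalIntegral.integral_smul]
    simp [radialAvg]
  · intro j _
    refine Continuous.intervalIntegrable ?_ _ _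
    have := h4 j
    fun_prop

end Hadamard

/-! ### Sections in local coordinates -/

section Localization

variable {n : ℕ} {M : Type u} [TopologicalSpace M] [ChartedSpace (EuclideanSpace ℝ (Fin n)) M]
  [T2Space M] [SecondCountableTopology M] [IsManifold (𝓡 n) ∞ M]

section
variable (V : HermBundle.{u, v, w} n M) (x₀ : M)

theorem HermBundle.exists_bump : ∃ χ : C^∞⟮𝓡 n, M; ℝ⟯, (∀ᶠ x in 𝓝 x₀, χ x = 1) ∧
    HasCompactSupport χ ∧ tsupport χ ⊆ V.dom x₀ := by
  obtain ⟨χ, h1, hc, hs, -⟩ := exists_cutoff (n := n) (isCompact_singleton (x := x₀))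
    (V.isOpen_dom x₀) (singleton_subset_iff.2 (V.mem_dom x₀))
  exact ⟨χ, by rwa [nhdsSet_singleton] at h1, hc, hs⟩

/-- A cutoff function that is one near `x₀` and supported in the local domain at `x₀`. -/
def HermBundle.bump : C^∞⟮𝓡 n, M; ℝ⟯ := (V.exists_bump x₀).choose

theorem HermBundle.bump_eq_one : ∀ᶠ x in 𝓝 x₀, V.bump x₀ x = 1 := (V.exists_bump x₀).choose_spec.1

theorem HermBundle.isCompact_tsupport_bump : IsCompact (tsupport (V.bump x₀)) :=
  (V.exists_bump x₀).choose_spec.2.1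

theorem HermBundle.tsupport_bump : tsupport (V.bump x₀) ⊆ V.dom x₀ :=
  (V.exists_bump x₀).choose_spec.2.2

/-- The open set around `x₀` on which the cutoff function at `x₀` equals one. -/
def HermBundle.core : Set M := interior {x | V.bump x₀ x = 1}

theorem HermBundle.isOpen_core : IsOpen (V.core x₀) := isOpen_interior

theorem HermBundle.mem_core : x₀ ∈ V.core x₀ := mem_interior_iff_mem_nhds.2 (V.bump_eq_one x₀)

variable {x₀} in
theorem HermBundle.bump_of_mem_core {x : M} (hx : x ∈ V.core x₀) : V.bump x₀ x = 1 :=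
  interior_subset (s := {x | V.bump x₀ x = 1}) hx

theorem HermBundle.core_subset : V.core x₀ ⊆ tsupport (V.bump x₀) := fun x hx ↦
  subset_tsupport _ (by rw [Function.mem_support, V.bump_of_mem_core hx]; exact one_ne_zero)

theorem HermBundle.core_subset_dom : V.core x₀ ⊆ V.dom x₀ :=
  (V.core_subset x₀).trans (V.tsupport_bump x₀)

theorem HermBundle.exists_plateau : ∃ θ : C^∞⟮𝓡 n, M; ℝ⟯, (∀ x ∈ tsupport (V.bump x₀), θ x = 1) ∧
    tsupport θ ⊆ V.dom x₀ := by
  obtain ⟨θ, h1, -, hs, -⟩ := exists_cutoff (n := n) (V.isCompact_tsupport_bump x₀)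
    (V.isOpen_dom x₀) (V.tsupport_bump x₀)
  exact ⟨θ, fun x hx ↦ h1.self_of_nhdsSet x hx, hs⟩

/-- A cutoff function that is one on the support of the first cutoff function. -/
def HermBundle.plateau : C^∞⟮𝓡 n, M; ℝ⟯ := (V.exists_plateau x₀).choose

theorem HermBundle.plateau_eq_one {x : M} (hx : x ∈ tsupport (V.bump x₀)) : V.plateau x₀ x = 1 :=
  (V.exists_plateau x₀).choose_spec.1 x hx

theorem HermBundle.tsupport_plateau : tsupport (V.plateau x₀) ⊆ V.dom x₀ :=
  (V.exists_plateau x₀).choose_spec.2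

/-- The support of localized sections in the coordinates at `x₀`. -/
def HermBundle.locSupp : Set (EuclideanSpace ℝ (Fin n)) :=
  extChartAt (𝓡 n) x₀ '' tsupport (V.bump x₀)

theorem HermBundle.tsupport_bump_subset_source :
    tsupport (V.bump x₀) ⊆ (extChartAt (𝓡 n) x₀).source := fun _ hx ↦ (V.tsupport_bump x₀ hx).1

theorem HermBundle.isCompact_locSupp : IsCompact (V.locSupp x₀) :=
  (V.isCompact_tsupport_bump x₀).image_of_continuousOn
    ((continuousOn_extChartAt x₀).mono (V.tsupport_bump_subset_source x₀))

theorem HermBundle.locSupp_subset : V.locSupp x₀ ⊆ (extChartAt (𝓡 n) x₀).target := by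
  rintro _ ⟨x, hx, rfl⟩
  exact (extChartAt (𝓡 n) x₀).map_source (V.tsupport_bump_subset_source x₀ hx)

/-- The smooth functions on the coordinate space that are supported in the coordinate image of the
support of the cutoff function. -/
def HermBundle.LocFun : Submodule ℂ (EuclideanSpace ℝ (Fin n) → V.F) where
  carrier := {g | ContDiff ℝ ∞ g ∧ ∀ y ∉ V.locSupp x₀, g y = 0}
  add_mem' := fun ha hb ↦ ⟨ha.1.add hb.1, fun y hy ↦ by
    rw [Pi.add_apply, ha.2 y hy, hb.2 y hy, add_zero]⟩
  zero_mem' := ⟨contDiff_const, fun _ _ ↦ rfl⟩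
  smul_mem' := fun c g hg ↦ ⟨hg.1.const_smul c, fun y hy ↦ by
    rw [Pi.smul_apply, hg.2 y hy, smul_zero]⟩

/-- Smoothness of functions on the coordinate space that vanish off the coordinate image of the
support of the cutoff function. -/
theorem HermBundle.contDiff_of_locSupp {F : Type*} [NormedAddCommGroup F] [NormedSpace ℝ F]
    {g : EuclideanSpace ℝ (Fin n) → F}
    (hg : ∀ y ∈ (extChartAt (𝓡 n) x₀).target, ContDiffAt ℝ ∞ g y)
    (h0 : ∀ y ∉ V.locSupp x₀, g y = 0) : ContDiff ℝ ∞ g := by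
  refine contDiff_iff_contDiffAt.2 fun y ↦ ?_
  by_cases hy : y ∈ V.locSupp x₀
  · exact hg y (V.locSupp_subset x₀ hy)
  · refine (contDiffAt_const (c := (0 : F))).congr_of_eventuallyEq ?_
    filter_upwards [(V.isCompact_locSupp x₀).isClosed.isOpen_compl.mem_nhds hy] with z hz
    exact h0 z hz

variable {V x₀} in
theorem HermBundle.LocFun.eventually_eq_zero (g : V.LocFun x₀) {y : EuclideanSpace ℝ (Fin n)}
    (hy : y ∉ V.locSupp x₀) : g.1 =ᶠ[𝓝 y] fun _ ↦ 0 := by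
  filter_upwards [(V.isCompact_locSupp x₀).isClosed.isOpen_compl.mem_nhds hy] with z hz
  exact g.2.2 z hz

theorem contDiffAt_comp_symm {F : Type*} [NormedAddCommGroup F] [NormedSpace ℝ F] {f : M → F}
    {y : EuclideanSpace ℝ (Fin n)} (hy : y ∈ (extChartAt (𝓡 n) x₀).target)
    (hf : ContMDiffAt (𝓡 n) 𝓘(ℝ, F) ∞ f ((extChartAt (𝓡 n) x₀).symm y)) :
    ContDiffAt ℝ ∞ (fun y ↦ f ((extChartAt (𝓡 n) x₀).symm y)) y := by
  have h1 := (contMDiffOn_extChartAt_symm (I := 𝓡 n) (n := ∞) x₀).contMDiffAt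
    ((isOpen_extChartAt_target x₀).mem_nhds hy)
  exact contMDiffAt_iff_contDiffAt.1 (hf.comp y h1)

open Classical in
/-- The localization of a section at `x₀`: its representation in the preferred chart and the
preferred trivialization at `x₀`, multiplied by the cutoff function at `x₀`. -/
def HermBundle.loc (s : V.Sec) : EuclideanSpace ℝ (Fin n) → V.F := fun y ↦
  if y ∈ (extChartAt (𝓡 n) x₀).target then
    V.bump x₀ ((extChartAt (𝓡 n) x₀).symm y) • V.triv x₀ s ((extChartAt (𝓡 n) x₀).symm y) else 0

theorem HermBundle.loc_of_mem_source (s : V.Sec) {x : M} (hx : x ∈ (extChartAt (𝓡 n) x₀).source) :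
    V.loc x₀ s (extChartAt (𝓡 n) x₀ x) = V.bump x₀ x • V.triv x₀ s x := by
  rw [HermBundle.loc, if_pos ((extChartAt (𝓡 n) x₀).map_source hx),
    (extChartAt (𝓡 n) x₀).left_inv hx]

theorem HermBundle.loc_eq_zero (s : V.Sec) {y : EuclideanSpace ℝ (Fin n)}
    (hy : y ∉ V.locSupp x₀) : V.loc x₀ s y = 0 := by
  by_cases h : y ∈ (extChartAt (𝓡 n) x₀).target
  · have h1 : (extChartAt (𝓡 n) x₀).symm y ∉ tsupport (V.bump x₀) := fun h' ↦
      hy ⟨_, h', (extChartAt (𝓡 n) x₀).right_inv h⟩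
    rw [HermBundle.loc, if_pos h, image_eq_zero_of_notMem_tsupport h1, zero_smul]
  · rw [HermBundle.loc, if_neg h]

theorem HermBundle.contDiff_loc (s : V.Sec) : ContDiff ℝ ∞ (V.loc x₀ s) := by
  refine V.contDiff_of_locSupp x₀ (fun y hy ↦ ?_) fun y hy ↦ V.loc_eq_zero x₀ s hy
  by_cases hd : (extChartAt (𝓡 n) x₀).symm y ∈ V.dom x₀
  · have h1 : ContMDiffAt (𝓡 n) 𝓘(ℝ, V.F) ∞ (fun x ↦ V.bump x₀ x • V.triv x₀ s x)
        ((extChartAt (𝓡 n) x₀).symm y) :=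
      (V.bump x₀).contMDiff.contMDiffAt.smul ((V.contMDiffOn_triv x₀ s).contMDiffAt
        ((trivializationAt V.F V.E x₀).open_baseSet.mem_nhds hd.2))
    refine (contDiffAt_comp_symm x₀ hy h1).congr_of_eventuallyEq ?_
    filter_upwards [(isOpen_extChartAt_target x₀).mem_nhds hy] with z hz
    rw [HermBundle.loc, if_pos hz]
  · have h1 : y ∉ V.locSupp x₀ := by
      rintro ⟨x, hx, rfl⟩
      rw [(extChartAt (𝓡 n) x₀).left_inv (V.tsupport_bump_subset_source x₀ hx)] at hd
      exact hd (V.tsupport_bump x₀ hx)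
    refine (contDiffAt_const (c := (0 : V.F))).congr_of_eventuallyEq ?_
    filter_upwards [(V.isCompact_locSupp x₀).isClosed.isOpen_compl.mem_nhds h1] with z hz
    exact V.loc_eq_zero x₀ s hz

/-- At every point of the coordinate space, either all localizations vanish or the localization is a
fixed multiple of the trivialized value at the corresponding point of the manifold. -/
theorem HermBundle.loc_eq_zero_or (y : EuclideanSpace ℝ (Fin n)) :
    (∀ s : V.Sec, V.loc x₀ s y = 0) ∨
      (y ∈ (extChartAt (𝓡 n) x₀).target ∧ (extChartAt (𝓡 n) x₀).symm y ∈ V.dom x₀ ∧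
        ∀ s : V.Sec, V.loc x₀ s y = V.bump x₀ ((extChartAt (𝓡 n) x₀).symm y) •
          V.triv x₀ s ((extChartAt (𝓡 n) x₀).symm y)) := by
  by_cases h : y ∈ V.locSupp x₀
  · obtain ⟨x, hx, rfl⟩ := h
    have h1 := V.tsupport_bump_subset_source x₀ hx
    refine Or.inr ⟨(extChartAt (𝓡 n) x₀).map_source h1, ?_, fun s ↦ ?_⟩
    · rw [(extChartAt (𝓡 n) x₀).left_inv h1]
      exact V.tsupport_bump x₀ hx
    · rw [V.loc_of_mem_source x₀ s h1, (extChartAt (𝓡 n) x₀).left_inv h1]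
  · exact Or.inl fun s ↦ V.loc_eq_zero x₀ s h

/-- The localization at `x₀` as a linear map. -/
def HermBundle.locL : V.Sec →ₗ[ℂ] V.LocFun x₀ where
  toFun s := ⟨V.loc x₀ s, V.contDiff_loc x₀ s, fun _ hy ↦ V.loc_eq_zero x₀ s hy⟩
  map_add' s t := by
    refine Subtype.ext (funext fun y ↦ ?_)
    change V.loc x₀ (s + t) y = V.loc x₀ s y + V.loc x₀ t y
    rcases V.loc_eq_zero_or x₀ y with h | ⟨-, hd, h⟩
    · rw [h, h, h, add_zero]
    · rw [h, h, h, V.triv_add hd, smul_add]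
  map_smul' c s := by
    refine Subtype.ext (funext fun y ↦ ?_)
    change V.loc x₀ (c • s) y = c • V.loc x₀ s y
    rcases V.loc_eq_zero_or x₀ y with h | ⟨-, hd, h⟩
    · rw [h, h, smul_zero]
    · rw [h, h, V.triv_smul hd, smul_comm]

/-- Multiplication by a smooth function in local coordinates. -/
def HermBundle.locMul (f : C^∞⟮𝓡 n, M; ℝ⟯) : V.LocFun x₀ →ₗ[ℂ] V.LocFun x₀ where
  toFun g := ⟨fun y ↦ f ((extChartAt (𝓡 n) x₀).symm y) • g.1 y, by
    refine V.contDiff_of_locSupp x₀ (fun y hy ↦ ?_) fun y hy ↦ by rw [g.2.2 y hy, smul_zero]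
    exact (contDiffAt_comp_symm x₀ hy f.contMDiff.contMDiffAt).smul g.2.1.contDiffAt, fun y hy ↦ by
      change _ • g.1 y = 0
      rw [g.2.2 y hy, smul_zero]⟩
  map_add' g g' := Subtype.ext (funext fun y ↦ smul_add _ _ _)
  map_smul' c g := Subtype.ext (funext fun y ↦ smul_comm _ _ _)

/-- Partial derivatives in local coordinates. -/
def HermBundle.locPartial (j : Fin n) : V.LocFun x₀ →ₗ[ℂ] V.LocFun x₀ where
  toFun g := ⟨partialDeriv j g.1, contDiff_partialDeriv g.2.1 j, fun y hy ↦ by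
    rw [(partialDeriv_congr (HermBundle.LocFun.eventually_eq_zero g hy) j).self_of_nhds]
    simp [partialDeriv]⟩
  map_add' g g' := by
    refine Subtype.ext (funext fun y ↦ ?_)
    change fderiv ℝ (g.1 + g'.1) y _ = fderiv ℝ g.1 y _ + fderiv ℝ g'.1 y _
    rw [fderiv_add (g.2.1.differentiable (by simp) y) (g'.2.1.differentiable (by simp) y)]
    rfl
  map_smul' c g := by
    refine Subtype.ext (funext fun y ↦ ?_)
    change fderiv ℝ (c • g.1) y _ = c • fderiv ℝ g.1 y _
    rw [fderiv_const_smul (g.2.1.differentiable (by simp) y)]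
    rfl

theorem HermBundle.locL_order : OrderLT V.fmul (V.locMul x₀) 1 (V.locL x₀) := fun f ↦ by
  change _ = _
  refine LinearMap.ext fun s ↦ sub_eq_zero.2 (Subtype.ext (funext fun y ↦ ?_))
  change V.loc x₀ (V.fmul f s) y = f ((extChartAt (𝓡 n) x₀).symm y) • V.loc x₀ s y
  rcases V.loc_eq_zero_or x₀ y with h | ⟨-, hd, h⟩
  · rw [h, h, smul_zero]
  · rw [h, h, V.triv_fmul hd, smul_comm]

theorem HermBundle.locPartial_commutator (j : Fin n) (f : C^∞⟮𝓡 n, M; ℝ⟯) (g : V.LocFun x₀)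
    {y : EuclideanSpace ℝ (Fin n)} (hy : y ∈ (extChartAt (𝓡 n) x₀).target) :
    (((V.locPartial x₀ j ∘ₗ V.locMul x₀ f - V.locMul x₀ f ∘ₗ V.locPartial x₀ j) g).1 y) =
      partialDeriv j (fun y ↦ f ((extChartAt (𝓡 n) x₀).symm y)) y • g.1 y := by
  change fderiv ℝ (fun y ↦ f ((extChartAt (𝓡 n) x₀).symm y) • g.1 y) y _ -
    f ((extChartAt (𝓡 n) x₀).symm y) • fderiv ℝ g.1 y _ = _
  rw [fderiv_fun_smul ((contDiffAt_comp_symm x₀ hy f.contMDiff.contMDiffAt).differentiableAt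
    (by simp)) (g.2.1.differentiable (by simp) y)]
  simp [partialDeriv]

theorem HermBundle.locPartial_order (j : Fin n) :
    OrderLT (V.locMul x₀) (V.locMul x₀) 2 (V.locPartial x₀ j) := fun f f' ↦ by
  change _ = _
  refine LinearMap.ext fun g ↦ sub_eq_zero.2 (Subtype.ext (funext fun y ↦ ?_))
  rw [LinearMap.comp_apply, LinearMap.comp_apply]
  by_cases hy : y ∈ (extChartAt (𝓡 n) x₀).target
  · rw [V.locPartial_commutator x₀ j f _ hy]
    change _ • (f' ((extChartAt (𝓡 n) x₀).symm y) • g.1 y) = f' ((extChartAt (𝓡 n) x₀).symm y) • _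
    rw [V.locPartial_commutator x₀ j f _ hy, smul_comm]
  · have h1 : y ∉ V.locSupp x₀ := fun h ↦ hy (V.locSupp_subset x₀ h)
    have h2 : ∀ g : V.LocFun x₀, g.1 y = 0 := fun g ↦ g.2.2 y h1
    rw [h2, h2]

/-- Iterated partial derivatives in local coordinates. -/
def HermBundle.locWord : List (Fin n) → V.LocFun x₀ →ₗ[ℂ] V.LocFun x₀
  | [] => LinearMap.id
  | j :: l => V.locPartial x₀ j ∘ₗ HermBundle.locWord l

theorem HermBundle.locWord_coe (l : List (Fin n)) (g : V.LocFun x₀) :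
    (V.locWord x₀ l g).1 = wordDeriv l g.1 := by
  induction l with
  | nil => rfl
  | cons j l ih =>
    rw [wordDeriv_cons, ← ih]
    rfl

theorem HermBundle.locWord_order (l : List (Fin n)) :
    ∃ k, OrderLT (V.locMul x₀) (V.locMul x₀) k (V.locWord x₀ l) := by
  induction l with
  | nil =>
    refine ⟨1, fun f ↦ ?_⟩
    change LinearMap.id ∘ₗ V.locMul x₀ f - V.locMul x₀ f ∘ₗ LinearMap.id = 0
    exact LinearMap.ext fun g ↦ sub_self (V.locMul x₀ f g)
  | cons j l ih =>
    obtain ⟨k, hk⟩ := ih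
    exact ⟨_, (V.locPartial_order x₀ j).comp hk⟩

/-- Evaluation of a component of a function in local coordinates, as a function on the manifold. -/
def HermBundle.locEval (c : V.F →L[ℂ] ℂ) : V.LocFun x₀ →ₗ[ℂ] (M → ℂ) where
  toFun g := fun x ↦ V.plateau x₀ x • c (g.1 (extChartAt (𝓡 n) x₀ x))
  map_add' g g' := by
    funext x
    change _ • c (g.1 _ + g'.1 _) = _
    rw [map_add, smul_add]
    rfl
  map_smul' a g := by
    funext x
    change _ • c (a • g.1 _) = a • _
    rw [map_smul, smul_comm]

theorem HermBundle.locEval_order (c : V.F →L[ℂ] ℂ) :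
    OrderLT (V.locMul x₀) scalarMul 1 (V.locEval x₀ c) := fun f ↦ by
  change _ = _
  refine LinearMap.ext fun g ↦ sub_eq_zero.2 (funext fun x ↦ ?_)
  change V.plateau x₀ x • c (f ((extChartAt (𝓡 n) x₀).symm (extChartAt (𝓡 n) x₀ x)) • g.1 _) =
    f x • V.plateau x₀ x • c (g.1 _)
  by_cases hx : x ∈ tsupport (V.plateau x₀)
  · rw [(extChartAt (𝓡 n) x₀).left_inv (V.tsupport_plateau x₀ hx).1, smul_comm]
    congr 1
    exact (c.restrictScalars ℝ).map_smul _ _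
  · rw [image_eq_zero_of_notMem_tsupport hx, zero_smul, zero_smul, smul_zero]

theorem HermBundle.contMDiff_locEval (c : V.F →L[ℂ] ℂ) (g : V.LocFun x₀) :
    ContMDiff (𝓡 n) 𝓘(ℝ, ℂ) ∞ (V.locEval x₀ c g) := by
  intro x
  by_cases hx : x ∈ tsupport (V.plateau x₀)
  · have h1 : ContMDiffAt (𝓡 n) 𝓘(ℝ, EuclideanSpace ℝ (Fin n)) ∞ (extChartAt (𝓡 n) x₀) x :=
      contMDiffAt_extChartAt' (by simpa using (V.tsupport_plateau x₀ hx).1)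
    have h2 : ContDiff ℝ ∞ fun y ↦ c (g.1 y) := (c.restrictScalars ℝ).contDiff.comp g.2.1
    exact (V.plateau x₀).contMDiff.contMDiffAt.smul (h2.contMDiff.contMDiffAt.comp x h1)
  · refine (contMDiffAt_const (c := (0 : ℂ))).congr_of_eventuallyEq ?_
    filter_upwards [(isClosed_tsupport (V.plateau x₀)).isOpen_compl.mem_nhds hx] with z hz
    change V.plateau x₀ z • c (g.1 (extChartAt (𝓡 n) x₀ z)) = 0
    rw [image_eq_zero_of_notMem_tsupport hz, zero_smul]

/-- A component of an iterated partial derivative of the local representation of a section at `x₀`,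
as a scalar differential operator. -/
def HermBundle.locOp (l : List (Fin n)) (c : V.F →L[ℂ] ℂ) : ScalarDiffOp V where
  op := V.locEval x₀ c ∘ₗ V.locWord x₀ l ∘ₗ V.locL x₀
  smooth s := V.contMDiff_locEval x₀ c _
  order := by
    obtain ⟨k, hk⟩ := V.locWord_order x₀ l
    exact ⟨_, (V.locEval_order x₀ c).comp (hk.comp (V.locL_order x₀))⟩

theorem HermBundle.locOp_apply (l : List (Fin n)) (c : V.F →L[ℂ] ℂ) (s : V.Sec) {x : M}
    (hx : x ∈ tsupport (V.bump x₀)) :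
    (V.locOp x₀ l c).op s x = c (wordDeriv l (V.loc x₀ s) (extChartAt (𝓡 n) x₀ x)) := by
  change V.plateau x₀ x • c ((V.locWord x₀ l (V.locL x₀ s)).1 _) = _
  rw [V.plateau_eq_one x₀ hx, one_smul, V.locWord_coe]
  rfl

/-- An iterated partial derivative of the local representation at a point, as a linear map. -/
def HermBundle.jet (l : List (Fin n)) (y : EuclideanSpace ℝ (Fin n)) : V.Sec →ₗ[ℂ] V.F :=
  LinearMap.proj y ∘ₗ (V.LocFun x₀).subtype ∘ₗ V.locWord x₀ l ∘ₗ V.locL x₀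

theorem HermBundle.jet_apply (l : List (Fin n)) (y : EuclideanSpace ℝ (Fin n)) (s : V.Sec) :
    V.jet x₀ l y s = wordDeriv l (V.loc x₀ s) y :=
  congrFun (V.locWord_coe x₀ l (V.locL x₀ s)) y

theorem HermBundle.jet_eq_zero (l : List (Fin n)) {y : EuclideanSpace ℝ (Fin n)}
    (hy : y ∉ V.locSupp x₀) (s : V.Sec) : V.jet x₀ l y s = 0 :=
  (V.locWord x₀ l (V.locL x₀ s)).2.2 y hy

end

end Localization

/-! ### Differential operators and jets -/

section Jets

variable {n : ℕ} {M : Type u} [TopologicalSpace M] [ChartedSpace (EuclideanSpace ℝ (Fin n)) M]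
  [T2Space M] [SecondCountableTopology M] [IsManifold (𝓡 n) ∞ M] {V : HermBundle.{u, v, w} n M}

theorem eventually_symm_of_eventually {x₀ x : M} (hx : x ∈ (extChartAt (𝓡 n) x₀).source)
    {p : M → Prop} (h : ∀ᶠ z in 𝓝 x, p z) :
    ∀ᶠ y in 𝓝 (extChartAt (𝓡 n) x₀ x), p ((extChartAt (𝓡 n) x₀).symm y) := by
  have h1 := continuousAt_extChartAt_symm' (I := 𝓡 n) hx
  rw [ContinuousAt, (extChartAt (𝓡 n) x₀).left_inv hx] at h1
  exact h1.eventually h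

theorem HermBundle.triv_eq_loc {x₀ x : M} (hx : x ∈ V.core x₀) (s : V.Sec) :
    V.triv x₀ s x = V.loc x₀ s (extChartAt (𝓡 n) x₀ x) := by
  rw [V.loc_of_mem_source x₀ s (V.core_subset_dom x₀ hx).1, V.bump_of_mem_core hx, one_smul]

/-- A section whose jet of order `k - 1` at `x` vanishes is annihilated at `x` by every
differential operator of order less than `k`. By Hadamard's lemma it is a sum of products of
functions vanishing at `x` with sections whose jet of order `k - 2` vanishes, and the commutators
with these functions have lower order. -/
theorem OrderLT.eq_zero_of_jet {x₀ x : M} (hx : x ∈ V.core x₀) {k : ℕ} {D : V.Sec →ₗ[ℂ] (M → ℂ)}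
    (hD : OrderLT V.fmul scalarMul k D) {s : V.Sec}
    (hs : ∀ l : List (Fin n), l.length < k → V.jet x₀ l (extChartAt (𝓡 n) x₀ x) s = 0) :
    D s x = 0 := by
  induction k generalizing D s with
  | zero =>
    rw [show D = 0 from hD]
    rfl
  | succ k ih =>
    set φ := extChartAt (𝓡 n) x₀ with hφ
    have hdom := V.core_subset_dom x₀
    have hsrc : x ∈ φ.source := (hdom hx).1
    obtain ⟨χ, h1, -, hsup, -⟩ := exists_cutoff (n := n) (isCompact_singleton (x := x))
      (V.isOpen_core x₀) (singleton_subset_iff.2 hx)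
    rw [nhdsSet_singleton] at h1
    set g := V.loc x₀ s with hg
    have hgs : ContDiff ℝ ∞ g := V.contDiff_loc x₀ s
    have hgc : HasCompactSupport g :=
      HasCompactSupport.intro (V.isCompact_locSupp x₀) fun y hy ↦ V.loc_eq_zero x₀ s hy
    have hw : ∀ l : List (Fin n), l.length < k + 1 → wordDeriv l g (φ x) = 0 := fun l hl ↦ by
      rw [← V.jet_apply]
      exact hs l hl
    let q : Fin n → EuclideanSpace ℝ (Fin n) → V.F := fun j ↦ radialAvg (φ x) 0 (partialDeriv j g)
    have hq : ∀ j, ContDiff ℝ ∞ (q j) := fun j ↦ contDiff_radialAvg _ _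
      (contDiff_partialDeriv hgs j) (hasCompactSupport_partialDeriv hgc j)
    let t : Fin n → V.Sec := fun j ↦ ⟨V.ofLocal x₀ (q j) χ,
      V.isSmooth_ofLocal x₀ (hsup.trans hdom) fun _ _ ↦ (hq j).contDiffAt⟩
    let f : Fin n → C^∞⟮𝓡 n, M; ℝ⟯ := fun j ↦ ⟨fun z ↦ χ z * (φ z j - φ x j), by
      intro z
      by_cases hz : z ∈ tsupport χ
      · have h2 : ContMDiffAt (𝓡 n) 𝓘(ℝ, EuclideanSpace ℝ (Fin n)) ∞ φ z :=
          contMDiffAt_extChartAt' (by simpa using (hdom (hsup hz)).1)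
        have h3 : ContDiff ℝ ∞ fun y : EuclideanSpace ℝ (Fin n) ↦ y j - φ x j := by fun_prop
        exact χ.contMDiff.contMDiffAt.smul (h3.contMDiff.contMDiffAt.comp z h2)
      · refine (contMDiffAt_const (c := (0 : ℝ))).congr_of_eventuallyEq ?_
        filter_upwards [(isClosed_tsupport χ).isOpen_compl.mem_nhds hz] with z' hz'
        rw [image_eq_zero_of_notMem_tsupport hz', zero_mul]⟩
    have hloc : ∀ j, V.loc x₀ (t j) =ᶠ[𝓝 (φ x)] q j := by
      intro j
      have h2 : ∀ᶠ z in 𝓝 x, z ∈ V.core x₀ ∧ χ z = 1 :=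
        Filter.Eventually.and ((V.isOpen_core x₀).mem_nhds hx) h1
      filter_upwards [eventually_symm_of_eventually hsrc h2,
        (isOpen_extChartAt_target x₀).mem_nhds (φ.map_source hsrc)] with y hy hy'
      have h3 := V.triv_eq_loc hy.1 (t j)
      rw [φ.right_inv hy'] at h3
      rw [← h3]
      refine (V.triv_ofLocal (hdom hy.1) (q j) χ).trans ?_
      rw [hy.2, one_smul]
      exact congrArg (q j) (φ.right_inv hy')
    have hst : ∀ᶠ z in 𝓝 x, (s - ∑ j, V.fmul (f j) (t j)) z = 0 := by
      filter_upwards [(V.isOpen_core x₀).mem_nhds hx, h1] with z hz hz1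
      rw [V.sub_apply, sub_eq_zero]
      refine V.triv_inj (hdom hz) ?_
      change V.triv x₀ s z = V.triv x₀ (∑ j, V.fmul (f j) (t j)) z
      rw [V.triv_eq_loc hz, V.triv_eq_loc hz, ← wordDeriv_nil (V.loc x₀ (∑ j, _)), ← V.jet_apply,
        map_sum]
      change g (φ z) = _
      rw [eq_sum_radialAvg (φ x) hgs (hw [] (Nat.succ_pos k)) (φ z)]
      refine Finset.sum_congr rfl fun j _ ↦ ?_
      rw [V.jet_apply, wordDeriv_nil, ← V.triv_eq_loc hz, V.triv_fmul (hdom hz)]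
      change _ = (χ z * (φ z j - φ x j)) • _
      rw [hz1, one_mul]
      congr 1
      refine Eq.symm ((V.triv_ofLocal (hdom hz) (q j) χ).trans ?_)
      rw [hz1, one_smul]
    have h5 : D (s - ∑ j, V.fmul (f j) (t j)) x = 0 :=
      OrderLT.eval_eq_zero (x := x) ((LinearMap.proj x : (M → ℂ) →ₗ[ℂ] ℂ) : (M → ℂ) →+ ℂ)
        (fun f y hf ↦ by
          change f x • y x = 0
          rw [hf, zero_smul]) hD hst
    rw [map_sub, Pi.sub_apply, sub_eq_zero] at h5
    rw [h5, map_sum, Finset.sum_apply]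
    refine Finset.sum_eq_zero fun j _ ↦ ?_
    have h6 := ih (hD (f j)) (s := t j) fun l hl ↦ by
      rw [V.jet_apply, (wordDeriv_congr (hloc j) l).self_of_nhds, wordDeriv_radialAvg _ _
        (contDiff_partialDeriv hgs j) (hasCompactSupport_partialDeriv hgc j)]
      refine radialAvg_self _ _ ?_
      have := hw (l ++ [j]) (by simpa using hl)
      rwa [wordDeriv_append] at this
    have h7 : f j x = 0 := by
      change χ x * (φ x j - φ x j) = 0
      rw [sub_self, mul_zero]
    have h8 : D (V.fmul (f j) (t j)) x - f j x • D (t j) x = 0 := h6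
    rwa [h7, zero_smul, sub_zero] at h8

/-- Linear coordinates on a finite dimensional space. -/
def coordCLE (F : Type*) [NormedAddCommGroup F] [NormedSpace ℂ F] [FiniteDimensional ℂ F] :
    F ≃L[ℂ] (Fin (Module.finrank ℂ F) → ℂ) :=
  (Module.finBasis ℂ F).equivFun.toContinuousLinearEquiv

/-- A coordinate form on a finite dimensional space. -/
def coordCLM (F : Type*) [NormedAddCommGroup F] [NormedSpace ℂ F] [FiniteDimensional ℂ F]
    (c : Fin (Module.finrank ℂ F)) : F →L[ℂ] ℂ :=
  ContinuousLinearMap.proj c ∘L (coordCLE F : F →L[ℂ] (Fin (Module.finrank ℂ F) → ℂ))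

section
variable {Y : Type*} [AddCommGroup Y] [Module ℂ Y] [TopologicalSpace Y]
  [IsTopologicalAddGroup Y] [ContinuousSMul ℂ Y] (τ : Y →ₗ[ℂ] V.Sec)

theorem continuous_of_mem_span {E : Type*} [AddCommGroup E] [Module ℂ E] {ι : Type*}
    {L : ι → E →ₗ[ℂ] ℂ} {K : E →ₗ[ℂ] ℂ} (hK : K ∈ Submodule.span ℂ (range L)) {τ : Y → E}
    (hL : ∀ i, Continuous fun a ↦ L i (τ a)) : Continuous fun a ↦ K (τ a) := by
  induction hK using Submodule.span_induction with
  | mem x hx =>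
    obtain ⟨i, rfl⟩ := hx
    exact hL i
  | zero => exact continuous_const
  | add x y _ _ hx hy => exact hx.add hy
  | smul c x _ hx => exact hx.const_smul c

/-- If the jets of `τ a` depend continuously on `a`, then so do the values of all differential
operators. -/
theorem ScalarDiffOp.continuous_eval (D : ScalarDiffOp V) {x₀ x : M} (hx : x ∈ V.core x₀)
    (h : ∀ l, Continuous fun a ↦ V.jet x₀ l (extChartAt (𝓡 n) x₀ x) (τ a)) :
    Continuous fun a ↦ D.op (τ a) x := by
  obtain ⟨k, hk⟩ := D.order
  have : Finite {l : List (Fin n) // l.length < k} := List.finite_length_lt (Fin n) k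
  let L : {l : List (Fin n) // l.length < k} × Fin (Module.finrank ℂ V.F) → V.Sec →ₗ[ℂ] ℂ :=
    fun p ↦ (coordCLM V.F p.2).toLinearMap ∘ₗ V.jet x₀ p.1.1 (extChartAt (𝓡 n) x₀ x)
  have hspan : (LinearMap.proj x ∘ₗ D.op : V.Sec →ₗ[ℂ] ℂ) ∈ Submodule.span ℂ (range L) := by
    refine mem_span_of_iInf_ker_le_ker fun s hs ↦ ?_
    rw [Submodule.mem_iInf] at hs
    refine OrderLT.eq_zero_of_jet hx hk fun l hl ↦ ?_
    refine (coordCLE V.F).injective ?_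
    rw [map_zero]
    exact funext fun c ↦ hs (⟨l, hl⟩, c)
  exact continuous_of_mem_span hspan fun p ↦ (coordCLM V.F p.2).continuous.comp (h p.1.1)

end

end Jets

/-! ### Continuity of maps from Banach spaces into spaces of sections -/

section Banach

variable {n : ℕ} {M : Type u} [TopologicalSpace M] [ChartedSpace (EuclideanSpace ℝ (Fin n)) M]
  [T2Space M] [SecondCountableTopology M] [IsManifold (𝓡 n) ∞ M] {V : HermBundle.{u, v, w} n M}
  {Y : Type*} [NormedAddCommGroup Y] [NormedSpace ℂ Y] [CompleteSpace Y] (τ : Y →ₗ[ℂ] V.Sec)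

/-- By non-degeneracy of the forms on the fibres, the functionals `(b|·)` span the dual of a fibre.
-/
theorem HermBundle.continuous_triv {x₀ x : M} (hx : x ∈ V.dom x₀)
    (h : ∀ b : V.E x, Continuous fun a ↦ V.form x b (τ a x)) :
    Continuous fun a ↦ V.triv x₀ (τ a) x := by
  let e := (trivializationAt V.F V.E x₀).linearEquivAt ℂ x hx.2
  have : FiniteDimensional ℂ (V.E x) := e.symm.finiteDimensional
  refine (coordCLE V.F).toHomeomorph.isInducing.continuous_iff.2 (continuous_pi fun c ↦ ?_)
  have hspan : (coordCLM V.F c).toLinearMap ∘ₗ e.toLinearMap ∈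
      Submodule.span ℂ (range fun b ↦ V.form x b) := by
    refine FiniteDimensional.mem_span_of_iInf_ker_le_ker fun z hz ↦ ?_
    rw [Submodule.mem_iInf] at hz
    have hz0 : z = 0 := V.form_nondeg x z fun b ↦ by
      rw [V.form_symm, show V.form x b z = 0 from hz b, map_zero]
    rw [hz0]
    exact Submodule.zero_mem _
  exact continuous_of_mem_span hspan h

/-- Limits of difference quotients: continuity of the values implies continuity of the jets, by the
Banach–Steinhaus theorem. -/
theorem HermBundle.continuous_jet (x₀ : M)
    (h : ∀ x, ∀ b : V.E x, Continuous fun a ↦ V.form x b (τ a x)) (l : List (Fin n))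
    (y : EuclideanSpace ℝ (Fin n)) : Continuous fun a ↦ V.jet x₀ l y (τ a) := by
  induction l generalizing y with
  | nil =>
    simp_rw [V.jet_apply, wordDeriv_nil]
    rcases V.loc_eq_zero_or x₀ y with h0 | ⟨-, hd, h0⟩
    · simp_rw [h0]
      exact continuous_const
    · simp_rw [h0]
      exact (V.continuous_triv τ hd fun b ↦ h _ b).const_smul _
  | cons j l ih =>
    let J : EuclideanSpace ℝ (Fin n) → Y →L[ℂ] V.F := fun z ↦ ⟨V.jet x₀ l z ∘ₗ τ, ih z⟩
    let G : ℕ → Y →L[ℂ] V.F := fun m ↦ ((m : ℝ) : ℂ) •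
      (J (y + (m : ℝ)⁻¹ • EuclideanSpace.single j (1 : ℝ)) - J y)
    have hlim : Tendsto (fun m a ↦ G m a) atTop (𝓝 fun a ↦ V.jet x₀ (j :: l) y (τ a)) := by
      refine tendsto_pi_nhds.2 fun a ↦ ?_
      have h1 : HasFDerivAt (wordDeriv l (V.loc x₀ (τ a)))
          (fderiv ℝ (wordDeriv l (V.loc x₀ (τ a))) y) y :=
        ((contDiff_wordDeriv (V.contDiff_loc x₀ (τ a)) l).differentiable (by simp) y).hasFDerivAt
      have h2 := h1.lim (EuclideanSpace.single j (1 : ℝ)) (c := fun m : ℕ ↦ (m : ℝ)) (l := atTop)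
        (by simpa using tendsto_natCast_atTop_atTop (R := ℝ))
      rw [V.jet_apply]
      refine h2.congr fun m ↦ ?_
      change _ = ((m : ℝ) : ℂ) • (V.jet x₀ l _ (τ a) - V.jet x₀ l y (τ a))
      rw [V.jet_apply, V.jet_apply, Complex.coe_smul]
    exact (continuousLinearMapOfTendsto G hlim).continuous

/-- A linear map from a Banach space to `Γ(M;V)` is continuous if the values of its images depend
continuously on the argument. -/
theorem HermBundle.continuous_of_values
    (h : ∀ x, ∀ b : V.E x, Continuous fun a ↦ V.form x b (τ a x)) : Continuous τ := by
  refine continuous_iInf_rng.2 fun p ↦ continuous_induced_rng.2 ?_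
  obtain ⟨K, D⟩ := p
  let g : K → Y →L[ℂ] ℂ := fun x ↦ ⟨LinearMap.proj x.1 ∘ₗ D.op ∘ₗ τ,
    D.continuous_eval τ (V.mem_core x.1) fun l ↦ V.continuous_jet τ x.1 h l _⟩
  obtain ⟨C, hC⟩ := banach_steinhaus (g := g) fun a ↦
    ⟨‖D.restrict K (τ a)‖, fun x ↦ (D.restrict K (τ a)).norm_coe_le_norm x⟩
  have hb : ∀ a, ‖D.restrict K (τ a)‖ ≤ max C 0 * ‖a‖ := by
    intro a
    refine (ContinuousMap.norm_le _ (mul_nonneg (le_max_right _ _) (norm_nonneg a))).2 fun x ↦ ?_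
    exact ((g x).le_opNorm a).trans (mul_le_mul_of_nonneg_right ((hC x).trans (le_max_left _ _))
      (norm_nonneg a))
  exact ((D.restrict K ∘ₗ τ).mkContinuous _ hb).continuous

end Banach

/-! ### Weak continuity -/

section Weak

variable {n : ℕ} {M : Type u} [TopologicalSpace M] [ChartedSpace (EuclideanSpace ℝ (Fin n)) M]
  [T2Space M] [SecondCountableTopology M] [IsManifold (𝓡 n) ∞ M] {V : HermBundle.{u, v, w} n M}
  [MeasurableSpace M] [BorelSpace M] {μ : Measure M} [IsFiniteMeasureOnCompacts μ]
  [μ.IsOpenPosMeasure]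

variable (n μ) in
/-- A sequence of normalized bump functions concentrating at a point. -/
theorem exists_approx_delta (x : M) : ∃ χ : ℕ → C^∞⟮𝓡 n, M; ℝ⟯, (∀ m, HasCompactSupport (χ m)) ∧
    ∀ f : M → ℂ, Continuous f →
      Tendsto (fun m ↦ ((∫ z, χ m z ∂μ : ℝ) : ℂ)⁻¹ * ∫ z, (χ m z : ℂ) * f z ∂μ) atTop (𝓝 (f x)) := by
  have : LocallyCompactSpace M := Manifold.locallyCompact_of_finiteDimensional (𝓡 n)
  obtain ⟨U, hU⟩ := (𝓝 x).exists_antitone_basis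
  have h : ∀ m, ∃ χ : C^∞⟮𝓡 n, M; ℝ⟯, χ x = 1 ∧ HasCompactSupport χ ∧
      tsupport χ ⊆ interior (U m) ∧ ∀ z, χ z ∈ Icc (0 : ℝ) 1 := fun m ↦ by
    obtain ⟨χ, h1, hc, hs, hI⟩ := exists_cutoff (n := n) (isCompact_singleton (x := x))
      (isOpen_interior (s := U m))
      (singleton_subset_iff.2 (mem_interior_iff_mem_nhds.2 (hU.1.mem_of_mem trivial)))
    exact ⟨χ, h1.self_of_nhdsSet x rfl, hc, hs, hI⟩
  choose χ h1 hc hs hI using h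
  refine ⟨χ, hc, fun f hf ↦ Metric.tendsto_atTop.2 fun ε hε ↦ ?_⟩
  have hpos : ∀ m, 0 < ∫ z, χ m z ∂μ := fun m ↦
    (χ m).contMDiff.continuous.integral_pos_of_hasCompactSupport_nonneg_nonzero (x := x) (hc m)
      (fun z ↦ (hI m z).1) (by rw [h1]; exact one_ne_zero)
  have hint : ∀ m, Integrable (χ m) μ := fun m ↦
    (χ m).contMDiff.continuous.integrable_of_hasCompactSupport (hc m)
  obtain ⟨N, -, hN⟩ := hU.1.mem_iff.1 (hf.continuousAt.preimage_mem_nhds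
    (Metric.ball_mem_nhds (f x) (half_pos hε)))
  refine ⟨N, fun m hm ↦ ?_⟩
  have hcont : Continuous fun z ↦ (χ m z : ℂ) :=
    Complex.continuous_ofReal.comp (χ m).contMDiff.continuous
  have hcs : HasCompactSupport fun z ↦ (χ m z : ℂ) := (hc m).comp_left (g := fun r : ℝ ↦ (r : ℂ)) rfl
  have hint1 : Integrable (fun z ↦ (χ m z : ℂ) * f z) μ :=
    (hcont.mul hf).integrable_of_hasCompactSupport hcs.mul_right
  have hint2 : Integrable (fun z ↦ (χ m z : ℂ) * f x) μ :=
    (hcont.mul continuous_const).integrable_of_hasCompactSupport hcs.mul_right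
  set c : ℝ := ∫ z, χ m z ∂μ with hcdef
  have hc0 : (c : ℂ) ≠ 0 := ofReal_ne_zero.2 (hpos m).ne'
  have h2 : ∫ z, (χ m z : ℂ) * f x ∂μ = c * f x := by
    rw [integral_mul_const]
    congr 1
    exact integral_ofReal
  have h3 : (c : ℂ)⁻¹ * ∫ z, (χ m z : ℂ) * f z ∂μ - f x =
      (c : ℂ)⁻¹ * ∫ z, (χ m z : ℂ) * (f z - f x) ∂μ := by
    simp_rw [mul_sub]
    rw [integral_sub hint1 hint2, h2, mul_sub, inv_mul_cancel_left₀ hc0]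
  rw [dist_eq_norm, h3, norm_mul, norm_inv, Complex.norm_real, Real.norm_of_nonneg (hpos m).le]
  have h4 : ‖∫ z, (χ m z : ℂ) * (f z - f x) ∂μ‖ ≤ c * (ε / 2) := by
    rw [hcdef, ← integral_mul_const]
    refine norm_integral_le_of_norm_le ((hint m).mul_const _) (Eventually.of_forall fun z ↦ ?_)
    rw [norm_mul, Complex.norm_real, Real.norm_of_nonneg (hI m z).1]
    by_cases hz : z ∈ tsupport (χ m)
    · refine mul_le_mul_of_nonneg_left ?_ (hI m z).1
      have h5 := hN (hU.2 hm (interior_subset (hs m hz)))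
      rw [← dist_eq_norm]
      exact (Metric.mem_ball.1 h5).le
    · rw [image_eq_zero_of_notMem_tsupport hz, zero_mul, zero_mul]
  calc c⁻¹ * ‖∫ z, (χ m z : ℂ) * (f z - f x) ∂μ‖ ≤ c⁻¹ * (c * (ε / 2)) :=
        mul_le_mul_of_nonneg_left h4 (inv_nonneg.2 (hpos m).le)
    _ = ε / 2 := inv_mul_cancel_left₀ (hpos m).ne' _
    _ < ε := half_lt_self hε

/-- A weakly continuous linear map from a Banach space to `Γ(M;V)` is continuous. -/
theorem HermBundle.continuous_of_pair {Y : Type*} [NormedAddCommGroup Y] [NormedSpace ℂ Y]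
    [CompleteSpace Y] (τ : Y →ₗ[ℂ] V.Sec)
    (h : ∀ f : V.Secc, Continuous fun a ↦ V.pair μ f.1 (τ a)) : Continuous τ := by
  refine V.continuous_of_values τ fun x b ↦ ?_
  obtain ⟨χ, hc, hχ⟩ := exists_approx_delta n μ x
  obtain ⟨s, rfl⟩ := V.exists_sec x b
  let G : ℕ → Y →L[ℂ] ℂ := fun m ↦ ((∫ z, χ m z ∂μ : ℝ) : ℂ)⁻¹ •
    ⟨V.pairL μ (V.fmulc (χ m) s) ∘ₗ τ, h _⟩
  have hlim : Tendsto (fun m a ↦ G m a) atTop (𝓝 fun a ↦ V.form x (s.1 x) (τ a x)) := by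
    refine tendsto_pi_nhds.2 fun a ↦ ?_
    refine (hχ _ (V.continuous_form s.1 (τ a))).congr fun m ↦ ?_
    change _ = _ * V.pair μ (V.fmul (χ m) s.1) (τ a)
    congr 1
    exact integral_congr_ae (Eventually.of_forall fun z ↦ (V.form_fmul_left _ _ _ z).symm)
  exact (continuousLinearMapOfTendsto G hlim).continuous

end Weak

/-! ### Bounded families and the metrizability of spaces of sections -/

section Bounded

variable {n : ℕ} {M : Type u} [TopologicalSpace M] [ChartedSpace (EuclideanSpace ℝ (Fin n)) M]
  [T2Space M] [SecondCountableTopology M] [IsManifold (𝓡 n) ∞ M] {V : HermBundle.{u, v, w} n M}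
  {ι : Type*}

theorem HermBundle.exists_center {I : Set M} (hI : ⋃ i ∈ I, V.core i = univ) (x : M) :
    ∃ i ∈ I, x ∈ V.core i := by
  have : x ∈ ⋃ i ∈ I, V.core i := hI ▸ mem_univ x
  simpa using this

/-- The equivalence of the fibre at `x` with the model fibre given by the trivialization at `i`. -/
def HermBundle.trivEquiv (V : HermBundle.{u, v, w} n M) {i x : M} (hx : x ∈ V.dom i) :
    V.E x ≃ₗ[ℂ] V.F := (trivializationAt V.F V.E i).linearEquivAt ℂ x hx.2

theorem HermBundle.trivEquiv_apply {i x : M} (hx : x ∈ V.dom i) (s : V.Sec) :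
    V.trivEquiv hx (s x) = V.triv i s x := rfl

theorem map_symm_tsum_smul {E F G : Type*} [AddCommGroup E] [Module ℂ E] [NormedAddCommGroup F]
    [NormedSpace ℂ F] [FiniteDimensional ℂ F] [NormedAddCommGroup G] [NormedSpace ℂ G] (e : E ≃ₗ[ℂ] F)
    (T : E →ₗ[ℂ] G) (a : lp (fun _ : ι ↦ ℂ) 1) {b : ι → E} {C : ℝ} (hb : ∀ m, ‖e (b m)‖ ≤ C) :
    T (e.symm (∑' m, a m • e (b m))) = ∑' m, a m • T (b m) := by
  have := FiniteDimensional.complete ℂ F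
  have h1 := ((T ∘ₗ e.symm.toLinearMap).toContinuousLinearMap).map_tsum
    (summable_smul_of_bounded a hb)
  have h2 : ∀ z, (T ∘ₗ e.symm.toLinearMap).toContinuousLinearMap (e z) = T z := fun z ↦
    congrArg T (e.symm_apply_apply z)
  simp_rw [map_smul, h2] at h1
  exact h1

/-- A family of sections whose local representations have bounded derivatives can be summed with
summable coefficients. -/
theorem HermBundle.exists_sum_of_bounded {I : Set M} (hI : ⋃ i ∈ I, V.core i = univ)
    (b : ι → V.Sec) (hb : ∀ i ∈ I, ∀ l, ∃ C, ∀ m y, ‖wordDeriv l (V.loc i (b m)) y‖ ≤ C) :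
    ∃ Θ : lp (fun _ : ι ↦ ℂ) 1 →L[ℂ] V.Sec, ∀ a x,
      (∀ T : V.E x →ₗ[ℂ] ℂ, T (Θ a x) = ∑' m, a m * T (b m x)) := by
  choose c hcI hc using V.exists_center hI
  have hdom : ∀ x, x ∈ V.dom (c x) := fun x ↦ V.core_subset_dom _ (hc x)
  have hbd : ∀ x, ∃ C, ∀ m, ‖V.trivEquiv (hdom x) (b m x)‖ ≤ C := by
    intro x
    obtain ⟨C, hC⟩ := hb (c x) (hcI x) []
    refine ⟨C, fun m ↦ ?_⟩
    rw [V.trivEquiv_apply, V.triv_eq_loc (hc x)]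
    exact hC m _
  let θ : lp (fun _ : ι ↦ ℂ) 1 → ∀ x, V.E x := fun a x ↦
    (V.trivEquiv (hdom x)).symm (∑' m, a m • V.trivEquiv (hdom x) (b m x))
  have hθC : ∀ a x (T : V.E x →ₗ[ℂ] ℂ),
      T (θ a x) = ∑' m, a m * T (b m x) := fun a x T ↦
    map_symm_tsum_smul _ T a (hbd x).choose_spec
  -- near `x` the section is the sum of the localizations at `c x`, independently of the choice of
  -- `c`
  have hsmooth : ∀ a, V.IsSmooth (θ a) := by
    intro a
    refine V.isSmooth_of_eventually fun x ↦ ?_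
    have hg := contDiff_tsum_smul a (fun m ↦ V.contDiff_loc (c x) (b m)) (hb (c x) (hcI x))
    refine ⟨⟨V.ofLocal (c x) _ (V.bump (c x)), V.isSmooth_ofLocal (c x) (V.tsupport_bump _)
      fun _ _ ↦ hg.contDiffAt⟩, ?_⟩
    filter_upwards [(V.isOpen_core (c x)).mem_nhds (hc x)] with z hz
    have hzd := V.core_subset_dom _ hz
    refine V.triv_inj hzd ?_
    refine Eq.trans ?_ (V.triv_ofLocal hzd _ _).symm
    rw [V.bump_of_mem_core hz, one_smul]
    refine (map_symm_tsum_smul _ (V.trivEquiv hzd).toLinearMap a (hbd z).choose_spec).trans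
      (tsum_congr fun m ↦ ?_)
    congr 1
    exact V.triv_eq_loc hz (b m)
  have hsum : ∀ (a : lp (fun _ : ι ↦ ℂ) 1) x,
      Summable fun m ↦ a m • V.trivEquiv (hdom x) (b m x) := fun a x ↦
    summable_smul_of_bounded a (hbd x).choose_spec
  let Θ : lp (fun _ : ι ↦ ℂ) 1 →ₗ[ℂ] V.Sec :=
    { toFun := fun a ↦ ⟨θ a, hsmooth a⟩
      map_add' := fun a a' ↦ by
        refine HermBundle.sec_ext fun x ↦ (V.trivEquiv (hdom x)).injective ?_
        change V.trivEquiv (hdom x) (θ (a + a') x) = V.trivEquiv (hdom x) (θ a x + θ a' x)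
        simp only [θ, map_add, LinearEquiv.apply_symm_apply]
        rw [← (hsum a x).tsum_add (hsum a' x)]
        exact tsum_congr fun m ↦ add_smul _ _ _
      map_smul' := fun r a ↦ by
        refine HermBundle.sec_ext fun x ↦ (V.trivEquiv (hdom x)).injective ?_
        change V.trivEquiv (hdom x) (θ (r • a) x) = V.trivEquiv (hdom x) (r • θ a x)
        simp only [θ, map_smul, LinearEquiv.apply_symm_apply]
        rw [← (hsum a x).tsum_const_smul r]
        exact tsum_congr fun m ↦ mul_smul r (a m) _ }
  have hcont : Continuous Θ := by
    refine V.continuous_of_values Θ fun x e ↦ ?_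
    change Continuous fun a ↦ V.form x e (θ a x)
    simp_rw [hθC]
    obtain ⟨C, hC⟩ := hbd x
    let T' : V.F →L[ℂ] ℂ :=
      (V.form x e ∘ₗ (V.trivEquiv (hdom x)).symm.toLinearMap).toContinuousLinearMap
    have h2 : ∀ m, ‖V.form x e (b m x)‖ ≤ ‖T'‖ * C := fun m ↦ by
      have h3 : T' (V.trivEquiv (hdom x) (b m x)) = V.form x e (b m x) :=
        congrArg (V.form x e) ((V.trivEquiv (hdom x)).symm_apply_apply _)
      rw [← h3]
      exact (T'.le_opNorm _).trans (mul_le_mul_of_nonneg_left (hC m) (norm_nonneg _))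
    have h4 : ∀ a : lp (fun _ : ι ↦ ℂ) 1, Summable fun m ↦ a m * V.form x e (b m x) := fun a ↦
      summable_smul_of_bounded a h2
    let S : lp (fun _ : ι ↦ ℂ) 1 →ₗ[ℂ] ℂ :=
      { toFun := fun a ↦ ∑' m, a m * V.form x e (b m x)
        map_add' := fun a a' ↦ by
          rw [← (h4 a).tsum_add (h4 a')]
          exact tsum_congr fun m ↦ add_mul _ _ _
        map_smul' := fun r a ↦ by
          rw [RingHom.id_apply, smul_eq_mul, ← tsum_mul_left]
          exact tsum_congr fun m ↦ mul_assoc _ _ _ }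
    refine (S.mkContinuous (‖T'‖ * C) fun a ↦ ?_).continuous
    have h5 : Summable fun m ↦ ‖a m‖ := by simpa using (lp.memℓp a).summable (by simp)
    have h6 : ‖a‖ = ∑' m, ‖a m‖ := by
      simpa using lp.norm_eq_tsum_rpow (p := 1) (by simp) a
    rw [h6, mul_comm, ← tsum_mul_right]
    refine tsum_of_norm_bounded (h5.mul_right _).hasSum fun m ↦ ?_
    rw [norm_mul]
    exact mul_le_mul_of_nonneg_left (h2 m) (norm_nonneg _)
  exact ⟨⟨Θ, hcont⟩, hθC⟩

/-- A linear map that is bounded on the sets on which countably many linear maps are bounded is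
dominated by finitely many of them. -/
theorem exists_finset_bound {E κ : Type*} [AddCommGroup E] [Module ℂ E] [Countable κ]
    {Z : κ → Type*} [∀ k, NormedAddCommGroup (Z k)] [∀ k, NormedSpace ℂ (Z k)]
    {Z' : Type*} [NormedAddCommGroup Z'] [NormedSpace ℂ Z'] (p : ∀ k, E →ₗ[ℂ] Z k)
    (q : E →ₗ[ℂ] Z')
    (h : ∀ b : ℕ → E, (∀ k, ∃ C, ∀ m, ‖p k (b m)‖ ≤ C) → ∃ C, ∀ m, ‖q (b m)‖ ≤ C) :
    ∃ (s : Finset κ) (C : ℝ), ∀ e, ‖q e‖ ≤ C * ∑ k ∈ s, ‖p k e‖ := by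
  classical
  rcases isEmpty_or_nonempty κ with hκ | hκ
  · obtain hq | ⟨e, he⟩ : (∀ e, q e = 0) ∨ ∃ e, q e ≠ 0 := by
      by_cases hq : ∀ e, q e = 0
      · exact Or.inl hq
      · exact Or.inr (not_forall.1 hq)
    · exact ⟨∅, 0, fun e ↦ by simp [hq e]⟩
    · obtain ⟨C, hC⟩ := h (fun m ↦ (m : ℂ) • e) fun k ↦ isEmptyElim k
      obtain ⟨m, hm⟩ := exists_nat_gt (C / ‖q e‖)
      have := hC m
      rw [map_smul, norm_smul, Complex.norm_natCast] at this
      rw [div_lt_iff₀ (norm_pos_iff.2 he)] at hm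
      exact absurd this (not_le.2 hm)
  -- otherwise there are `e m` with `m * ∑_{k ≤ m} ‖p k e‖ < ‖q e‖`; rescaled to `‖q e‖ = m` they
  -- are bounded under every `p k`, but not under `q`
  obtain ⟨f, hf⟩ := exists_surjective_nat κ
  by_contra! hcon
  choose e he using fun m : ℕ ↦ hcon ((Finset.range (m + 1)).image f) m
  have hq : ∀ m, 0 < ‖q (e m)‖ := fun m ↦ lt_of_le_of_lt
    (mul_nonneg (Nat.cast_nonneg m) (Finset.sum_nonneg fun _ _ ↦ norm_nonneg _)) (he m)
  obtain ⟨C, hC⟩ := h (fun m : ℕ ↦ ((m : ℝ) / ‖q (e m)‖ : ℝ) • e m) (by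
    intro k
    obtain ⟨N, rfl⟩ := hf k
    refine ⟨1 + ∑ m ∈ Finset.range N, ‖p (f N) (((m : ℝ) / ‖q (e m)‖ : ℝ) • e m)‖, fun m ↦ ?_⟩
    by_cases hm : m < N
    · exact (Finset.single_le_sum (f := fun m : ℕ ↦ ‖p (f N) (((m : ℝ) / ‖q (e m)‖ : ℝ) • e m)‖)
        (fun _ _ ↦ norm_nonneg _) (Finset.mem_range.2 hm)).trans (le_add_of_nonneg_left zero_le_one)
    · refine le_trans ?_ (le_add_of_nonneg_right (Finset.sum_nonneg fun _ _ ↦ norm_nonneg _))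
      have h1 : ‖p (f N) (e m)‖ ≤ ∑ k ∈ (Finset.range (m + 1)).image f, ‖p k (e m)‖ :=
        Finset.single_le_sum (f := fun k ↦ ‖p k (e m)‖) (fun _ _ ↦ norm_nonneg _)
          (Finset.mem_image.2 ⟨N, Finset.mem_range.2 (by omega), rfl⟩)
      rw [← Complex.coe_smul, map_smul, norm_smul, Complex.norm_real,
        Real.norm_of_nonneg (by positivity), div_mul_eq_mul_div, div_le_one (hq m)]
      exact (mul_le_mul_of_nonneg_left h1 (Nat.cast_nonneg m)).trans (he m).le)
  obtain ⟨m, hm⟩ := exists_nat_gt C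
  have := hC m
  rw [← Complex.coe_smul, map_smul, norm_smul, Complex.norm_real,
    Real.norm_of_nonneg (by positivity), div_mul_cancel₀ _ (hq m).ne'] at this
  exact absurd this (not_le.2 hm)

end Bounded

/-! ### Bounded sets and the Banach–Steinhaus theorem on spaces of sections -/

section Bornology

variable {n : ℕ} {M : Type u} [TopologicalSpace M] [ChartedSpace (EuclideanSpace ℝ (Fin n)) M]
  [T2Space M] [SecondCountableTopology M] [IsManifold (𝓡 n) ∞ M] {V : HermBundle.{u, v, w} n M}
  {ι : Type*}

variable (V) in
/-- The support of the cutoff function at `x₀`, as a compact set. -/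
def HermBundle.bumpSupp (x₀ : M) : TopologicalSpace.Compacts M :=
  ⟨tsupport (V.bump x₀), V.isCompact_tsupport_bump x₀⟩

/-- Bounds for the seminorms defining the topology of `Γ(M;V)` bound the derivatives of the local
representations. -/
theorem HermBundle.bounded_wordDeriv_loc (b : ι → V.Sec) (i : M) (l : List (Fin n))
    (hb : ∀ c, ∃ C, ∀ m, ‖(V.locOp i l (coordCLM V.F c)).restrict (V.bumpSupp i) (b m)‖ ≤ C) :
    ∃ C, ∀ m y, ‖wordDeriv l (V.loc i (b m)) y‖ ≤ C := by
  choose C hC using hb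
  refine ⟨‖((coordCLE V.F).symm : (Fin (Module.finrank ℂ V.F) → ℂ) →L[ℂ] V.F)‖ * ∑ c, |C c|,
    fun m y ↦ ?_⟩
  have h0 : 0 ≤ ∑ c, |C c| := Finset.sum_nonneg fun _ _ ↦ abs_nonneg _
  by_cases hy : y ∈ V.locSupp i
  · obtain ⟨x, hx, rfl⟩ := hy
    set z := wordDeriv l (V.loc i (b m)) (extChartAt (𝓡 n) i x) with hz
    rw [← (coordCLE V.F).symm_apply_apply z]
    refine (((coordCLE V.F).symm : (Fin (Module.finrank ℂ V.F) → ℂ) →L[ℂ] V.F).le_opNorm _).trans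
      (mul_le_mul_of_nonneg_left ((pi_norm_le_iff_of_nonneg h0).2 fun c ↦ ?_) (norm_nonneg _))
    have h1 := ((V.locOp i l (coordCLM V.F c)).restrict (V.bumpSupp i) (b m)).norm_coe_le_norm
      ⟨x, hx⟩
    rw [ScalarDiffOp.restrict_apply, V.locOp_apply i l _ _ hx] at h1
    exact (h1.trans ((hC c m).trans (le_abs_self _))).trans
      (Finset.single_le_sum (f := fun c ↦ |C c|) (fun _ _ ↦ abs_nonneg _) (Finset.mem_univ c))
  · rw [← V.jet_apply, V.jet_eq_zero i l hy, norm_zero]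
    exact mul_nonneg (norm_nonneg _) h0

variable (V) in
/-- Countably many local domains cover the manifold. -/
theorem HermBundle.exists_countable_cover :
    ∃ I : Set M, I.Countable ∧ ⋃ i ∈ I, V.core i = univ :=
  TopologicalSpace.countable_cover_nhds fun x ↦ (V.isOpen_core x).mem_nhds (V.mem_core x)

theorem ScalarDiffOp.bounded_of_isVonNBounded (D : ScalarDiffOp V) (K : TopologicalSpace.Compacts M)
    {B : Set V.Sec} (hB : Bornology.IsVonNBounded ℂ B) : ∃ C, ∀ s ∈ B, ‖D.restrict K s‖ ≤ C := by
  have h := hB.image (⟨D.restrict K, D.continuous_restrict K⟩ : V.Sec →L[ℂ] C(K, ℂ))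
  exact (NormedSpace.image_isVonNBounded_iff ℂ).1 h

/-- The `C^∞` topology is generated by the countably many seminorms of local derivatives. -/
instance : FirstCountableTopology V.Sec := by
  obtain ⟨I, hIc, hI⟩ := V.exists_countable_cover
  have := hIc.to_subtype
  let κ := I × List (Fin n) × Fin (Module.finrank ℂ V.F)
  let D : κ → ScalarDiffOp V := fun k ↦ V.locOp k.1.1 k.2.1 (coordCLM V.F k.2.2)
  let p : ∀ k : κ, V.Sec →ₗ[ℂ] C(V.bumpSupp k.1.1, ℂ) := fun k ↦ (D k).restrict _
  have hdom : ∀ (K : TopologicalSpace.Compacts M) (D : ScalarDiffOp V),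
      ∃ (s : Finset κ) (C : ℝ), ∀ e, ‖D.restrict K e‖ ≤ C * ∑ k ∈ s, ‖p k e‖ := by
    refine fun K D ↦ exists_finset_bound p (D.restrict K) fun b hb ↦ ?_
    obtain ⟨Θ, hΘ⟩ := HermBundle.exists_sum_of_bounded hI b fun i hi l ↦
      HermBundle.bounded_wordDeriv_loc b i l fun c ↦ hb (⟨i, hi⟩, l, c)
    have h1 : ∀ m, Θ (lp.single 1 m 1) = b m := fun m ↦ HermBundle.sec_ext fun x ↦ by
      refine sub_eq_zero.1 (V.form_nondeg x _ fun e ↦ ?_)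
      rw [V.form_symm, map_sub, hΘ, tsum_eq_single m fun j hj ↦ by
        rw [lp.single_apply_ne _ _ _ hj, zero_mul], lp.single_apply_self, one_mul, sub_self,
        map_zero]
    -- the sections `b m` are the images under `Θ` of the unit vectors of `ℓ¹`
    let q : lp (fun _ : ℕ ↦ ℂ) 1 →L[ℂ] C(K, ℂ) :=
      (⟨D.restrict K, D.continuous_restrict K⟩ : V.Sec →L[ℂ] C(K, ℂ)) ∘L Θ
    refine ⟨‖q‖, fun m ↦ ?_⟩
    rw [← h1]
    refine (q.le_opNorm _).trans ?_
    rw [lp.norm_single one_pos, norm_one, mul_one]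
  refine ⟨fun e ↦ ?_⟩
  have h : 𝓝 e = ⨅ k : κ, comap (p k) (𝓝 (p k e)) := by
    refine le_antisymm (le_iInf fun k ↦
      ((D k).continuous_restrict _).continuousAt.tendsto.le_comap) ?_
    rw [nhds_iInf]
    refine le_iInf fun q ↦ ?_
    rw [nhds_induced, ← tendsto_iff_comap]
    obtain ⟨s, C, hC⟩ := hdom q.1 q.2
    refine tendsto_iff_norm_sub_tendsto_zero.2 ?_
    have h1 : Tendsto (fun e' ↦ C * ∑ k ∈ s, ‖p k e' - p k e‖)
        (⨅ k : κ, comap (p k) (𝓝 (p k e))) (𝓝 (C * ∑ k ∈ s, 0)) :=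
      (tendsto_finsetSum _ fun k _ ↦ tendsto_iff_norm_sub_tendsto_zero.1
        (tendsto_comap.mono_left (iInf_le _ k))).const_mul C
    rw [Finset.sum_const_zero, mul_zero] at h1
    refine squeeze_zero (fun _ ↦ norm_nonneg _) (fun e' ↦ ?_) h1
    have := hC (e' - e)
    simp only [map_sub] at this
    exact this
  rw [h]
  infer_instance

/-- The elements of a bounded set of sections can be summed with summable coefficients. -/
theorem HermBundle.exists_sum [DecidableEq ι] (b : ι → V.Sec)
    (hb : Bornology.IsVonNBounded ℂ (range b)) :
    ∃ Θ : lp (fun _ : ι ↦ ℂ) 1 →L[ℂ] V.Sec, (∀ i, Θ (lp.single 1 i 1) = b i) ∧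
      ∀ K, IsClosed K → (∀ i, V.supp (b i) ⊆ K) → ∀ a, V.supp (Θ a) ⊆ K := by
  obtain ⟨I, -, hI⟩ := V.exists_countable_cover
  obtain ⟨Θ, hΘ⟩ := HermBundle.exists_sum_of_bounded hI b fun i hi l ↦
    HermBundle.bounded_wordDeriv_loc b i l fun c ↦ by
      obtain ⟨C, hC⟩ := (V.locOp i l (coordCLM V.F c)).bounded_of_isVonNBounded (V.bumpSupp i) hb
      exact ⟨C, fun m ↦ hC _ (mem_range_self m)⟩
  refine ⟨Θ, fun m ↦ HermBundle.sec_ext fun x ↦ ?_, fun K hK hbK a ↦ ?_⟩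
  · refine sub_eq_zero.1 (V.form_nondeg x _ fun e ↦ ?_)
    rw [V.form_symm, map_sub, hΘ, tsum_eq_single m fun j hj ↦ by
      rw [lp.single_apply_ne _ _ _ hj, zero_mul], lp.single_apply_self, one_mul, sub_self, map_zero]
  · refine HermBundle.supp_subset_of_closed hK fun x hx ↦ ?_
    refine V.form_nondeg x _ fun e ↦ ?_
    have h0 : ∀ m, b m x = 0 := fun m ↦
      HermBundle.eq_zero_of_notMem_supp fun h ↦ hx (hbK m h)
    rw [V.form_symm, hΘ]
    simp [h0]

/-- A pointwise bounded family of continuous linear forms on `Γ(M;V)` is uniformly bounded on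
bounded sets. -/
theorem HermBundle.bounded_of_pointwise (T : ι → V.Sec →L[ℂ] ℂ)
    (hT : ∀ s, ∃ C, ∀ i, ‖T i s‖ ≤ C) {B : Set V.Sec} (hB : Bornology.IsVonNBounded ℂ B) :
    ∃ C, ∀ i, ∀ s ∈ B, ‖T i s‖ ≤ C := by
  classical
  obtain ⟨Θ, hΘ, -⟩ := V.exists_sum (fun s : B ↦ s.1) (by simpa using hB)
  obtain ⟨C, hC⟩ := banach_steinhaus (g := fun i ↦ T i ∘L Θ) fun a ↦ hT (Θ a)
  refine ⟨C, fun i s hs ↦ ?_⟩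
  have h1 := (T i ∘L Θ).le_opNorm (lp.single 1 ⟨s, hs⟩ 1)
  rw [lp.norm_single one_pos, norm_one, mul_one, ContinuousLinearMap.comp_apply, hΘ] at h1
  exact h1.trans (hC i)

theorem HermBundle.bounded_of_pointwise_antilinear (T : ι → V.Sec →SL[starRingEnd ℂ] ℂ)
    (hT : ∀ s, ∃ C, ∀ i, ‖T i s‖ ≤ C) {B : Set V.Sec} (hB : Bornology.IsVonNBounded ℂ B) :
    ∃ C, ∀ i, ∀ s ∈ B, ‖T i s‖ ≤ C := by
  let T' : ι → V.Sec →L[ℂ] ℂ := fun i ↦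
    { toFun := fun s ↦ starRingEnd ℂ (T i s)
      map_add' := fun s t ↦ by rw [map_add, map_add]
      map_smul' := fun c s ↦ by
        rw [map_smulₛₗ, smul_eq_mul, map_mul, Complex.conj_conj, RingHom.id_apply, smul_eq_mul]
      cont := Complex.continuous_conj.comp (T i).continuous }
  have h : ∀ i s, ‖T' i s‖ = ‖T i s‖ := fun i s ↦ RCLike.norm_conj _
  simp_rw [← h] at hT ⊢
  exact HermBundle.bounded_of_pointwise T' hT hB

end Bornology

/-! ### Operators with a weak adjoint -/

section WeakAdjoint

variable {n : ℕ} {M : Type u} [TopologicalSpace M] [ChartedSpace (EuclideanSpace ℝ (Fin n)) M]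
  [T2Space M] [SecondCountableTopology M] [IsManifold (𝓡 n) ∞ M] {V : HermBundle.{u, v, w} n M}
  [MeasurableSpace M] [BorelSpace M] {μ : Measure M} [IsFiniteMeasureOnCompacts μ]
  {n' : ℕ} {M' : Type u} [TopologicalSpace M'] [ChartedSpace (EuclideanSpace ℝ (Fin n')) M']
  [T2Space M'] [SecondCountableTopology M'] [IsManifold (𝓡 n') ∞ M']
  {W : HermBundle.{u, v, w} n' M'} [MeasurableSpace M'] [BorelSpace M'] {μ' : Measure M'}
  [IsFiniteMeasureOnCompacts μ'] [μ'.IsOpenPosMeasure]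

/-- Forms on `Γ_c` given by the pairing with a smooth section depend continuously on sections with
support in a fixed compact set. -/
theorem HermBundle.continuous_comp_of_pair {K : Set M} (hK : IsCompact K) {Y : Type*}
    [TopologicalSpace Y] {θ : Y → V.Sec} (hθ : Continuous θ) (hθK : ∀ a, V.supp (θ a) ⊆ K)
    {φ : V.Secc → ℂ} {r : V.Sec} (hφ : ∀ g : V.Secc, φ g = V.pair μ r g.1) :
    Continuous fun a ↦ φ ⟨θ a, HermBundle.mem_Secc_of_subset hK (hθK a)⟩ := by
  obtain ⟨χ, hχ1, hχc, -, -⟩ := exists_cutoff (n := n) hK isOpen_univ (subset_univ K)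
  have h : ∀ a, φ ⟨θ a, HermBundle.mem_Secc_of_subset hK (hθK a)⟩ =
      V.pair μ (V.fmul χ r) (θ a) := fun a ↦ by
    rw [hφ, V.pair_fmul]
    congr 1
    refine HermBundle.sec_ext fun x ↦ ?_
    rw [V.fmul_apply]
    by_cases hx : x ∈ K
    · rw [hχ1.self_of_nhdsSet x hx, one_smul]
    · rw [HermBundle.eq_zero_of_notMem_supp fun h ↦ hx (hθK a h), smul_zero]
  simp_rw [h]
  exact (V.continuous_pair ⟨V.fmul χ r, V.fmul_mem_Secc hχc r⟩).comp hθ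

/-- Closed graph theorem for operators `Γ_c → Γ` with a formal adjoint of the same type. -/
theorem continuousOnSecc_of_pair {T : V.Secc → W.Sec} (hT : IsLinearMap ℂ T)
    (hadj : ∀ f : W.Secc, ∃ r : V.Sec, ∀ g : V.Secc, W.pair μ' f.1 (T g) = V.pair μ r g.1) :
    ContinuousOnSecc V T := by
  intro K hK
  let ΓK : Submodule ℂ V.Sec :=
    { carrier := {s | V.supp s ⊆ K}
      add_mem' := fun {s t} hs ht ↦ (V.supp_add_subset s t).trans (union_subset hs ht)
      zero_mem' := HermBundle.supp_subset_of_closed hK.isClosed fun x _ ↦ V.zero_apply x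
      smul_mem' := fun c s hs ↦ HermBundle.supp_subset_of_closed hK.isClosed fun x hx ↦ by
        rw [V.smul_apply, HermBundle.eq_zero_of_notMem_supp fun h ↦ hx (hs h), smul_zero] }
  let TK : ΓK →ₗ[ℂ] W.Sec :=
    { toFun := fun s ↦ T ⟨s.1, HermBundle.mem_Secc_of_subset hK s.2⟩
      map_add' := fun s t ↦ hT.map_add ⟨s.1, _⟩ ⟨t.1, _⟩
      map_smul' := fun c s ↦ hT.map_smul c ⟨s.1, _⟩ }
  have : FirstCountableTopology ΓK := Topology.IsInducing.subtypeVal.firstCountableTopology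
  have hTK : Continuous TK := by
    -- a bounded set is contained in the image of the unit ball under a continuous map `ℓ¹ → Γ_K`,
    -- whose composition with `T` is weakly continuous
    refine TK.continuous_of_locally_bounded fun B hB ↦ ?_
    have hB' : Bornology.IsVonNBounded ℂ (range fun s : B ↦ s.1.1) := by
      have h1 := hB.image ΓK.subtypeL
      rwa [image_eq_range] at h1
    classical
    obtain ⟨Θ, hΘ, hsup⟩ := V.exists_sum (fun s : B ↦ s.1.1) hB'
    have hΘK : ∀ a, Θ a ∈ ΓK := fun a ↦ hsup K hK.isClosed (fun s ↦ s.1.2) a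
    let τ : lp (fun _ : B ↦ ℂ) 1 →ₗ[ℂ] W.Sec := TK ∘ₗ Θ.toLinearMap.codRestrict ΓK hΘK
    have hτ : Continuous τ := by
      refine HermBundle.continuous_of_pair (μ := μ') τ fun f ↦ ?_
      obtain ⟨r, hr⟩ := hadj f
      exact HermBundle.continuous_comp_of_pair hK Θ.continuous hΘK
        (φ := fun g ↦ W.pair μ' f.1 (T g)) hr
    refine ((NormedSpace.isVonNBounded_closedBall ℂ (lp (fun _ : B ↦ ℂ) 1) 1).image
      (⟨τ, hτ⟩ : lp (fun _ : B ↦ ℂ) 1 →L[ℂ] W.Sec)).subset ?_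
    rintro _ ⟨s, hs, rfl⟩
    refine ⟨lp.single 1 ⟨s, hs⟩ 1, ?_, ?_⟩
    · rw [mem_closedBall_zero_iff, lp.norm_single one_pos, norm_one]
    · exact congrArg TK (Subtype.ext (hΘ ⟨s, hs⟩))
  rw [continuousOn_iff_continuous_domRestrict]
  refine hTK.comp (Continuous.subtype_mk (f := fun s : {s : V.Secc | V.supp s.1 ⊆ K} ↦ s.1.1)
    (continuous_subtype_val.comp continuous_subtype_val) fun s ↦ s.2)

end WeakAdjoint

/-! ### Operators with compactly supported values -/

section CompactSupport

variable {n : ℕ} {M : Type u} [TopologicalSpace M] [ChartedSpace (EuclideanSpace ℝ (Fin n)) M]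
  [T2Space M] [SecondCountableTopology M] [IsManifold (𝓡 n) ∞ M] {V : HermBundle.{u, v, w} n M}
  [MeasurableSpace M] [BorelSpace M] {μ : Measure M} [IsFiniteMeasureOnCompacts μ]
  {n' : ℕ} {M' : Type u} [TopologicalSpace M'] [ChartedSpace (EuclideanSpace ℝ (Fin n')) M']
  [T2Space M'] [SecondCountableTopology M'] [IsManifold (𝓡 n') ∞ M']
  {W : HermBundle.{u, v, w} n' M'} [MeasurableSpace M'] [BorelSpace M'] {μ' : Measure M'}
  [IsFiniteMeasureOnCompacts μ'] [μ'.IsOpenPosMeasure]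

/-- An operator `Γ_c(M;V) → Γ_c(M';W)` with a weak adjoint maps the sections with support in a
compact set to sections with support in a compact set: otherwise some summable combination of
rescaled counterexamples would have non-compactly supported image, by the Baire category theorem. -/
theorem exists_compact_supp {T : V.Secc →ₗ[ℂ] W.Secc}
    (hadj : ∀ f : W.Secc, ∃ r : V.Sec, ∀ g : V.Secc,
      W.pair μ' f.1 (T g).1 = V.pair μ r g.1) {K : Set M} (hK : IsCompact K) :
    ∃ K' : Set M', IsCompact K' ∧ ∀ g : V.Secc, V.supp g.1 ⊆ K → W.supp (T g).1 ⊆ K' := by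
  have : LocallyCompactSpace M' := Manifold.locallyCompact_of_finiteDimensional (𝓡 n')
  by_contra! hcon
  let E := CompactExhaustion.choice M'
  have h0 : ∀ m, ∃ g : V.Secc, V.supp g.1 ⊆ K ∧ ¬ W.supp (T g).1 ⊆ E m := fun m ↦
    hcon (E m) (E.isCompact m)
  choose g hgK hg using h0
  obtain ⟨U, hU⟩ := (𝓝 (0 : V.Sec)).exists_antitone_basis
  have h1 : ∀ m, ∃ c : ℂ, c ≠ 0 ∧ c • (g m).1 ∈ U m := fun m ↦ by
    have h2 : Tendsto (fun c : ℂ ↦ c • (g m).1) (𝓝[≠] 0) (𝓝 ((0 : ℂ) • (g m).1)) :=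
      ((continuous_id.smul continuous_const).tendsto (0 : ℂ)).mono_left nhdsWithin_le_nhds
    rw [zero_smul] at h2
    obtain ⟨c, hc, hc0⟩ := ((h2.eventually (hU.1.mem_of_mem (i := m) trivial)).and
      self_mem_nhdsWithin).exists
    exact ⟨c, hc0, hc⟩
  choose c hc0 hcU using h1
  let b : ℕ → V.Secc := fun m ↦ c m • g m
  have hbK : ∀ m, V.supp (b m).1 ⊆ K := fun m ↦
    HermBundle.supp_subset_of_closed hK.isClosed fun x hx ↦ by
      change c m • (g m).1 x = 0
      rw [HermBundle.eq_zero_of_notMem_supp fun h ↦ hx (hgK m h), smul_zero]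
  have hb : Tendsto (fun m ↦ (b m).1) atTop (𝓝 0) := hU.tendsto hcU
  obtain ⟨Θ, hΘ, hsup⟩ := V.exists_sum (fun m ↦ (b m).1) (hb.isVonNBounded_range ℂ)
  have hΘK : ∀ a, V.supp (Θ a) ⊆ K := hsup K hK.isClosed hbK
  let τ : lp (fun _ : ℕ ↦ ℂ) 1 →ₗ[ℂ] W.Secc :=
    T ∘ₗ Θ.toLinearMap.codRestrict V.Secc fun a ↦ HermBundle.mem_Secc_of_subset hK (hΘK a)
  have hcont : ∀ f : W.Secc, Continuous fun a ↦ W.pair μ' f.1 (τ a).1 := fun f ↦ by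
    obtain ⟨r, hr⟩ := hadj f
    exact HermBundle.continuous_comp_of_pair hK Θ.continuous hΘK (φ := fun g ↦ W.pair μ' f.1 (T g).1)
      hr
  -- `F m` consists of the coefficients for which the image is supported in the `m`-th compact set
  let F : ℕ → Submodule ℂ (lp (fun _ : ℕ ↦ ℂ) 1) := fun m ↦
    ⨅ f : {f : W.Secc // W.supp f.1 ⊆ (E m)ᶜ},
      LinearMap.ker (W.pairL μ' f.1 ∘ₗ W.Secc.subtype ∘ₗ τ)
  have hF : ∀ m a, a ∈ F m ↔ ∀ f : W.Secc, W.supp f.1 ⊆ (E m)ᶜ → W.pair μ' f.1 (τ a).1 = 0 := by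
    intro m a
    rw [Submodule.mem_iInf]
    exact ⟨fun h f hf ↦ h ⟨f, hf⟩, fun h f ↦ h f.1 f.2⟩
  have hclosed : ∀ m, IsClosed (F m : Set (lp (fun _ : ℕ ↦ ℂ) 1)) := fun m ↦ by
    have h2 : (F m : Set (lp (fun _ : ℕ ↦ ℂ) 1)) =
        ⋂ f : {f : W.Secc // W.supp f.1 ⊆ (E m)ᶜ}, {a | W.pair μ' f.1.1 (τ a).1 = 0} := by
      ext a
      rw [SetLike.mem_coe, hF, mem_iInter]
      exact ⟨fun h f ↦ h f.1 f.2, fun h f hf ↦ h ⟨f, hf⟩⟩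
    rw [h2]
    exact isClosed_iInter fun f ↦ isClosed_eq (hcont f.1) continuous_const
  have hcover : ⋃ m, (F m : Set (lp (fun _ : ℕ ↦ ℂ) 1)) = univ := by
    refine eq_univ_of_forall fun a ↦ ?_
    obtain ⟨m, hm⟩ := E.exists_superset_of_isCompact (τ a).2
    refine mem_iUnion.2 ⟨m, (hF m a).2 fun f hf ↦ ?_⟩
    refine (W.pair_congr_right (t' := 0) fun x hx ↦ ?_).trans (W.pair_zero_right _)
    exact HermBundle.eq_zero_of_notMem_supp fun h ↦ hf hx (hm h)
  obtain ⟨m, hm⟩ := nonempty_interior_of_iUnion_of_closed hclosed hcover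
  -- a subspace with interior points is everything, which contradicts the choice of `g m`
  have htop : F m = ⊤ := (F m).eq_top_of_nonempty_interior' hm
  refine hg m ?_
  have h3 : ∀ x ∉ E m, (τ (lp.single 1 m 1)).1 x = 0 := fun x hx ↦
    HermBundle.eq_zero_of_pair_eq_zero (μ := μ') (E.isCompact m).isClosed.isOpen_compl
      ((hF m _).1 (htop ▸ Submodule.mem_top)) x hx
  have h4 : τ (lp.single 1 m 1) = c m • T (g m) := by
    rw [← map_smul]
    exact congrArg T (Subtype.ext (hΘ m))
  rw [h4] at h3
  refine HermBundle.supp_subset_of_closed (E.isCompact m).isClosed fun x hx ↦ ?_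
  exact (smul_eq_zero.1 (h3 x hx : c m • (T (g m)).1 x = 0)).resolve_left (hc0 m)

/-- The extension of a weak adjoint `Γ_c(M';W) → Γ(M;V)` to all smooth sections. -/
theorem exists_extension [μ.IsOpenPosMeasure] {T : V.Secc →ₗ[ℂ] W.Secc}
    (hadj : ∀ f : W.Secc, ∃ r : V.Sec, ∀ g : V.Secc,
      W.pair μ' f.1 (T g).1 = V.pair μ r g.1) :
    ∃ Z : W.Sec →ₗ[ℂ] V.Sec, ∀ (g : V.Secc) t, V.pair μ g.1 (Z t) = W.pair μ' (T g).1 t := by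
  have : LocallyCompactSpace M := Manifold.locallyCompact_of_finiteDimensional (𝓡 n)
  have hloc : ∀ t (K : Set M), IsCompact K → ∃ z : V.Sec, ∀ g : V.Secc, V.supp g.1 ⊆ K →
      V.pair μ g.1 z = W.pair μ' (T g).1 t := by
    intro t K hK
    obtain ⟨K', hK', hT⟩ := exists_compact_supp hadj hK
    obtain ⟨χ, hχ1, hχc, -, -⟩ := exists_cutoff (n := n') hK' isOpen_univ (subset_univ K')
    obtain ⟨z, hz⟩ := hadj ⟨W.fmul χ t, W.fmul_mem_Secc hχc t⟩
    refine ⟨z, fun g hg ↦ ?_⟩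
    rw [V.pair_conj, ← hz, ← W.pair_conj]
    refine W.pair_congr_right fun x hx ↦ ?_
    rw [W.fmul_apply, hχ1.self_of_nhdsSet x (hT g hg hx), one_smul]
  have hex : ∀ t, ∃ z : V.Sec, ∀ g : V.Secc, V.pair μ g.1 z = W.pair μ' (T g).1 t := by
    intro t
    choose z hz using hloc t
    -- the local solutions agree on overlaps and are glued
    have hagree : ∀ K L (hK : IsCompact K) (hL : IsCompact L), ∀ x ∈ interior K ∩ interior L,
        z K hK x = z L hL x := fun K L hK hL x hx ↦ by
      refine sub_eq_zero.1 (HermBundle.eq_zero_of_pair_eq_zero (μ := μ) (t := z K hK - z L hL)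
        (isOpen_interior.inter isOpen_interior) (fun f hf ↦ ?_) x hx)
      rw [V.pair_sub_right, hz K hK f (hf.trans (inter_subset_left.trans interior_subset)),
        hz L hL f (hf.trans (inter_subset_right.trans interior_subset)), sub_self]
    choose N hN hxN using fun x : M ↦ exists_compact_mem_nhds x
    have hs : V.IsSmooth fun x ↦ z (N x) (hN x) x := by
      refine V.isSmooth_of_eventually fun x ↦ ⟨z (N x) (hN x), ?_⟩
      filter_upwards [interior_mem_nhds.2 (hxN x)] with y hy
      exact hagree _ _ _ _ y ⟨mem_interior_iff_mem_nhds.2 (hxN y), hy⟩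
    refine ⟨⟨_, hs⟩, fun g ↦ ?_⟩
    obtain ⟨L, hL, hgL⟩ := exists_compact_superset g.2
    rw [← hz L hL g (hgL.trans interior_subset)]
    refine V.pair_congr_right fun x hx ↦ ?_
    exact hagree _ _ _ _ x ⟨mem_interior_iff_mem_nhds.2 (hxN x), hgL hx⟩
  choose Z hZ using hex
  refine ⟨⟨⟨Z, fun t t' ↦ ?_⟩, fun c t ↦ ?_⟩, fun g t ↦ hZ t g⟩
  · refine HermBundle.ext_of_pair (μ := μ) fun g ↦ ?_
    rw [hZ, V.pair_add_right, hZ, hZ, W.pair_add_right]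
  · refine HermBundle.ext_of_pair (μ := μ) fun g ↦ ?_
    rw [hZ, RingHom.id_apply, V.pair_smul_right, hZ, W.pair_smul_right]

end CompactSupport

/-! ### Rapid decay of oscillatory pairings -/

section Decay

open scoped FourierTransform

/-- The Fourier transform of a test function decays rapidly. -/
theorem exists_fourier_decay {n : ℕ} {F : EuclideanSpace ℝ (Fin n) → ℂ} (hF : ContDiff ℝ ∞ F)
    (hc : HasCompactSupport F) (N : ℕ) :
    ∃ C, ∀ ξ : EuclideanSpace ℝ (Fin n) →L[ℝ] ℝ,
      (1 + ‖ξ‖) ^ N * ‖∫ y, exp (-(I * (ξ y : ℝ))) * F y‖ ≤ C := by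
  let f := 𝓕 (hc.toSchwartzMap hF)
  refine ⟨(2 * Real.pi) ^ N * (2 ^ N * (Finset.Iic (N, 0)).sup
    (fun m ↦ SchwartzMap.seminorm ℝ m.1 m.2) f), fun ξ ↦ ?_⟩
  have hπ : 1 ≤ 2 * Real.pi := by linarith [Real.pi_gt_three]
  have hπ0 : 0 < 2 * Real.pi := by linarith
  -- the frequency at which the Fourier transform, normalized with `2π`, has phase `ξ`
  set q : EuclideanSpace ℝ (Fin n) :=
    (2 * Real.pi)⁻¹ • (InnerProductSpace.toDual ℝ (EuclideanSpace ℝ (Fin n))).symm ξ with hq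
  have hqn : ‖q‖ = (2 * Real.pi)⁻¹ * ‖ξ‖ := by
    rw [hq, norm_smul, LinearIsometryEquiv.norm_map, Real.norm_of_nonneg (inv_pos.2 hπ0).le]
  have hin : ∀ y, 2 * Real.pi * inner ℝ y q = ξ y := fun y ↦ by
    rw [hq, inner_smul_right, real_inner_comm, InnerProductSpace.toDual_symm_apply,
      mul_inv_cancel_left₀ hπ0.ne']
  have h1 : f q = ∫ y, exp (-(I * (ξ y : ℝ))) * F y := by
    change 𝓕 F q = _
    rw [Real.fourier_eq']
    refine integral_congr_ae (Eventually.of_forall fun y ↦ ?_)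
    change _ • F y = exp (-(I * (ξ y : ℝ))) * F y
    rw [smul_eq_mul, neg_mul, neg_mul, hin, mul_comm I, ofReal_neg, neg_mul]
  have h2 := SchwartzMap.one_add_le_sup_seminorm_apply (𝕜 := ℝ) (m := (N, 0)) le_rfl le_rfl f q
  rw [norm_iteratedFDeriv_zero] at h2
  rw [← h1]
  have h3 : 1 + ‖ξ‖ ≤ 2 * Real.pi * (1 + ‖q‖) := by
    rw [hqn, mul_add, mul_inv_cancel_left₀ hπ0.ne', mul_one]
    linarith
  calc (1 + ‖ξ‖) ^ N * ‖f q‖ ≤ (2 * Real.pi * (1 + ‖q‖)) ^ N * ‖f q‖ := by gcongr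
    _ = (2 * Real.pi) ^ N * ((1 + ‖q‖) ^ N * ‖f q‖) := by rw [mul_pow, mul_assoc]
    _ ≤ _ := by gcongr

variable {n : ℕ} {M : Type u} [TopologicalSpace M] [ChartedSpace (EuclideanSpace ℝ (Fin n)) M]
  [T2Space M] [SecondCountableTopology M] [IsManifold (𝓡 n) ∞ M] {V : HermBundle.{u, v, w} n M}
  [MeasurableSpace M] [BorelSpace M] {μ : Measure M}
  {g : ∀ x : M, TangentSpace (𝓡 n) x →ₗ[ℝ] TangentSpace (𝓡 n) x →ₗ[ℝ] ℝ}

/-- The pairing of a smooth section with a localized section that oscillates in a chart decays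
rapidly with the frequency. -/
theorem IsSmoothMetric.exists_decay (hg : IsSmoothMetric g) (hμ : IsVolume g μ) (x : M)
    {a : V.Secc} (ha : V.supp a.1 ⊆ (extChartAt (𝓡 n) x).source) (t : V.Sec) (N : ℕ) :
    ∃ C, ∀ (ξ : EuclideanSpace ℝ (Fin n) →L[ℝ] ℝ) (a' : V.Sec),
      (∀ z, a' z = exp (I * (ξ (extChartAt (𝓡 n) x z) : ℝ)) • a.1 z) →
        (1 + ‖ξ‖) ^ N * ‖V.pair μ a' t‖ ≤ C := by
  classical
  set φ := extChartAt (𝓡 n) x with hφ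
  -- in the chart, the pairing is the Fourier transform of the test function `|det g|^{1/2} (a|t)`
  let F : EuclideanSpace ℝ (Fin n) → ℂ := φ.target.indicator fun y ↦
    density g x y • V.form (φ.symm y) (a.1 (φ.symm y)) (t (φ.symm y))
  have h0 : ∀ y ∉ φ '' V.supp a.1, F y = 0 := fun y hy ↦ by
    by_cases hyt : y ∈ φ.target
    · have h1 : φ.symm y ∉ V.supp a.1 := fun h ↦ hy ⟨_, h, φ.right_inv hyt⟩
      refine (indicator_of_mem hyt _).trans ?_
      rw [HermBundle.form_eq_zero fun h ↦ h1 h.1, smul_zero]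
    · exact indicator_of_notMem hyt _
  have hK : IsCompact (φ '' V.supp a.1) :=
    IsCompact.image_of_continuousOn a.2 ((continuousOn_extChartAt x).mono ha)
  have hF : ContDiff ℝ ∞ F := by
    refine contDiff_iff_contDiffAt.2 fun y ↦ ?_
    by_cases hy : y ∈ φ '' V.supp a.1
    · have hyt : y ∈ φ.target := by
        obtain ⟨z, hz, rfl⟩ := hy
        exact φ.map_source (ha hz)
      have hn : φ.target ∈ 𝓝 y := (isOpen_extChartAt_target x).mem_nhds hyt
      have h1 := (hg.contDiffOn_density x).contDiffAt hn
      have h2 := contDiffAt_comp_symm x hyt ((V.form_smooth a.1 t a.1.2 t.2).contMDiffAt)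
      refine (h1.smul h2).congr_of_eventuallyEq ?_
      filter_upwards [hn] with z hz
      exact indicator_of_mem hz _
    · refine (contDiffAt_const (c := (0 : ℂ))).congr_of_eventuallyEq ?_
      filter_upwards [hK.isClosed.isOpen_compl.mem_nhds hy] with z hz
      exact h0 z hz
  obtain ⟨C, hC⟩ := exists_fourier_decay hF (HasCompactSupport.intro hK h0) N
  refine ⟨C, fun ξ a' ha' ↦ ?_⟩
  have h1 : V.pair μ a' t = ∫ y, exp (-(I * (ξ y : ℝ))) * F y := by
    unfold HermBundle.pair
    have hs : (Function.support fun z ↦ V.form z (a' z) (t z)) ⊆ φ.source := fun z hz ↦ by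
      by_contra hz'
      refine hz ?_
      change V.form z (a' z) (t z) = 0
      rw [ha', HermBundle.eq_zero_of_notMem_supp fun h ↦ hz' (ha h), smul_zero, map_zero,
        LinearMap.zero_apply]
    rw [hg.integral_chart hμ x (V.continuous_form a' t) hs,
      ← integral_indicator (isOpen_extChartAt_target x).measurableSet]
    refine integral_congr_ae (Eventually.of_forall fun y ↦ ?_)
    change φ.target.indicator _ y = _ * φ.target.indicator _ y
    by_cases hy : y ∈ φ.target
    · rw [indicator_of_mem hy, indicator_of_mem hy, ha', LinearMap.map_smulₛₗ,
        LinearMap.smul_apply, ← exp_conj, map_mul, conj_I, conj_ofReal, φ.right_inv hy, neg_mul,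
        smul_eq_mul, mul_smul_comm]
    · rw [indicator_of_notMem hy, indicator_of_notMem hy, mul_zero]
  rw [h1]
  exact hC ξ

variable [IsFiniteMeasureOnCompacts μ]
  {n' : ℕ} {M' : Type u} [TopologicalSpace M'] [ChartedSpace (EuclideanSpace ℝ (Fin n')) M']
  [T2Space M'] [SecondCountableTopology M'] [IsManifold (𝓡 n') ∞ M']
  {W : HermBundle.{u, v, w} n' M'} [MeasurableSpace M'] [BorelSpace M'] {μ' : Measure M'}
  [IsFiniteMeasureOnCompacts μ']

/-- If `T : Γ_c(M;V) → Γ_c(M';W)` has an adjoint `Z : Γ(M';W) → Γ(M;V)` and `A` is smoothing, then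
the bilinear form `(T u|G A T v)` has no wave front set. The rapidly decaying families `(1+|η|)^N T
v` are weakly, hence strongly bounded in the dual of `Γ(M';W)`, so that `A` maps them to bounded
sets of smooth sections, on which the forms `(1+|ξ|)^N (T u|·)` are uniformly bounded. -/
theorem IsSmoothing.exists_decay {A : W.Secc → W.Sec} (hA : IsSmoothing W μ' A)
    (hg : IsSmoothMetric g) (hμ : IsVolume g μ) {T : V.Secc → W.Secc} {Z : W.Sec → V.Sec}
    (hZ : ∀ (u : V.Secc) t, V.pair μ u.1 (Z t) = W.pair μ' (T u).1 t) (G : W.Sec →L[ℂ] W.Sec)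
    (x y : M) {a b : V.Secc} (ha : V.supp a.1 ⊆ (extChartAt (𝓡 n) x).source)
    (hb : V.supp b.1 ⊆ (extChartAt (𝓡 n) y).source) (N : ℕ) :
    ∃ C, ∀ (ξ η : EuclideanSpace ℝ (Fin n) →L[ℝ] ℝ) (a' b' : V.Secc),
      (∀ z, a'.1 z = exp (I * (ξ (extChartAt (𝓡 n) x z) : ℝ)) • a.1 z) →
      (∀ z, b'.1 z = exp (I * (η (extChartAt (𝓡 n) y z) : ℝ)) • b.1 z) →
        (1 + ‖ξ‖) ^ N * (1 + ‖η‖) ^ N * ‖W.pair μ' (T a').1 (G (A (T b')))‖ ≤ C := by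
  obtain ⟨A', hA'⟩ := hA
  let J (x : M) (a : V.Secc) := {q : (EuclideanSpace ℝ (Fin n) →L[ℝ] ℝ) × V.Secc //
    ∀ z, q.2.1 z = exp (I * (q.1 (extChartAt (𝓡 n) x z) : ℝ)) • a.1 z}
  let wgt (ξ : EuclideanSpace ℝ (Fin n) →L[ℝ] ℝ) : ℂ := (((1 + ‖ξ‖) ^ N : ℝ) : ℂ)
  have hw : ∀ ξ, ‖wgt ξ‖ = (1 + ‖ξ‖) ^ N := fun ξ ↦ by
    rw [Complex.norm_real, Real.norm_of_nonneg (by positivity)]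
  let R : W.Secc → W.Sec →SL[starRingEnd ℂ] ℂ := fun s ↦
    { toFun := fun t ↦ W.pair μ' t s.1
      map_add' := fun t t' ↦ by
        rw [W.pair_conj, W.pair_add_right, map_add, ← W.pair_conj, ← W.pair_conj]
      map_smul' := fun c t ↦ W.pair_smul_left t s.1 c
      cont := by
        simp_rw [fun t ↦ W.pair_conj (μ := μ') t s.1]
        exact Complex.continuous_conj.comp (W.continuous_pair s) }
  let τ : J y b → W.Sec →SL[starRingEnd ℂ] ℂ := fun j ↦ wgt j.1.1 • R (T j.1.2)
  have hτ : ∀ t, ∃ C, ∀ j, ‖τ j t‖ ≤ C := fun t ↦ by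
    obtain ⟨C, hC⟩ := hg.exists_decay hμ y hb (Z t) N
    refine ⟨C, fun j ↦ ?_⟩
    change ‖wgt j.1.1 * W.pair μ' t (T j.1.2).1‖ ≤ C
    rw [W.pair_conj, ← hZ, norm_mul, hw, RCLike.norm_conj]
    exact hC _ _ j.2
  have hbd : Bornology.IsVonNBounded ℂ (range τ) := by
    refine ContinuousLinearMap.isVonNBounded_iff.2 fun B hB ↦ ?_
    obtain ⟨C, hC⟩ := HermBundle.bounded_of_pointwise_antilinear τ hτ hB
    refine (NormedSpace.isVonNBounded_iff' ℂ).2 ⟨C, ?_⟩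
    rintro _ ⟨_, ⟨j, rfl⟩, s, hs, rfl⟩
    exact hC j s hs
  let σ : J x a → W.Sec →L[ℂ] ℂ := fun i ↦ wgt i.1.1 • (W.pairCL μ' (T i.1.2) ∘L G)
  have hσ : ∀ t, ∃ C, ∀ i, ‖σ i t‖ ≤ C := fun t ↦ by
    obtain ⟨C, hC⟩ := hg.exists_decay hμ x ha (Z (G t)) N
    refine ⟨C, fun i ↦ ?_⟩
    change ‖wgt i.1.1 * W.pair μ' (T i.1.2).1 (G t)‖ ≤ C
    rw [← hZ, norm_mul, hw]
    exact hC _ _ i.2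
  obtain ⟨C, hC⟩ := HermBundle.bounded_of_pointwise σ hσ (hbd.image A')
  refine ⟨C, fun ξ η a' b' ha' hb' ↦ ?_⟩
  have h1 := hC ⟨(ξ, a'), ha'⟩ _ (mem_image_of_mem A' (mem_range_self ⟨(η, b'), hb'⟩))
  have h2 : A' (τ ⟨(η, b'), hb'⟩) = wgt η • A (T b') :=
    (map_smul A' _ _).trans (congrArg _ (hA' (T b') (R (T b')) fun _ ↦ rfl))
  rw [h2, map_smul, norm_smul, hw] at h1
  change _ * ‖wgt ξ * W.pair μ' (T a').1 (G (A (T b')))‖ ≤ C at h1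
  rw [norm_mul, hw] at h1
  rwa [mul_comm ((1 + ‖ξ‖) ^ N), mul_assoc]

/-- Adding a rapidly decaying form does not change the wave front set. -/
theorem NotMemWF.add {lam lam' : V.Secc → V.Sec} {x y : M}
    {ξ η : EuclideanSpace ℝ (Fin n) →L[ℝ] ℝ} (h : NotMemWF V μ lam x ξ y η)
    (hr : ∀ a b : V.Secc, V.supp a.1 ⊆ (extChartAt (𝓡 n) x).source →
      V.supp b.1 ⊆ (extChartAt (𝓡 n) y).source → ∀ N : ℕ, ∃ C, ∀
        (ξ η : EuclideanSpace ℝ (Fin n) →L[ℝ] ℝ) (a' b' : V.Secc),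
        (∀ z, a'.1 z = exp (I * (ξ (extChartAt (𝓡 n) x z) : ℝ)) • a.1 z) →
        (∀ z, b'.1 z = exp (I * (η (extChartAt (𝓡 n) y z) : ℝ)) • b.1 z) →
          (1 + ‖ξ‖) ^ N * (1 + ‖η‖) ^ N * ‖V.pair μ a'.1 (lam' b') - V.pair μ a'.1 (lam b')‖ ≤ C) :
    NotMemWF V μ lam' x ξ y η := by
  obtain ⟨U, hU, U', hU', hUs, hUs', Γ, hΓ, hmem, hcone, hdec⟩ := h
  refine ⟨U, hU, U', hU', hUs, hUs', Γ, hΓ, hmem, hcone, fun a b ha hb N ↦ ?_⟩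
  obtain ⟨c, hc⟩ := hdec a b ha hb N
  rw [← extChartAt_source (𝓡 n)] at hUs hUs'
  obtain ⟨C, hC⟩ := hr a b (ha.trans hUs) (hb.trans hUs') N
  refine ⟨c + C, fun p hp a' b' ha' hb' ↦ ?_⟩
  have h1 := hc p hp a' b' ha' hb'
  have h2 := hC p.1 p.2 a' b' ha' hb'
  have hpos : 0 < (1 + ‖p.1‖ + ‖p.2‖) ^ N := by positivity
  have h3 : (1 + ‖p.1‖ + ‖p.2‖) ^ N ≤ (1 + ‖p.1‖) ^ N * (1 + ‖p.2‖) ^ N := by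
    rw [← mul_pow]
    refine pow_le_pow_left₀ (by positivity) ?_ N
    nlinarith [mul_nonneg (norm_nonneg p.1) (norm_nonneg p.2)]
  have h4 : ‖V.pair μ a'.1 (lam' b') - V.pair μ a'.1 (lam b')‖ ≤
      C * ((1 + ‖p.1‖ + ‖p.2‖) ^ N)⁻¹ := by
    rw [← div_eq_mul_inv, le_div_iff₀ hpos, mul_comm]
    exact (mul_le_mul_of_nonneg_right h3 (norm_nonneg _)).trans h2
  calc ‖V.pair μ a'.1 (lam' b')‖
      = ‖V.pair μ a'.1 (lam b') + (V.pair μ a'.1 (lam' b') - V.pair μ a'.1 (lam b'))‖ := by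
        rw [add_sub_cancel]
    _ ≤ _ := norm_add_le _ _
    _ ≤ _ := add_le_add h1 h4
    _ = _ := (add_mul _ _ _).symm

end Decay

/-! ### Spacetime two-point functions from Cauchy surface two-point functions -/

section Spacetime

variable {d : ℕ} {M : Type u} [TopologicalSpace M]
  [ChartedSpace (EuclideanSpace ℝ (Fin (d + 1))) M] [IsManifold (𝓡 (d + 1)) ∞ M]
  [MeasurableSpace M] [T2Space M] [SecondCountableTopology M] [BorelSpace M]
  {S : Type u} [TopologicalSpace S] [ChartedSpace (EuclideanSpace ℝ (Fin d)) S]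
  [IsManifold (𝓡 d) ∞ S] [MeasurableSpace S] [T2Space S] [SecondCountableTopology S] [BorelSpace S]
  {X : Spacetime (d + 1) M} {Sg : CauchySurface X S}

section General

variable {V : HermBundle.{u, v, w} (d + 1) M} {D : V.Sec →ₗ[ℂ] V.Sec} {Gr : GreenOps X V D}
  (C : CauchyData Sg Gr)

/-- `ρG` as a linear map `Γ_c(M;V) → Γ_c(Σ;W)`. -/
def CauchyData.ρGL : V.Secc →ₗ[ℂ] C.W.Secc where
  toFun := C.ρG
  map_add' u v := Subtype.ext (by
    rw [C.ρG_coe, map_add, map_add]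
    rfl)
  map_smul' c u := Subtype.ext (by
    rw [C.ρG_coe, map_smul, map_smul]
    rfl)

/-- The weak adjoint of `ρG` maps `f` to the solution with Cauchy data `G_Σ⁻¹ f`. -/
theorem CauchyData.exists_weak_adjoint (hD : IsDiffOp D) (hadj : IsFormalAdj X.vol D D)
    (f : C.W.Secc) : ∃ r : V.Sec, ∀ g : V.Secc,
      C.W.pair Sg.vol f.1 (C.ρGL g).1 = V.pair X.vol r g.1 := by
  refine ⟨C.sol (C.GSinv_diff.onSecc f), fun g ↦ ?_⟩
  rw [V.pair_conj, C.pair_sol hD hadj, C.W.pair_conj]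
  congr 2
  exact (C.GS_GSinv f.1).symm

/-- `(ρG)* : Γ(Σ;W) → Γ(M;V)`, the adjoint of `ρG`. -/
theorem CauchyData.exists_adjoint (hD : IsDiffOp D) (hadj : IsFormalAdj X.vol D D) :
    ∃ Z : C.W.Sec →ₗ[ℂ] V.Sec, ∀ (u : V.Secc) t,
      V.pair X.vol u.1 (Z t) = C.W.pair Sg.vol (C.ρG u).1 t :=
  exists_extension (T := C.ρGL) (C.exists_weak_adjoint hD hadj)

theorem CauchyData.ρG_eq_zero {a b : V.Secc} (h : b.1 = D a.1) : C.ρG b = 0 := by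
  refine Subtype.ext ?_
  rw [C.ρG_coe, Gr.G_apply, Gr.ret_D a b h, Gr.adv_D a b h, sub_self, map_zero]
  rfl

variable {C}

/-- `(ρG)* λ_Σ^± (ρG)` are spacetime two-point functions. -/
theorem CauchyData.IsTwoPoint.spacetime {lamS : ℤˣ → C.W.Secc → C.W.Sec} (h : C.IsTwoPoint lamS)
    (hD : IsDiffOp D) (hadj : IsFormalAdj X.vol D D) {Z : C.W.Sec →ₗ[ℂ] V.Sec}
    (hZ : ∀ (u : V.Secc) t, V.pair X.vol u.1 (Z t) = C.W.pair Sg.vol (C.ρG u).1 t) :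
    GaugeFix.IsTwoPoint Gr fun s v ↦ Z (lamS s (C.ρG v)) := by
  have hlin : ∀ s, IsLinearMap ℂ fun v ↦ Z (lamS s (C.ρG v)) := fun s ↦
    (Z ∘ₗ (h.linear s).mk' _ ∘ₗ C.ρGL).isLinear
  have hsym : ∀ s (a b : V.Secc), V.pair X.vol a.1 (Z (lamS s (C.ρG b))) =
      V.pair X.vol (Z (lamS s (C.ρG a))) b.1 := fun s a b ↦ by
    rw [hZ, h.adj, V.pair_conj _ b.1, hZ, ← C.W.pair_conj]
  refine ⟨hlin, fun s ↦ ?_, hsym, fun a ↦ ?_, fun s a ↦ ?_, fun s a b hab ↦ ?_⟩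
  · exact continuousOnSecc_of_pair (μ := X.vol) (μ' := X.vol) (hlin s) fun f ↦
      ⟨Z (lamS s (C.ρG f)), hsym s f⟩
  · refine HermBundle.ext_of_pair (μ := X.vol) fun u ↦ ?_
    rw [← map_sub, h.ccr, map_smul, V.pair_smul_right, V.pair_smul_right, hZ, C.GS_def]
    rfl
  · refine HermBundle.ext_of_pair (μ := X.vol) fun u ↦ ?_
    rw [hadj.pair_left hD hD u, V.pair_zero_right]
    refine (hZ (hD.onSecc u) _).trans ?_
    rw [C.ρG_eq_zero (a := u) rfl]
    exact C.W.pair_zero_left _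
  · rw [C.ρG_eq_zero hab, (h.linear s).map_zero, map_zero]

/-- Adding smoothing operators to Hadamard two-point functions gives Hadamard two-point functions.
-/
theorem CauchyData.IsHadamard.of_isSmoothing {lamS lamS' : ℤˣ → C.W.Secc → C.W.Sec}
    (h : C.IsHadamard lamS) (h' : C.IsTwoPoint lamS') (hD : IsDiffOp D)
    (hadj : IsFormalAdj X.vol D D) {R : ℤˣ → C.W.Secc → C.W.Sec}
    (hR : ∀ s, IsSmoothing C.W Sg.vol (R s)) (k : ℤˣ → ℂ)
    (hdiff : ∀ s f, lamS s f - lamS' s f = k s • C.GS (R s f)) : C.IsHadamard lamS' := by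
  obtain ⟨-, lam, -, hlam, hWF⟩ := h
  obtain ⟨Z, hZ⟩ := C.exists_adjoint hD hadj
  refine ⟨h', _, h'.spacetime hD hadj hZ, fun s u v a b ha hb ↦ ?_, fun s x ξ y η hne hmem ↦ ?_⟩
  · rw [hZ, show a = C.ρG u from Subtype.ext ha, show b = C.ρG v from Subtype.ext hb]
  · refine hWF s x ξ y η hne fun hnot ↦ hmem (hnot.add fun a b ha hb N ↦ ?_)
    obtain ⟨B, hB⟩ := (hR s).exists_decay X.toPreSpacetime.isSmoothMetric X.isVolume hZ
      ⟨C.GS, C.GS_diff.continuous⟩ x y ha hb N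
    refine ⟨‖k s‖ * B, fun ξ η a' b' ha' hb' ↦ ?_⟩
    have h1 : V.pair X.vol a'.1 (Z (lamS' s (C.ρG b'))) - V.pair X.vol a'.1 (lam s b') =
        -(k s * C.W.pair Sg.vol (C.ρG a').1 (C.GS (R s (C.ρG b')))) := by
      rw [hZ, hlam s a' b' (C.ρG a') (C.ρG b') rfl rfl, ← C.W.pair_smul_right, ← hdiff,
        C.W.pair_sub_right, neg_sub]
    rw [h1, norm_neg, norm_mul, mul_left_comm]
    exact mul_le_mul_of_nonneg_left (hB ξ η a' b' ha' hb') (norm_nonneg _)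

end General

namespace GaugeFixing

variable {T : GaugeTheory.{u, v, w} X} {Q : SurfaceTheory.{u, v, w} Sg T}
  {L : TwoPointData.{u, v, w, h} Q} (A : GaugeFixing L)

theorem isTwoPoint_lamTilde : Q.C₁.IsTwoPoint A.lamTilde where
  linear s := ((((s : ℤ) : ℂ) * I⁻¹) • (Q.C₁.GS ∘ₗ (A.isLinearMap_cTilde s).mk' _)).isLinear
  continuous s K hK := ContinuousOn.const_smul (β := Q.C₁.W.Secc)
    (g := fun f ↦ Q.C₁.GS (A.cTilde s (L.H₁.ofc f)))
    (Q.C₁.GS_diff.continuous.comp_continuousOn (A.continuousOnSecc_cTilde s K hK)) (((s : ℤ) : ℂ) * I⁻¹)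
  adj s f g := by
    rw [lamTilde, lamTilde, HermBundle.pair_smul_right, HermBundle.pair_smul_left, A.cTilde_adj,
      Q.C₁.pair_GS_right T.D₁_diff T.D₁_adj, map_mul, map_inv₀, conj_I, map_intCast, inv_neg]
    ring
  ccr f := by
    have h1 := A.cTilde_add (L.H₁.ofc (Q.C₁.W.fmulc A.x.wt f))
    rw [← A.ofc_eq_xinv₁, L.H₁.incl_ofc] at h1
    rw [lamTilde, lamTilde, ← h1]
    simp only [Units.val_one, Units.val_neg, Int.cast_one, Int.cast_neg, one_mul, neg_mul, neg_smul,
      sub_neg_eq_add, map_add, smul_add]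

/-- `λ_1Σ^± - λ̃_1Σ^± = ±i⁻¹ G_1Σ c_{1 reg}^±`. -/
theorem lam₁_sub_lamTilde (s : ℤˣ) (f : Q.C₁.W.Secc) :
    L.H₁.incl (L.lam₁ s (L.H₁.ofc f)) - A.lamTilde s f = (((s : ℤ) : ℂ) * I⁻¹) •
      Q.C₁.GS (A.cReg (ContinuousLinearMap.id ℂ _ - A.Pidag) A.xK.op s (L.H₁.ofc f)) := by
  have h1 := A.c₁_eq s (L.H₁.ofc (Q.C₁.W.fmulc A.x.wt f))
  rw [← A.ofc_eq_xinv₁] at h1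
  have hs : ((s : ℤ) : ℂ) * ((s : ℤ) : ℂ) = 1 := by
    rcases Int.units_eq_one_or s with rfl | rfl <;> simp
  have h2 : L.H₁.incl (L.lam₁ s (L.H₁.ofc f)) =
      (((s : ℤ) : ℂ) * I⁻¹) • Q.C₁.GS (L.H₁.incl (L.c₁ s (L.H₁.ofc f))) := by
    rw [← L.G₁.spec, L.G₁_c₁, map_smul, smul_smul, mul_mul_mul_comm, hs,
      inv_mul_cancel₀ I_ne_zero, one_mul, one_smul]
  rw [h2, lamTilde, ← smul_sub, ← map_sub, h1, add_sub_cancel_left]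

/-- The two-point functions `λ̃_1Σ^±` are Hadamard if `λ_1Σ^±` are and `c_{1 reg}^±` are smoothing.
-/
theorem isHadamard_lamTilde
    (hR : ∀ s, IsSmoothing Q.C₁.W Sg.vol fun f ↦
      A.cReg (ContinuousLinearMap.id ℂ _ - A.Pidag) A.xK.op s (L.H₁.ofc f))
    (h : Q.C₁.IsHadamard fun s f ↦ L.H₁.incl (L.lam₁ s (L.H₁.ofc f))) :
    Q.C₁.IsHadamard A.lamTilde :=
  h.of_isSmoothing A.isTwoPoint_lamTilde T.D₁_diff T.D₁_adj hR _ A.lam₁_sub_lamTilde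

end GaugeFixing

end Spacetime

end GaugeFix

end

theorem mainTheorem3 {d : ℕ}
    {M : Type u} [TopologicalSpace M] [T2Space M] [SecondCountableTopology M]
    [ChartedSpace (EuclideanSpace ℝ (Fin (d + 1))) M] [IsManifold (𝓡 (d + 1)) ∞ M]
    [MeasurableSpace M] [BorelSpace M]
    {S : Type u} [TopologicalSpace S] [T2Space S] [SecondCountableTopology S]
    [ChartedSpace (EuclideanSpace ℝ (Fin d)) S] [IsManifold (𝓡 d) ∞ S]
    [MeasurableSpace S] [BorelSpace S]
    (X : GaugeFix.Spacetime (d + 1) M) (Sg : GaugeFix.CauchySurface X S)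
    (T : GaugeFix.GaugeTheory.{u, v, w} X) (Q : GaugeFix.SurfaceTheory.{u, v, w} Sg T)
    (L : GaugeFix.TwoPointData.{u, v, w, h} Q) (A : GaugeFix.GaugeFixing.{u, v, w, h} L) :
    -- `c̃` is well defined and continuous `⟨x⟩⁻¹ ℋ₁ → ⟨x⟩ ℋ₁` and `Γ_c → Γ`
    (∀ s, (∀ k, A.InDomBdag (L.H₀.incl (L.c₀ s (L.KdagH (A.xinv₁.op k))))) ∧
      (∃ C : L.H₁.H →L[ℂ] L.H₁.H,
        ∀ k, A.cTilde s (A.xinv₁.op k) = Q.C₁.W.fmul A.x.wt (L.H₁.incl (C k))) ∧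
      IsLinearMap ℂ (fun f : Q.C₁.W.Secc ↦ A.cTilde s (L.H₁.ofc f)) ∧
      GaugeFix.ContinuousOnSecc Q.C₁.W (fun f ↦ A.cTilde s (L.H₁.ofc f))) ∧
    -- `c̃† = c̃`
    (∀ s (f g : Q.C₁.W.Secc),
      Q.C₁.W.pair Sg.vol f.1 (Q.C₁.GS (A.cTilde s (L.H₁.ofc g))) =
        Q.C₁.W.pair Sg.vol (A.cTilde s (L.H₁.ofc f)) (Q.C₁.GS g.1)) ∧
    -- `c̃⁺ + c̃⁻ = 1`
    (∀ k, A.cTilde 1 (A.xinv₁.op k) + A.cTilde (-1) (A.xinv₁.op k) =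
      L.H₁.incl (A.xinv₁.op k)) ∧
    -- `c̃` preserves `Ker K†`, and it maps `Ran K` to `Ran K`
    (∀ s k, Q.Kdag (L.H₁.incl (A.xinv₁.op k)) = 0 → Q.Kdag (A.cTilde s (A.xinv₁.op k)) = 0) ∧
    (∀ s k e, A.xinv₁.op k = L.K.op e →
      ∃ e', A.cTilde s (A.xinv₁.op k) = Q.KS (Q.C₀.W.fmul A.x.wt (L.H₀.incl e'))) ∧
    -- `(f|λ̃ g) = (Π f|λ Π g)` on `Ker K†`
    (∀ s (f g : Q.C₁.W.Secc), Q.Kdag f.1 = 0 → Q.Kdag g.1 = 0 →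
      Q.C₁.W.pair Sg.vol f.1 (A.lamTilde s g) =
        Q.C₁.W.pair Sg.vol f.1 (L.H₁.incl (A.Pi.adj (L.lam₁ s (A.Pi.op (L.H₁.ofc g)))))) ∧
    -- positivity
    (∀ s, (∀ f : Q.C₁.W.Secc, Q.Kdag f.1 = 0 →
        0 ≤ (Q.C₁.W.pair Sg.vol f.1
          (L.H₁.incl (A.Pi.adj (L.lam₁ s (A.Pi.op (L.H₁.ofc f)))))).re) →
      ∀ f : Q.C₁.W.Secc, Q.Kdag f.1 = 0 →
        0 ≤ (Q.C₁.W.pair Sg.vol f.1 (A.lamTilde s f)).re ∧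
          (Q.C₁.W.pair Sg.vol f.1 (A.lamTilde s f)).im = 0) ∧
    -- the products `B† K†` and `Π† K` in the definition of `c_reg` have continuous extensions
    ∃ E J, A.ExtendsBK E ∧ A.ExtendsPiK J ∧
      -- `c = c̃ + c_reg`
      (∀ s k, L.H₁.incl (L.c₁ s (A.xinv₁.op k)) =
        A.cTilde s (A.xinv₁.op k) + A.cReg E J s (A.xinv₁.op k)) ∧
      -- Hadamard property
      ((∀ s, GaugeFix.IsSmoothing Q.C₁.W Sg.vol (fun f ↦ A.cReg E J s (L.H₁.ofc f))) →
        Q.C₁.IsHadamard (fun s f ↦ L.H₁.incl (L.lam₁ s (L.H₁.ofc f))) →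
        Q.C₁.IsHadamard A.lamTilde) := by
  refine ⟨fun s ↦ ⟨fun k ↦ ⟨_, A.incl_xc₀_adj_xKG s k⟩, ⟨A.cTildeH s, A.cTilde_xinv s⟩,
    A.isLinearMap_cTilde s, A.continuousOnSecc_cTilde s⟩, A.cTilde_adj, A.cTilde_add,
    A.Kdag_cTilde, fun s k e hk ↦ ⟨_, A.cTilde_of_range s k e hk⟩, A.pair_lamTilde,
    A.lamTilde_nonneg, _, _, A.extendsBK, A.extendsPiK, A.c₁_eq, A.isHadamard_lamTilde⟩
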